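/- Let $T=(V,E)$ be a tree with a (not necessarily proper) vertex colouring $c\colon V\to[k]$. For $S\subseteq V$ and $u\in V$, a nearest neighbour of $u$ in $S$ is a vertex of $S$ at minimum graph distance from $u$ among all vertices of $S$. A set $S\subseteq V$ is a consistent subset if every vertex $u\in V$ has a nearest neighbour $v$ in $S$ with $c(v)=c(u)$. \textsc{Minimum Consistent Subset} asks for a consistent subset of minimum cardinality. Theorem. There is an $O(2^{4k}n^{2k+3})$-time algorithm for \textsc{Minimum Consistent Subset} on $k$-coloured $n$-vertex trees. More precisely, there are a single word-RAM program (with unit-cost addition, subtraction, multiplication, division with remainder, comparison and indirect memory access) and an absolute constant $C$ such that, for all $n\ge 1$ and $k\ge 1$ and every $n$-vertex tree $T$ with a colouring $c\colon V(T)\to[k]$, the program, given $n$, $k$, the list of colours and the adjacency matrix of $T$, halts after at most $C\cdot 2^{4k}n^{2k+3}$ steps, uses only words holding non-negative integers at most $C\cdot 2^{4k}n^{2k+3}$, and outputs a consistent subset of $T$ of minimum cardinality. -/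

import Mathlib

namespace MinConsistentSubset

/-- The set of nearest neighbours of `u` in `S`: the vertices of `S` at minimum distance
from `u`. (Graph distance; only used for connected graphs.) -/
def nearest {V : Type*} (G : SimpleGraph V) (S : Finset V) (u : V) : Set V :=
  {v | v ∈ S ∧ ∀ w ∈ S, G.dist u v ≤ G.dist u w}

/-- `S` is a consistent subset of the coloured graph `(G, c)`: every vertex has a nearest
neighbour in `S` of its own colour. -/
def IsConsistent {V κ : Type*} (G : SimpleGraph V) (c : V → κ) (S : Finset V) : Prop :=
  ∀ u, ∃ v ∈ nearest G S u, c v = c u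

/-- `S` is a consistent subset of minimum cardinality. -/
def IsMinConsistent {V κ : Type*} (G : SimpleGraph V) (c : V → κ) (S : Finset V) : Prop :=
  IsConsistent G c S ∧ ∀ S' : Finset V, IsConsistent G c S' → S.card ≤ S'.card

end MinConsistentSubset

/-! A word RAM: finitely many registers per program, a random-access memory with indirect
addressing, unit cost for every elementary operation, and a bound `W` on every number that is
ever computed. Programs are written in structured form (sequence, branch, loop). -/

namespace WordRAM

/-- Elementary binary operations on words (subtraction is truncated, division is integral,
comparisons return `0` or `1`). -/
inductive BinOp where
  | add | sub | mul | div | mod | lt | eq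

def BinOp.eval : BinOp → ℕ → ℕ → ℕ
  | .add, a, b => a + b
  | .sub, a, b => a - b
  | .mul, a, b => a * b
  | .div, a, b => a / b
  | .mod, a, b => a % b
  | .lt, a, b => if a < b then 1 else 0
  | .eq, a, b => if a = b then 1 else 0

/-- Expressions: constants, registers, memory cells, binary operations. -/
inductive Expr where
  | const (a : ℕ)
  | reg (x : ℕ)
  | load (e : Expr)
  | bin (o : BinOp) (e f : Expr)

/-- Contents of the registers and of the memory. -/
structure State where
  reg : ℕ → ℕ
  mem : ℕ → ℕ

def State.setReg (s : State) (x a : ℕ) : State :=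
  { s with reg := Function.update s.reg x a }

def State.setMem (s : State) (p a : ℕ) : State :=
  { s with mem := Function.update s.mem p a }

/-- Value of an expression. -/
def Expr.eval (s : State) : Expr → ℕ
  | .const a => a
  | .reg x => s.reg x
  | .load e => s.mem (e.eval s)
  | .bin o e f => o.eval (e.eval s) (f.eval s)

/-- Number of elementary operations in the evaluation of an expression. -/
def Expr.cost : Expr → ℕ
  | .const _ => 1
  | .reg _ => 1
  | .load e => e.cost + 1
  | .bin _ e f => e.cost + f.cost + 1

/-- All numbers (addresses included) occurring in the evaluation are at most `W`. -/
def Expr.Fits (W : ℕ) (s : State) : Expr → Prop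
  | .const a => a ≤ W
  | .reg x => s.reg x ≤ W
  | .load e => e.Fits W s ∧ s.mem (e.eval s) ≤ W
  | .bin o e f => e.Fits W s ∧ f.Fits W s ∧ o.eval (e.eval s) (f.eval s) ≤ W

/-- Programs. `assign x e` is `reg[x] := e`, `store e f` is `mem[e] := f`; the tests of `ite`
and `loop` (a while loop) ask whether the value of the expression is nonzero. -/
inductive Prog where
  | skip
  | assign (x : ℕ) (e : Expr)
  | store (e f : Expr)
  | seq (p q : Prog)
  | ite (e : Expr) (p q : Prog)
  | loop (e : Expr) (p : Prog)

/-- `Exec W p s t s'`: started in state `s`, the program `p` halts in state `s'` after exactly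
`t` steps, and no number occurring in the run exceeds `W`. -/
inductive Exec (W : ℕ) : Prog → State → ℕ → State → Prop where
  | skip (s : State) : Exec W .skip s 1 s
  | assign (s : State) (x : ℕ) (e : Expr) (he : e.Fits W s) :
      Exec W (.assign x e) s (e.cost + 1) (s.setReg x (e.eval s))
  | store (s : State) (e f : Expr) (he : e.Fits W s) (hf : f.Fits W s) :
      Exec W (.store e f) s (e.cost + f.cost + 1) (s.setMem (e.eval s) (f.eval s))
  | seq {s s₁ s₂ : State} {p q : Prog} {t₁ t₂ : ℕ}
      (hp : Exec W p s t₁ s₁) (hq : Exec W q s₁ t₂ s₂) :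
      Exec W (.seq p q) s (t₁ + t₂) s₂
  | ite_true {s s' : State} {e : Expr} {p q : Prog} {t : ℕ}
      (he : e.Fits W s) (hne : e.eval s ≠ 0) (hp : Exec W p s t s') :
      Exec W (.ite e p q) s (e.cost + 1 + t) s'
  | ite_false {s s' : State} {e : Expr} {p q : Prog} {t : ℕ}
      (he : e.Fits W s) (h0 : e.eval s = 0) (hq : Exec W q s t s') :
      Exec W (.ite e p q) s (e.cost + 1 + t) s'
  | loop_true {s s₁ s₂ : State} {e : Expr} {p : Prog} {t₁ t₂ : ℕ}
      (he : e.Fits W s) (hne : e.eval s ≠ 0)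
      (hp : Exec W p s t₁ s₁) (hl : Exec W (.loop e p) s₁ t₂ s₂) :
      Exec W (.loop e p) s (e.cost + 1 + t₁ + t₂) s₂
  | loop_false {s : State} {e : Expr} {p : Prog}
      (he : e.Fits W s) (h0 : e.eval s = 0) :
      Exec W (.loop e p) s (e.cost + 1) s

open Classical in
/-- The input for a coloured graph on the vertices `0, …, n - 1` with colours `0, …, k - 1`:
register `0` holds `n`, register `1` holds `k`, memory cell `v < n` holds the colour of `v`, and
memory cell `n + n * u + v` holds the entry `(u, v)` of the adjacency matrix. All other registers
and cells hold `0`. -/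
noncomputable def inputState {n k : ℕ} (G : SimpleGraph (Fin n)) (c : Fin n → Fin k) : State where
  reg := fun x => if x = 0 then n else if x = 1 then k else 0
  mem := fun a =>
    if h : a < n then (c ⟨a, h⟩ : ℕ)
    else if ∃ u v : Fin n, a = n + n * (u : ℕ) + (v : ℕ) ∧ G.Adj u v then 1
    else 0

/-- The vertex set `S` is the output written in the final state `s`: memory cell `v < n` holds
`1` if `v ∈ S` and `0` otherwise. -/
def IsOutput {n : ℕ} (s : State) (S : Finset (Fin n)) : Prop :=
  ∀ v : Fin n, s.mem (v : ℕ) = if v ∈ S then 1 else 0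

end WordRAM

/-! The algorithm is a dynamic programme over the tree. What a vertex `u` needs to know about a set
`S` of vertices is its *view* of `S`: the distance to the nearest elements of `S` together with the
bitmask of their colours. Views of disjoint unions are obtained by `Profile.merge` (the smaller
distance wins, ties unite the colours), and moving one edge away is `Profile.shift`; the two
operations commute. There are at most `M = (n + 1) * 2 ^ k` profiles, and `S` is consistent if
and only if the colour of every vertex occurs in its view of `S` (`isConsistent_iff_view`).

If a cluster `A` of vertices is attached to the rest of the tree through its root `r` only, then
a set chosen outside `A` influences the vertices of `A` only through the profile `τ` that `r` sees
of it. Hence it suffices to know, for every pair `(σ, τ)` of profiles, a smallest `S ⊆ A` that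
`r` sees as `σ` and that satisfies all vertices of `A` when `r` sees `τ` outside (`Partial`,
`IsTable`). Two clusters whose roots are adjacent are combined by running through all triples
consisting of the two inner profiles and the outer one, as these determine what each cluster sees
outside of itself (`partial_union_iff`, `isTable_mergeSteps`).

The program contracts the tree leaf by leaf (`Contraction`, `Progress`): `n - 1` times it looks for
a living vertex with exactly one living neighbour and combines its table with that of the neighbour
into a fresh table. Every entry stores its set explicitly, so no backtracking is needed, and one
step of combining costs `O(n + k)`. Altogether this takes `O(n * M ^ 3 * (n + k))` steps, which is
`O(2 ^ (4 * k) * n ^ 5)` because `k ≤ 2 ^ k`, and `5 ≤ 2 * k + 3` because there is at least one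
colour.

Programs are verified by a total-correctness calculus (`Ends`, with the loop rule `Ends.forLoop`)
that accounts for the number of steps and for the size of all words. The memory behind the input
holds, from address `n + n * n` on, a pointer for each vertex, and from `n + n * n + n` on the
tables, in blocks of `n + 1` cells. Registers `0, …, 8` hold constants (`Constants`), the others
serve as variables, those from `28` on as scratch space. -/

/-! ### Profiles -/

namespace MinConsistentSubset

/-- A distance together with a bitmask of colours: what a vertex sees of a set of vertices,
namely how far its nearest elements are and which colours occur among them. -/
abbrev Profile := ℕ × ℕ

namespace Profile

/-- The profile of a union: the smaller distance wins, and at equal distances the colours are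
united. -/
def merge (a b : Profile) : Profile :=
  if a.1 < b.1 then a else if b.1 < a.1 then b else (a.1, a.2 ||| b.2)

/-- The profile of the empty set of vertices in a graph with `n` vertices. Distances there are
less than `n`, so `n` serves as infinity. -/
def far (n : ℕ) : Profile := (n, 0)

/-- The profile after moving one edge away; distances that would reach `n` collapse to
`far n`. -/
def shift (n : ℕ) (a : Profile) : Profile :=
  if a.1 + 1 < n then (a.1 + 1, a.2) else far n

/-- The profiles that the tables are indexed by. -/
def Valid (n k : ℕ) (a : Profile) : Prop := a.1 ≤ n ∧ a.2 < 2 ^ k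

theorem merge_comm (a b : Profile) : merge a b = merge b a := by
  unfold merge
  split_ifs <;> first | omega | rfl | skip
  have : a.1 = b.1 := by omega
  rw [this, Nat.lor_comm]

theorem merge_assoc (a b c : Profile) : merge (merge a b) c = merge a (merge b c) := by
  rcases lt_trichotomy a.1 b.1 with h1 | h1 | h1 <;>
  rcases lt_trichotomy b.1 c.1 with h2 | h2 | h2 <;>
  rcases lt_trichotomy a.1 c.1 with h3 | h3 | h3 <;>
  first
  | omega
  | simp [merge, h1, h2, h3, h1.not_gt, h2.not_gt, h3.not_gt, Nat.lor_assoc]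

instance : Std.Commutative merge := ⟨merge_comm⟩
instance : Std.Associative merge := ⟨merge_assoc⟩

theorem merge_far {n : ℕ} {a : Profile} (ha : a.1 ≤ n) : merge a (far n) = a := by
  unfold merge far
  split_ifs with h1 h2
  · rfl
  · simp only at h2; omega
  · simp

theorem shift_far (n : ℕ) : shift n (far n) = far n := by simp [shift, far]

theorem iterate_shift_far (n m : ℕ) : (shift n)^[m] (far n) = far n :=
  Function.iterate_fixed (shift_far n) m

theorem shift_merge {n : ℕ} (a b : Profile) :
    shift n (merge a b) = merge (shift n a) (shift n b) := by
  unfold shift merge far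
  split_ifs <;> simp_all <;> omega

theorem iterate_shift_merge {n : ℕ} (m : ℕ) (a b : Profile) :
    (shift n)^[m] (merge a b) = merge ((shift n)^[m] a) ((shift n)^[m] b) := by
  induction m generalizing a b with
  | zero => rfl
  | succ m ih => simp only [Function.iterate_succ_apply, shift_merge, ih]

theorem iterate_shift_of_lt {n d m b : ℕ} (h : d + m < n) :
    (shift n)^[m] (d, b) = (d + m, b) := by
  induction m generalizing d with
  | zero => rfl
  | succ m ih =>
    have h1 : d + 1 < n := by omega
    rw [Function.iterate_succ_apply, shift, if_pos h1, ih (by simp only; omega)]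
    simp only [Prod.mk.injEq, and_true]; omega

theorem Valid.merge {n k : ℕ} {a b : Profile} (ha : a.Valid n k) (hb : b.Valid n k) :
    (merge a b).Valid n k := by
  unfold Profile.merge
  split_ifs
  · exact ha
  · exact hb
  · exact ⟨ha.1, Nat.or_lt_two_pow ha.2 hb.2⟩

theorem valid_far (n k : ℕ) : (far n).Valid n k := ⟨le_rfl, by simp [far]⟩

theorem Valid.shift {n k : ℕ} {a : Profile} (ha : a.Valid n k) : (a.shift n).Valid n k := by
  unfold Profile.shift
  split_ifs with h
  · exact ⟨h.le, ha.2⟩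
  · exact valid_far n k

/-- The number that stands for a profile in table indices. -/
def code (k : ℕ) (a : Profile) : ℕ := a.1 * 2 ^ k + a.2

/-- The profile with a given code. -/
def ofCode (k x : ℕ) : Profile := (x / 2 ^ k, x % 2 ^ k)

theorem ofCode_code {n k : ℕ} {a : Profile} (ha : a.Valid n k) : ofCode k (code k a) = a := by
  have := Nat.two_pow_pos k
  ext
  · simp only [ofCode, code]
    rw [mul_comm, Nat.mul_add_div this, Nat.div_eq_of_lt ha.2, add_zero]
  · simp only [ofCode, code]
    rw [mul_comm, Nat.mul_add_mod, Nat.mod_eq_of_lt ha.2]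

theorem code_ofCode (k x : ℕ) : code k (ofCode k x) = x := by
  simp only [ofCode, code]
  rw [mul_comm]; exact Nat.div_add_mod x (2 ^ k)

theorem code_lt {n k : ℕ} {a : Profile} (ha : a.Valid n k) : code k a < (n + 1) * 2 ^ k := by
  have h1 := ha.1
  have h2 := ha.2
  unfold code
  nlinarith [Nat.mul_le_mul_right (2 ^ k) h1]

theorem valid_ofCode {n k x : ℕ} (hx : x < (n + 1) * 2 ^ k) : (ofCode k x).Valid n k :=
  ⟨Nat.lt_succ_iff.mp (Nat.div_lt_of_lt_mul (by rwa [mul_comm])),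
    Nat.mod_lt _ (Nat.two_pow_pos k)⟩

end Profile

open Profile

/-- What `u` sees of `S`: the distance to the nearest elements of `S`, and the bitmask of their
colours. -/
noncomputable def view {n k : ℕ} (G : SimpleGraph (Fin n)) (c : Fin n → Fin k) (u : Fin n)
    (S : Finset (Fin n)) : Profile :=
  S.fold merge (far n) fun s => (G.dist u s, 2 ^ (c s : ℕ))

section View

variable {n k : ℕ} {G : SimpleGraph (Fin n)} {c : Fin n → Fin k}

theorem dist_lt_of_connected (hG : G.Connected) (u v : Fin n) : G.dist u v < n := by
  obtain ⟨p, hp, hl⟩ := hG.exists_path_of_dist u v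
  simpa [hl] using hp.length_lt

theorem valid_view (hG : G.Connected) (u : Fin n) (S : Finset (Fin n)) :
    (view G c u S).Valid n k := by
  induction S using Finset.induction_on with
  | empty => exact valid_far n k
  | insert a S ha ih =>
    rw [view, Finset.fold_insert ha]
    exact Valid.merge ⟨(dist_lt_of_connected hG u a).le,
      Nat.pow_lt_pow_right (by norm_num) (c a).2⟩ ih

theorem view_union {u : Fin n} {S T : Finset (Fin n)} (h : Disjoint S T) :
    view G c u (S ∪ T) = merge (view G c u S) (view G c u T) := by
  rw [← Finset.disjUnion_eq_union S T h]
  have hf : far n = merge (far n) (far n) := (merge_far (n := n) le_rfl).symm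
  conv_lhs => rw [view, hf]
  exact Finset.fold_disjUnion h

theorem view_spec (u : Fin n) (S : Finset (Fin n)) (hG : G.Connected) :
    (∀ s ∈ S, (view G c u S).1 ≤ G.dist u s) ∧
    (S.Nonempty → ∃ s ∈ S, G.dist u s = (view G c u S).1) ∧
    ∀ i : ℕ, (view G c u S).2.testBit i ↔
      ∃ s ∈ S, G.dist u s = (view G c u S).1 ∧ (c s : ℕ) = i := by
  induction S using Finset.induction_on with
  | empty => simp [view, far]
  | insert a S ha ih =>
    obtain ⟨h1, h2, h3⟩ := ih
    have hv : view G c u (insert a S) = merge (G.dist u a, 2 ^ (c a : ℕ)) (view G c u S) :=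
      Finset.fold_insert ha
    have hn : S = ∅ → (view G c u S).1 = n := by rintro rfl; rfl
    have hd := dist_lt_of_connected hG u a
    rw [hv]
    unfold merge
    simp only
    split_ifs with c1 c2
    · refine ⟨?_, fun _ => ⟨a, by simp, rfl⟩, fun i => ?_⟩
      · intro s hs
        rcases Finset.mem_insert.mp hs with rfl | hs
        · exact le_rfl
        · exact c1.le.trans (h1 s hs)
      · simp only [Nat.testBit_two_pow]
        constructor
        · intro h
          exact ⟨a, by simp, rfl, by simpa using h⟩
        · rintro ⟨s, hs, hs1, hs2⟩
          rcases Finset.mem_insert.mp hs with rfl | hs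
          · simpa using hs2
          · have := h1 s hs; omega
    · have hne : S.Nonempty := by
        rw [Finset.nonempty_iff_ne_empty]; intro h; have := hn h; omega
      refine ⟨?_, fun _ => ?_, fun i => ?_⟩
      · intro s hs
        rcases Finset.mem_insert.mp hs with rfl | hs
        · exact c2.le
        · exact h1 s hs
      · obtain ⟨s, hs, h⟩ := h2 hne
        exact ⟨s, by simp [hs], h⟩
      · rw [h3 i]
        constructor
        · rintro ⟨s, hs, h⟩
          exact ⟨s, by simp [hs], h⟩
        · rintro ⟨s, hs, hs1, hs2⟩
          rcases Finset.mem_insert.mp hs with rfl | hs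
          · omega
          · exact ⟨s, hs, hs1, hs2⟩
    · have he : G.dist u a = (view G c u S).1 := by omega
      refine ⟨?_, fun _ => ⟨a, by simp, rfl⟩, fun i => ?_⟩
      · intro s hs
        rcases Finset.mem_insert.mp hs with rfl | hs
        · exact le_rfl
        · exact he.le.trans (h1 s hs)
      · simp only [Nat.testBit_or, Bool.or_eq_true, h3 i, Nat.testBit_two_pow, he,
          Finset.mem_insert, decide_eq_true_eq, exists_eq_or_imp, true_and]

theorem isConsistent_iff_view (hG : G.Connected) (S : Finset (Fin n)) :
    IsConsistent G c S ↔ ∀ u, (view G c u S).2.testBit (c u) := by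
  refine forall_congr' fun u => ?_
  obtain ⟨h1, h2, h3⟩ := view_spec (c := c) u S hG
  rw [h3]
  constructor
  · rintro ⟨v, ⟨hv, hmin⟩, hc⟩
    obtain ⟨s, hs, hs'⟩ := h2 ⟨v, hv⟩
    exact ⟨v, hv, le_antisymm (hs' ▸ hmin s hs) (h1 v hv), by rw [hc]⟩
  · rintro ⟨v, hv, hd, hc⟩
    exact ⟨v, ⟨hv, fun w hw => hd ▸ h1 w hw⟩, Fin.ext hc⟩

/-- If every element of `S` is reached from `u` through `r`, then `u` sees `S` as `r` does,
only farther away. -/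
theorem view_eq_iterate_shift (hG : G.Connected) {u r : Fin n} {m : ℕ} {S : Finset (Fin n)}
    (h : ∀ s ∈ S, G.dist u s = m + G.dist r s) :
    view G c u S = (shift n)^[m] (view G c r S) := by
  unfold view
  rw [← Finset.fold_hom (op := merge) (iterate_shift_merge m), iterate_shift_far]
  refine Finset.fold_congr fun s hs => ?_
  have := dist_lt_of_connected hG u s
  rw [iterate_shift_of_lt (by have := h s hs; omega), h s hs, add_comm]

end View

/-! ### Partial solutions on clusters -/

/-- `S` is a partial solution for the cluster `A`, which is attached to the other vertices
through its root `r` only: `r` sees `S` as `σ`, and every vertex of `A` has a nearest neighbour of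
its own colour once `r` sees the part of the solution outside `A` as `τ`. -/
def Partial {n k : ℕ} (G : SimpleGraph (Fin n)) (c : Fin n → Fin k) (A : Finset (Fin n))
    (r : Fin n) (S : Finset (Fin n)) (σ τ : Profile) : Prop :=
  S ⊆ A ∧ view G c r S = σ ∧
    ∀ u ∈ A, (merge (view G c u S) ((shift n)^[G.dist u r] τ)).2.testBit (c u)

section Partial

variable {n k : ℕ} {G : SimpleGraph (Fin n)} {c : Fin n → Fin k}

/-- Partial solutions of the whole vertex set with nothing outside are the consistent subsets. -/
theorem partial_univ_iff (hG : G.Connected) {r : Fin n} {S : Finset (Fin n)} {σ : Profile} :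
    Partial G c Finset.univ r S σ (far n) ↔ view G c r S = σ ∧ IsConsistent G c S := by
  simp only [Partial, Finset.subset_univ, true_and, Finset.mem_univ, forall_const,
    iterate_shift_far, isConsistent_iff_view hG, merge_far (valid_view (c := c) hG _ S).1]

/-- Partial solutions of a union of two clusters whose roots `r` and `x` are adjacent: each half
counts the other half, one edge farther, as part of its outside. -/
theorem partial_union_iff (hG : G.Connected) {A B : Finset (Fin n)} {r x : Fin n}
    (hr : r ∈ A) (hAB : Disjoint A B)
    (hd : ∀ u ∈ A, ∀ w ∈ B, G.dist u w = G.dist u r + 1 + G.dist x w)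
    {S T : Finset (Fin n)} (hS : S ⊆ A) (hT : T ⊆ B) {σ τ : Profile} :
    Partial G c (A ∪ B) r (S ∪ T) σ τ ↔
      σ = merge (view G c r S) (shift n (view G c x T)) ∧
      Partial G c A r S (view G c r S) (merge (shift n (view G c x T)) τ) ∧
      Partial G c B x T (view G c x T) (shift n (merge (view G c r S) τ)) := by
  have hST : Disjoint S T := hAB.mono hS hT
  have hrx : ∀ w ∈ B, G.dist w r = G.dist w x + 1 := by
    intro w hw
    have := hd r hr w hw
    rw [SimpleGraph.dist_self] at this
    rw [G.dist_comm, this, G.dist_comm]; omega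
  have hA : ∀ u ∈ A, merge (view G c u (S ∪ T)) ((shift n)^[G.dist u r] τ) =
      merge (view G c u S)
        ((shift n)^[G.dist u r] (merge (shift n (view G c x T)) τ)) := by
    intro u hu
    rw [view_union hST, merge_assoc, iterate_shift_merge, ← Function.iterate_succ_apply,
      view_eq_iterate_shift (u := u) (r := x) (m := G.dist u r + 1) hG
        fun t ht => hd u hu t (hT ht)]
  have hB : ∀ u ∈ B, merge (view G c u (S ∪ T)) ((shift n)^[G.dist u r] τ) =
      merge (view G c u T)
        ((shift n)^[G.dist u x] (shift n (merge (view G c r S) τ))) := by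
    intro u hu
    rw [view_union hST, merge_comm (view G c u S), merge_assoc, ← Function.iterate_succ_apply,
      iterate_shift_merge, Nat.succ_eq_add_one, hrx u hu,
      view_eq_iterate_shift (u := u) (r := r) (S := S) (m := G.dist u x + 1) hG]
    intro s hs
    rw [SimpleGraph.dist_comm, hd s (hS hs) u hu, G.dist_comm (u := s), G.dist_comm (u := x)]
    omega
  have hv : view G c r (S ∪ T) = merge (view G c r S) (shift n (view G c x T)) := by
    rw [view_union hST, view_eq_iterate_shift (u := r) (r := x) (m := 1) (S := T) hG]
    · rfl
    · intro t ht
      rw [hd r hr t (hT ht), SimpleGraph.dist_self, zero_add]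
  unfold Partial
  simp only [hv, hS, hT, Finset.union_subset_union hS hT, true_and]
  rw [Finset.forall_mem_union]
  constructor
  · rintro ⟨h1, h2, h3⟩
    exact ⟨h1.symm, fun u hu => hA u hu ▸ h2 u hu, fun u hu => hB u hu ▸ h3 u hu⟩
  · rintro ⟨h1, h2, h3⟩
    exact ⟨h1.symm, fun u hu => (hA u hu).symm ▸ h2 u hu, fun u hu => (hB u hu).symm ▸ h3 u hu⟩

theorem partial_singleton_iff {v : Fin n} {S : Finset (Fin n)}
    {σ τ : Profile} (hτ : τ.1 ≤ n) :
    Partial G c {v} v S σ τ ↔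
      (S = {v} ∧ σ = (0, 2 ^ (c v : ℕ))) ∨ (S = ∅ ∧ σ = far n ∧ τ.2.testBit (c v)) := by
  have h1 : view G c v {v} = (0, 2 ^ (c v : ℕ)) := by
    have hn : 0 < n := v.pos
    simp [view, merge, far, hn]
  have h0 : view G c v ∅ = far n := rfl
  have h2 : (merge (0, 2 ^ (c v : ℕ)) τ).2.testBit (c v) := by
    unfold merge
    split_ifs <;> simp_all [Nat.testBit_or]
  unfold Partial
  rw [Finset.subset_singleton_iff]
  constructor
  · rintro ⟨rfl | rfl, h, hu⟩
    · right
      have := hu v (by simp)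
      rw [h0, SimpleGraph.dist_self, Function.iterate_zero, id, merge_comm, merge_far hτ] at this
      exact ⟨rfl, h.symm, this⟩
    · left
      exact ⟨rfl, by rw [← h, h1]⟩
  · rintro (⟨rfl, rfl⟩ | ⟨rfl, rfl, h⟩)
    · refine ⟨by simp, h1, fun u hu => ?_⟩
      rw [Finset.mem_singleton.mp hu, h1, SimpleGraph.dist_self, Function.iterate_zero, id]
      exact h2
    · refine ⟨by simp, h0, fun u hu => ?_⟩
      rw [Finset.mem_singleton.mp hu, h0, SimpleGraph.dist_self, Function.iterate_zero, id,
        merge_comm, merge_far hτ]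
      exact h

end Partial

/-! ### Contracting a tree leaf by leaf -/

section Contraction

variable {n : ℕ} {G : SimpleGraph (Fin n)}

/-- The tree `G` contracted onto the vertices in `R`: every vertex `u` belongs to the cluster of
its representative `root u ∈ R`, and clusters are attached to one another through their
representatives only. The last condition says that distances within `R` are realised inside
`R`. -/
structure Contraction (G : SimpleGraph (Fin n)) (R : Finset (Fin n)) (root : Fin n → Fin n) :
    Prop where
  root_mem : ∀ u, root u ∈ R
  root_eq : ∀ v ∈ R, root v = v
  dist_eq : ∀ u w, root u ≠ root w →
    G.dist u w = G.dist u (root u) + G.dist (root u) (root w) + G.dist (root w) w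
  exists_adj : ∀ y ∈ R, ∀ z ∈ R, y ≠ z → ∃ x ∈ R, G.Adj y x ∧ G.dist y z = G.dist x z + 1

/-- `x` is a leaf of the subgraph induced by `R`, and `p` is its neighbour there. -/
def IsLeaf (G : SimpleGraph (Fin n)) (R : Finset (Fin n)) (x p : Fin n) : Prop :=
  x ∈ R ∧ p ∈ R ∧ G.Adj x p ∧ ∀ y ∈ R, G.Adj x y → y = p

theorem Contraction.refl (hG : G.Connected) : Contraction G Finset.univ id where
  root_mem _ := Finset.mem_univ _
  root_eq _ _ := rfl
  dist_eq u w _ := by simp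
  exists_adj y _ z _ h := by
    obtain ⟨p, hp⟩ := hG.exists_walk_length_eq_dist y z
    cases p with
    | nil => exact absurd rfl h
    | cons hadj q =>
      rename_i x
      refine ⟨x, Finset.mem_univ _, hadj, ?_⟩
      rw [SimpleGraph.Walk.length_cons] at hp
      have h1 := SimpleGraph.dist_le q
      have h2 := hG.dist_triangle (u := y) (v := x) (w := z)
      rw [SimpleGraph.dist_eq_one_iff_adj.mpr hadj] at h2
      omega

theorem eq_of_adj_of_dist (hG : G.IsTree) {z x y y' : Fin n} (h : G.Adj x y) (h' : G.Adj x y')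
    (hd : G.dist z x = G.dist z y + 1) (hd' : G.dist z x = G.dist z y' + 1) : y = y' := by
  obtain ⟨p, hp, hl⟩ := hG.connected.exists_path_of_dist z y
  obtain ⟨p', hp', hl'⟩ := hG.connected.exists_path_of_dist z y'
  have aux : ∀ {y : Fin n} (p : G.Walk z y) (h : G.Adj x y), p.IsPath →
      p.length = G.dist z y → G.dist z x = G.dist z y + 1 → (p.concat h.symm).IsPath := by
    intro y p h hp hl hd
    refine hp.concat (fun hx => ?_) _
    have h1 := SimpleGraph.dist_le (p.takeUntil x hx)
    have h2 := p.length_takeUntil_le_length hx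
    omega
  have h1 := aux p h hp hl hd
  have h2 := aux p' h' hp' hl' hd'
  have h3 := (hG.isAcyclic.subsingleton_path z x).elim ⟨_, h1⟩ ⟨_, h2⟩
  have h4 : (p.concat h.symm).penultimate = (p'.concat h'.symm).penultimate := by
    rw [show p.concat h.symm = p'.concat h'.symm from congrArg Subtype.val h3]
  simpa using h4

/-- A representative as far as possible from another one is a leaf. -/
theorem Contraction.exists_isLeaf (hG : G.IsTree) {R : Finset (Fin n)} {root : Fin n → Fin n}
    (h : Contraction G R root) (hR : 2 ≤ R.card) : ∃ x p, IsLeaf G R x p := by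
  obtain ⟨z, hz⟩ : R.Nonempty := Finset.card_pos.mp (by omega)
  obtain ⟨x, hx, hmax⟩ := R.exists_max_image (fun x => G.dist z x) ⟨z, hz⟩
  have hxz : x ≠ z := by
    rintro rfl
    obtain ⟨y, hy, hne⟩ := Finset.exists_mem_ne (s := R) (by omega) x
    have h1 := hmax y hy
    have h2 := hG.connected.pos_dist_of_ne hne
    rw [SimpleGraph.dist_self, G.dist_comm] at h1
    omega
  obtain ⟨p, hp, hadj, hd⟩ := h.exists_adj x hx z hz hxz
  refine ⟨x, p, hx, hp, hadj, fun y hy hxy => ?_⟩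
  refine eq_of_adj_of_dist hG (z := z) hxy hadj ?_ ?_
  · rcases hG.dist_eq_dist_add_one_of_adj z hxy with h1 | h1
    · exact h1
    · have := hmax y hy; omega
  · rw [G.dist_comm, hd, G.dist_comm]

variable {R : Finset (Fin n)} {root : Fin n → Fin n} {x p : Fin n}

theorem Contraction.dist_leaf (h : Contraction G R root) (hl : IsLeaf G R x p)
    {y : Fin n} (hy : y ∈ R) (hxy : y ≠ x) : G.dist x y = G.dist p y + 1 := by
  obtain ⟨q, hq, hadj, hd⟩ := h.exists_adj x hl.1 y hy hxy.symm
  rw [hd, hl.2.2.2 q hq hadj]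

theorem Contraction.contract (h : Contraction G R root) (hl : IsLeaf G R x p) :
    Contraction G (R.erase x) (fun u => if root u = x then p else root u) := by
  have hpx : p ≠ x := hl.2.2.1.ne'
  have h1 : G.dist x p = 1 := SimpleGraph.dist_eq_one_iff_adj.mpr hl.2.2.1
  have key : ∀ u w, root u = x → root w ≠ x →
      G.dist u w = G.dist u p + G.dist p (root w) + G.dist (root w) w := by
    intro u w hu hw
    have e1 := h.dist_eq u w (by rw [hu]; exact hw.symm)
    have e2 := h.dist_eq u p (by rw [hu, h.root_eq p hl.2.1]; exact hpx.symm)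
    rw [hu] at e1 e2
    rw [h.root_eq p hl.2.1, SimpleGraph.dist_self] at e2
    have e3 := h.dist_leaf hl (h.root_mem w) hw
    omega
  refine ⟨?_, ?_, ?_, ?_⟩
  · intro u
    split_ifs with hu
    · exact Finset.mem_erase.mpr ⟨hpx, hl.2.1⟩
    · exact Finset.mem_erase.mpr ⟨hu, h.root_mem u⟩
  · intro v hv
    rw [Finset.mem_erase] at hv
    rw [h.root_eq v hv.2, if_neg hv.1]
  · intro u w huw
    by_cases hu : root u = x <;> by_cases hw : root w = x
    · simp [hu, hw] at huw
    · simp only [hu, hw, if_true, if_false] at huw ⊢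
      exact key u w hu hw
    · simp only [hu, hw, if_true, if_false] at huw ⊢
      have := key w u hw hu
      rw [G.dist_comm (u := u) (v := w), this, G.dist_comm (u := w) (v := p),
        G.dist_comm (u := p) (v := root u), G.dist_comm (u := root u) (v := u)]
      omega
    · simp only [hu, hw, if_false] at huw ⊢
      exact h.dist_eq u w huw
  · intro y hy z hz hyz
    rw [Finset.mem_erase] at hy hz
    obtain ⟨q, hq, hadj, hd⟩ := h.exists_adj y hy.2 z hz.2 hyz
    refine ⟨q, Finset.mem_erase.mpr ⟨?_, hq⟩, hadj, hd⟩
    -- a geodesic between other representatives cannot enter the leaf, as it would have to return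
    rintro rfl
    have e1 := h.dist_leaf hl hz.2 hz.1
    have e2 := hl.2.2.2 y hy.2 hadj.symm
    rw [e2] at hd
    omega

/-- The vertices represented by `v`. -/
def cluster (root : Fin n → Fin n) (v : Fin n) : Finset (Fin n) :=
  Finset.univ.filter fun u => root u = v

theorem cluster_contract_self :
    cluster (fun u => if root u = x then p else root u) p =
      cluster root p ∪ cluster root x := by
  ext u
  simp only [cluster, Finset.mem_filter, Finset.mem_univ, true_and, Finset.mem_union]
  split_ifs with h
  · simp [h]
  · simp [h]

theorem cluster_contract_of_ne {v : Fin n} (hvp : v ≠ p) (hvx : v ≠ x) :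
    cluster (fun u => if root u = x then p else root u) v = cluster root v := by
  ext u
  simp only [cluster, Finset.mem_filter, Finset.mem_univ, true_and]
  split_ifs with h
  · rw [h]; exact ⟨fun h => absurd h.symm hvp, fun h => absurd h.symm hvx⟩
  · rfl

theorem disjoint_cluster (hpx : p ≠ x) : Disjoint (cluster root p) (cluster root x) := by
  rw [Finset.disjoint_left]
  intro u hu hu'
  simp only [cluster, Finset.mem_filter] at hu hu'
  exact hpx (hu.2.symm.trans hu'.2)

theorem Contraction.dist_cluster (h : Contraction G R root) (hl : IsLeaf G R x p) :
    ∀ u ∈ cluster root p, ∀ w ∈ cluster root x,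
      G.dist u w = G.dist u p + 1 + G.dist x w := by
  intro u hu w hw
  simp only [cluster, Finset.mem_filter] at hu hw
  rw [h.dist_eq u w (by rw [hu.2, hw.2]; exact hl.2.2.1.ne'), hu.2, hw.2,
    SimpleGraph.dist_eq_one_iff_adj.mpr hl.2.2.1.symm]

end Contraction

/-! ### Tables of partial solutions -/

section Tables

variable {n k : ℕ} {G : SimpleGraph (Fin n)} {c : Fin n → Fin k}

/-- `T` lists a smallest partial solution of the cluster `A` for every pair of an inner and an
outer profile (or `none` where there is no partial solution). -/
def IsTable (G : SimpleGraph (Fin n)) (c : Fin n → Fin k) (A : Finset (Fin n)) (r : Fin n)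
    (T : ℕ → ℕ → Option (Finset (Fin n))) : Prop :=
  ∀ σ τ : Profile, σ.Valid n k → τ.Valid n k →
    (∀ S, T (code k σ) (code k τ) = some S → Partial G c A r S σ τ) ∧
    ∀ S, Partial G c A r S σ τ → ∃ S', T (code k σ) (code k τ) = some S' ∧ S'.card ≤ S.card

/-- Position of the entry `(σ, τ)` of table `i` in the list of all entries of all tables, where
`M` is the number of codes of profiles. -/
def entry (M i σ τ : ℕ) : ℕ := (i * M + σ) * M + τ

theorem entry_div {M i σ τ : ℕ} (hτ : τ < M) : entry M i σ τ / M = i * M + σ := by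
  unfold entry
  rw [mul_comm, Nat.mul_add_div (by omega), Nat.div_eq_of_lt hτ, add_zero]

theorem entry_mod {M i σ τ : ℕ} (hτ : τ < M) : entry M i σ τ % M = τ := by
  unfold entry
  rw [mul_comm, Nat.mul_add_mod, Nat.mod_eq_of_lt hτ]

theorem entry_div_div {M i σ τ : ℕ} (hσ : σ < M) (hτ : τ < M) : entry M i σ τ / M / M = i := by
  rw [entry_div hτ, mul_comm, Nat.mul_add_div (by omega), Nat.div_eq_of_lt hσ, add_zero]

theorem entry_div_mod {M i σ τ : ℕ} (hσ : σ < M) (hτ : τ < M) : entry M i σ τ / M % M = σ := by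
  rw [entry_div hτ, mul_comm, Nat.mul_add_mod, Nat.mod_eq_of_lt hσ]

theorem entry_lt {M N i σ τ : ℕ} (hi : i < N) (hσ : σ < M) (hτ : τ < M) :
    entry M i σ τ < N * M * M := by
  unfold entry
  have h1 : i * M + σ < N * M := by nlinarith
  nlinarith

theorem entry_lt_cube {M a b t : ℕ} (ha : a < M) (hb : b < M) (ht : t < M) :
    entry M a b t < M * M * M := entry_lt ha hb ht

/-- The content of all the tables, entry by entry. -/
abbrev Tables (n : ℕ) := ℕ → Option (Finset (Fin n))

/-- The better one of an entry and a further candidate. -/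
def improve (o : Option (Finset (Fin n))) (S : Finset (Fin n)) : Option (Finset (Fin n)) :=
  match o with
  | none => some S
  | some U => if S.card < U.card then some S else some U

/-- The new entry after the union of the sets in two other entries has been offered to it. -/
def combine (o₁ o₂ o : Option (Finset (Fin n))) : Option (Finset (Fin n)) :=
  match o₁, o₂ with
  | some S, some T => improve o (S ∪ T)
  | _, _ => o

theorem combine_eq_or (o₁ o₂ o : Option (Finset (Fin n))) :
    combine o₁ o₂ o = o ∨
      ∃ S T, o₁ = some S ∧ o₂ = some T ∧ combine o₁ o₂ o = some (S ∪ T) := by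
  rcases o₁ with _ | S
  · exact Or.inl rfl
  rcases o₂ with _ | T
  · exact Or.inl rfl
  rcases o with _ | U
  · exact Or.inr ⟨S, T, rfl, rfl, rfl⟩
  simp only [combine, improve]
  split_ifs
  · exact Or.inr ⟨S, T, rfl, rfl, rfl⟩
  · exact Or.inl rfl

theorem exists_combine_of_some (o₁ o₂ : Option (Finset (Fin n))) (U : Finset (Fin n)) :
    ∃ U', combine o₁ o₂ (some U) = some U' ∧ U'.card ≤ U.card := by
  rcases o₁ with _ | S
  · exact ⟨U, rfl, le_rfl⟩
  rcases o₂ with _ | T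
  · exact ⟨U, rfl, le_rfl⟩
  simp only [combine, improve]
  split_ifs with h
  · exact ⟨_, rfl, h.le⟩
  · exact ⟨_, rfl, le_rfl⟩

theorem exists_combine (S T : Finset (Fin n)) (o : Option (Finset (Fin n))) :
    ∃ U, combine (some S) (some T) o = some U ∧ U.card ≤ (S ∪ T).card := by
  rcases o with _ | U
  · exact ⟨_, rfl, le_rfl⟩
  simp only [combine, improve]
  split_ifs with h
  · exact ⟨_, rfl, le_rfl⟩
  · exact ⟨_, rfl, by omega⟩

/-- The entry at position `j` in the tables of the single vertices. -/
def initEntry (k : ℕ) (c : Fin n → Fin k) (j : ℕ) : Option (Finset (Fin n)) :=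
  let M := (n + 1) * 2 ^ k
  if h : j / M / M < n then
    let v : Fin n := ⟨j / M / M, h⟩
    if j / M % M = 2 ^ (c v : ℕ) then some {v}
    else if j / M % M = n * 2 ^ k ∧ j % M % 2 ^ k / 2 ^ (c v : ℕ) % 2 = 1 then some ∅
    else none
  else none

theorem initEntry_of_le {j : ℕ} (hj : n * ((n + 1) * 2 ^ k) * ((n + 1) * 2 ^ k) ≤ j) :
    initEntry k c j = none := by
  unfold initEntry
  have hM : 0 < (n + 1) * 2 ^ k := by positivity
  have : ¬ j / ((n + 1) * 2 ^ k) / ((n + 1) * 2 ^ k) < n := by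
    rw [not_lt, Nat.le_div_iff_mul_le hM, Nat.le_div_iff_mul_le hM]
    exact hj
  rw [dif_neg this]

theorem isTable_initEntry (v : Fin n) :
    IsTable G c {v} v fun σ τ => initEntry k c (entry ((n + 1) * 2 ^ k) v σ τ) := by
  intro σ τ hσ hτ
  have h1 := code_lt hσ
  have h2 := code_lt hτ
  have hσ1 : code k σ = 2 ^ (c v : ℕ) ↔ σ = (0, 2 ^ (c v : ℕ)) := by
    have hv : Valid n k (0, 2 ^ (c v : ℕ)) :=
      ⟨Nat.zero_le _, Nat.pow_lt_pow_right (by norm_num) (c v).2⟩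
    constructor
    · intro h
      rw [← ofCode_code hσ, ← ofCode_code hv, h]
      simp [code]
    · rintro rfl; simp [code]
  have hσ2 : code k σ = n * 2 ^ k ↔ σ = far n := by
    constructor
    · intro h
      rw [← ofCode_code hσ, ← ofCode_code (valid_far n k), h]
      simp [code, far]
    · rintro rfl; simp [code, far]
  have hτ1 : code k τ % 2 ^ k / 2 ^ (c v : ℕ) % 2 = 1 ↔ τ.2.testBit (c v) := by
    have h3 : code k τ % 2 ^ k = τ.2 := by
      conv_rhs => rw [← ofCode_code hτ]
      rfl
    rw [h3, Nat.testBit_eq_decide_div_mod_eq, decide_eq_true_eq]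
  have he : initEntry k c (entry ((n + 1) * 2 ^ k) v (code k σ) (code k τ)) =
      if σ = (0, 2 ^ (c v : ℕ)) then some {v}
      else if σ = far n ∧ τ.2.testBit (c v) then some ∅ else none := by
    unfold initEntry
    simp only [entry_div_div h1 h2, entry_div_mod h1 h2, entry_mod h2, v.2, dif_pos, hσ1, hσ2,
      hτ1]
  simp only [he, partial_singleton_iff hτ.1]
  have hn : 0 < n := v.pos
  have hne : ((0, 2 ^ (c v : ℕ)) : Profile) ≠ far n := by
    intro h
    have := congrArg Prod.fst h
    simp only [far] at this; omega
  refine ⟨fun S hS => ?_, fun S hS => ?_⟩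
  · split_ifs at hS with h3 h4
    · exact Or.inl ⟨(Option.some.inj hS).symm, h3⟩
    · exact Or.inr ⟨(Option.some.inj hS).symm, h4⟩
  · rcases hS with ⟨rfl, rfl⟩ | ⟨rfl, rfl, h⟩
    · exact ⟨{v}, by simp, le_rfl⟩
    · exact ⟨∅, by rw [if_neg hne.symm, if_pos ⟨rfl, h⟩], le_rfl⟩

/-- One step of combining the tables `i₁` and `i₂` of two clusters with adjacent roots into
the table `i₃` of their union. The step number `q` encodes the inner profiles `a` and `b` of the
two clusters and the outer profile `t` of the union. -/
def mergeStep (k : ℕ) (i₁ i₂ i₃ : ℕ) (D : Tables n) (q : ℕ) : Tables n :=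
  let M := (n + 1) * 2 ^ k
  let a := ofCode k (q / M / M)
  let b := ofCode k (q / M % M)
  let t := ofCode k (q % M)
  let j := entry M i₃ (code k (merge a (shift n b))) (code k t)
  Function.update D j
    (combine (D (entry M i₁ (code k a) (code k (merge (shift n b) t))))
      (D (entry M i₂ (code k b) (code k (shift n (merge a t))))) (D j))

/-- The tables after the first `q` steps of combining. -/
def mergeSteps (k : ℕ) (i₁ i₂ i₃ : ℕ) (D : Tables n) : ℕ → Tables n
  | 0 => D
  | q + 1 => mergeStep k i₁ i₂ i₃ (mergeSteps k i₁ i₂ i₃ D q) q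

theorem entry_decode_lt {M q : ℕ} (h : q < M * M * M) :
    q / M / M < M ∧ q / M % M < M ∧ q % M < M := by
  have hM : 0 < M := by
    rcases Nat.eq_zero_or_pos M with h0 | h0
    · simp [h0] at h
    · exact h0
  exact ⟨Nat.div_lt_of_lt_mul (Nat.div_lt_of_lt_mul (by linarith [mul_assoc M M M])),
    Nat.mod_lt _ hM, Nat.mod_lt _ hM⟩

/-- Combining reads the tables `i₁` and `i₂` and writes into table `i₃` only. -/
theorem mergeSteps_of_ne {i₁ i₂ i₃ : ℕ} (D : Tables n) {q i : ℕ} (hi : i ≠ i₃)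
    (hq : q ≤ ((n + 1) * 2 ^ k) * ((n + 1) * 2 ^ k) * ((n + 1) * 2 ^ k)) {σ τ : ℕ}
    (hσ : σ < (n + 1) * 2 ^ k) (hτ : τ < (n + 1) * 2 ^ k) :
    mergeSteps k i₁ i₂ i₃ D q (entry ((n + 1) * 2 ^ k) i σ τ) =
      D (entry ((n + 1) * 2 ^ k) i σ τ) := by
  induction q with
  | zero => rfl
  | succ q ih =>
    rw [mergeSteps, mergeStep]
    obtain ⟨ha, hb, ht⟩ := entry_decode_lt (M := (n + 1) * 2 ^ k) (q := q) (by omega)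
    rw [Function.update_of_ne, ih (by omega)]
    intro h
    apply hi
    have := congrArg (fun j => j / ((n + 1) * 2 ^ k) / ((n + 1) * 2 ^ k)) h
    rwa [entry_div_div hσ hτ, entry_div_div
      (code_lt ((valid_ofCode ha).merge (valid_ofCode hb).shift))
      (code_lt (valid_ofCode ht))] at this

/-- Combining improves every entry for which a step has found a candidate, and never worsens an
entry. -/
theorem mergeSteps_le {i₁ i₂ i₃ : ℕ} (h₁ : i₁ ≠ i₃) (h₂ : i₂ ≠ i₃) (D : Tables n) {q : ℕ}
    (hq : q ≤ ((n + 1) * 2 ^ k) * ((n + 1) * 2 ^ k) * ((n + 1) * 2 ^ k))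
    {a b t : Profile} (ha : a.Valid n k) (hb : b.Valid n k) (ht : t.Valid n k)
    (hlt : entry ((n + 1) * 2 ^ k) (code k a) (code k b) (code k t) < q) {S T : Finset (Fin n)}
    (hS : D (entry ((n + 1) * 2 ^ k) i₁ (code k a) (code k (merge (shift n b) t))) = some S)
    (hT : D (entry ((n + 1) * 2 ^ k) i₂ (code k b) (code k (shift n (merge a t)))) = some T) :
    ∃ U, mergeSteps k i₁ i₂ i₃ D q
        (entry ((n + 1) * 2 ^ k) i₃ (code k (merge a (shift n b))) (code k t)) = some U ∧
      U.card ≤ (S ∪ T).card := by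
  induction q with
  | zero => omega
  | succ q ih =>
    rcases Nat.lt_succ_iff_lt_or_eq.mp hlt with h | h
    · obtain ⟨U, hU, hc⟩ := ih (by omega) h
      rw [mergeSteps, mergeStep]
      rw [Function.update_apply]
      split_ifs with he
      · rw [← he, hU]
        obtain ⟨U', hU', hc'⟩ := exists_combine_of_some _ _ U
        exact ⟨U', hU', hc'.trans hc⟩
      · exact ⟨U, hU, hc⟩
    · have e1 := code_lt ha
      have e2 := code_lt hb
      have e3 := code_lt ht
      rw [mergeSteps, mergeStep, ← h]
      simp only [entry_div_div e2 e3, entry_div_mod e2 e3, entry_mod e3, ofCode_code ha,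
        ofCode_code hb, ofCode_code ht]
      rw [h, mergeSteps_of_ne D h₁ (by omega) e1 (code_lt (hb.shift.merge ht)),
        mergeSteps_of_ne D h₂ (by omega) e2 (code_lt (ha.merge ht).shift), hS, hT]
      simp only [Function.update_self]
      exact exists_combine _ _ _

/-- Combining two tables gives the table of the union. -/
theorem isTable_mergeSteps (hG : G.Connected) {A B : Finset (Fin n)} {r x : Fin n}
    (hr : r ∈ A) (hAB : Disjoint A B)
    (hd : ∀ u ∈ A, ∀ w ∈ B, G.dist u w = G.dist u r + 1 + G.dist x w)
    {i₁ i₂ i₃ : ℕ} (h₁ : i₁ ≠ i₃) (h₂ : i₂ ≠ i₃) (D : Tables n)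
    (hA : IsTable G c A r fun σ τ => D (entry ((n + 1) * 2 ^ k) i₁ σ τ))
    (hB : IsTable G c B x fun σ τ => D (entry ((n + 1) * 2 ^ k) i₂ σ τ))
    (h0 : ∀ σ < (n + 1) * 2 ^ k, ∀ τ < (n + 1) * 2 ^ k,
      D (entry ((n + 1) * 2 ^ k) i₃ σ τ) = none) :
    IsTable G c (A ∪ B) r fun σ τ =>
      mergeSteps k i₁ i₂ i₃ D (((n + 1) * 2 ^ k) * ((n + 1) * 2 ^ k) * ((n + 1) * 2 ^ k))
        (entry ((n + 1) * 2 ^ k) i₃ σ τ) := by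
  intro σ τ hσ hτ
  refine ⟨?_, ?_⟩
  · suffices H : ∀ q ≤ ((n + 1) * 2 ^ k) * ((n + 1) * 2 ^ k) * ((n + 1) * 2 ^ k), ∀ S,
        mergeSteps k i₁ i₂ i₃ D q (entry ((n + 1) * 2 ^ k) i₃ (code k σ) (code k τ)) = some S →
        Partial G c (A ∪ B) r S σ τ from H _ le_rfl
    intro q
    induction q with
    | zero =>
      intro _ S hS
      rw [mergeSteps, h0 _ (code_lt hσ) _ (code_lt hτ)] at hS
      cases hS
    | succ q ih =>
      intro hq U hU
      obtain ⟨ha, hb, ht⟩ := entry_decode_lt (M := (n + 1) * 2 ^ k) (q := q) (by omega)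
      have va := valid_ofCode ha
      have vb := valid_ofCode hb
      have vt := valid_ofCode ht
      rw [mergeSteps, mergeStep] at hU
      rw [Function.update_apply] at hU
      split_ifs at hU with he
      · rw [← he] at hU
        rcases combine_eq_or (mergeSteps k i₁ i₂ i₃ D q (entry ((n + 1) * 2 ^ k) i₁
            (code k (ofCode k (q / ((n + 1) * 2 ^ k) / ((n + 1) * 2 ^ k))))
            (code k (merge (shift n (ofCode k (q / ((n + 1) * 2 ^ k) % ((n + 1) * 2 ^ k))))
              (ofCode k (q % ((n + 1) * 2 ^ k)))))))
          (mergeSteps k i₁ i₂ i₃ D q (entry ((n + 1) * 2 ^ k) i₂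
            (code k (ofCode k (q / ((n + 1) * 2 ^ k) % ((n + 1) * 2 ^ k))))
            (code k (shift n (merge (ofCode k (q / ((n + 1) * 2 ^ k) / ((n + 1) * 2 ^ k)))
              (ofCode k (q % ((n + 1) * 2 ^ k))))))))
          (mergeSteps k i₁ i₂ i₃ D q
            (entry ((n + 1) * 2 ^ k) i₃ (code k σ) (code k τ))) with h | ⟨S, T, hS, hT, h⟩
        · exact ih (by omega) U (h ▸ hU)
        · rw [h] at hU
          obtain rfl := Option.some.inj hU
          rw [mergeSteps_of_ne D h₁ (by omega) (code_lt va)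
            (code_lt (vb.shift.merge vt))] at hS
          rw [mergeSteps_of_ne D h₂ (by omega) (code_lt vb)
            (code_lt (va.merge vt).shift)] at hT
          have hS' := (hA _ _ va (vb.shift.merge vt)).1 S hS
          have hT' := (hB _ _ vb (va.merge vt).shift).1 T hT
          have hσe : σ = merge (ofCode k (q / ((n + 1) * 2 ^ k) / ((n + 1) * 2 ^ k)))
              (shift n (ofCode k (q / ((n + 1) * 2 ^ k) % ((n + 1) * 2 ^ k)))) := by
            have := congrArg (fun j => j / ((n + 1) * 2 ^ k) % ((n + 1) * 2 ^ k)) he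
            rw [entry_div_mod (code_lt hσ) (code_lt hτ),
              entry_div_mod (code_lt (va.merge vb.shift)) (code_lt vt)] at this
            rw [← ofCode_code hσ, this, ofCode_code (va.merge vb.shift)]
          have hτe : τ = ofCode k (q % ((n + 1) * 2 ^ k)) := by
            have := congrArg (fun j => j % ((n + 1) * 2 ^ k)) he
            rw [entry_mod (code_lt hτ), entry_mod (code_lt vt)] at this
            rw [← ofCode_code hτ, this, ofCode_code vt]
          rw [partial_union_iff hG hr hAB hd hS'.1 hT'.1, hS'.2.1, hT'.2.1, hσe, hτe]
          exact ⟨rfl, hS', hT'⟩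
      · exact ih (by omega) U hU
  · intro U hU
    have hU' : U = (U ∩ A) ∪ (U ∩ B) := by
      rw [← Finset.inter_union_distrib_left]
      exact (Finset.inter_eq_left.mpr hU.1).symm
    rw [hU', partial_union_iff hG hr hAB hd Finset.inter_subset_right
      Finset.inter_subset_right] at hU
    obtain ⟨hσe, hUA, hUB⟩ := hU
    have va := valid_view (c := c) hG r (U ∩ A)
    have vb := valid_view (c := c) hG x (U ∩ B)
    obtain ⟨S, hS, hSc⟩ := (hA _ _ va (vb.shift.merge hτ)).2 _ hUA
    obtain ⟨T, hT, hTc⟩ := (hB _ _ vb (va.merge hτ).shift).2 _ hUB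
    obtain ⟨W, hW, hWc⟩ := mergeSteps_le h₁ h₂ D le_rfl va vb hτ
      (entry_lt_cube (code_lt va) (code_lt vb) (code_lt hτ)) hS hT
    refine ⟨W, by rw [hσe]; exact hW, ?_⟩
    rw [hU', Finset.card_union_of_disjoint
      (hAB.mono Finset.inter_subset_right Finset.inter_subset_right)]
    exact hWc.trans ((Finset.card_union_le _ _).trans (add_le_add hSc hTc))

theorem IsTable.subset {A : Finset (Fin n)} {r : Fin n} {T : ℕ → ℕ → Option (Finset (Fin n))}
    (h : IsTable G c A r T) {σ τ : ℕ} (hσ : σ < (n + 1) * 2 ^ k) (hτ : τ < (n + 1) * 2 ^ k)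
    {S : Finset (Fin n)} (hS : T σ τ = some S) : S ⊆ A := by
  rw [← code_ofCode k σ, ← code_ofCode k τ] at hS
  exact ((h _ _ (valid_ofCode hσ) (valid_ofCode hτ)).1 S hS).1

/-- A smallest set in the table of the whole tree with nothing outside is a minimum consistent
subset. -/
theorem IsTable.isMinConsistent (hG : G.Connected) {r : Fin n}
    {T : ℕ → ℕ → Option (Finset (Fin n))} (h : IsTable G c Finset.univ r T) {σ : ℕ}
    (hσ : σ < (n + 1) * 2 ^ k) {S : Finset (Fin n)} (hS : T σ (n * 2 ^ k) = some S)
    (hmin : ∀ σ' < (n + 1) * 2 ^ k, ∀ S', T σ' (n * 2 ^ k) = some S' → S.card ≤ S'.card) :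
    IsMinConsistent G c S := by
  have hf : code k (far n) = n * 2 ^ k := by simp [code, far]
  constructor
  · rw [← code_ofCode k σ, ← hf] at hS
    exact ((partial_univ_iff hG).mp
      ((h _ _ (valid_ofCode hσ) (valid_far n k)).1 S hS)).2
  · intro S' hS'
    have hv := valid_view (c := c) hG r S'
    obtain ⟨U, hU, hc⟩ := (h _ _ hv (valid_far n k)).2 S' ((partial_univ_iff hG).mpr ⟨rfl, hS'⟩)
    rw [hf] at hU
    exact (hmin _ (code_lt hv) U hU).trans hc

theorem IsTable.exists_some (hG : G.Connected) {r : Fin n}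
    {T : ℕ → ℕ → Option (Finset (Fin n))} (h : IsTable G c Finset.univ r T) :
    ∃ σ < (n + 1) * 2 ^ k, ∃ S, T σ (n * 2 ^ k) = some S := by
  have hf : code k (far n) = n * 2 ^ k := by simp [code, far]
  have hcons : IsConsistent G c Finset.univ := fun u =>
    ⟨u, ⟨Finset.mem_univ u, fun w _ => by simp⟩, rfl⟩
  have hv := valid_view (c := c) hG r Finset.univ
  obtain ⟨U, hU, -⟩ := (h _ _ hv (valid_far n k)).2 _ ((partial_univ_iff hG).mpr ⟨rfl, hcons⟩)
  exact ⟨_, code_lt hv, U, by rw [← hf]; exact hU⟩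

end Tables

end MinConsistentSubset

/-! ### Reasoning about programs -/

namespace WordRAM

instance : Add Expr := ⟨.bin .add⟩
instance : Sub Expr := ⟨.bin .sub⟩
instance : Mul Expr := ⟨.bin .mul⟩
instance : Div Expr := ⟨.bin .div⟩
instance : Mod Expr := ⟨.bin .mod⟩

section Simp

variable (W : ℕ) (s : State) (e f : Expr) (x y a p : ℕ)

theorem eval_const : (Expr.const a).eval s = a := rfl
theorem eval_reg : (Expr.reg x).eval s = s.reg x := rfl
theorem eval_load : (Expr.load e).eval s = s.mem (e.eval s) := rfl
theorem eval_add : (e + f).eval s = e.eval s + f.eval s := rfl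
theorem eval_sub : (e - f).eval s = e.eval s - f.eval s := rfl
theorem eval_mul : (e * f).eval s = e.eval s * f.eval s := rfl
theorem eval_div : (e / f).eval s = e.eval s / f.eval s := rfl
theorem eval_mod : (e % f).eval s = e.eval s % f.eval s := rfl
theorem eval_lt : (Expr.bin .lt e f).eval s = if e.eval s < f.eval s then 1 else 0 := rfl
theorem eval_eq : (Expr.bin .eq e f).eval s = if e.eval s = f.eval s then 1 else 0 := rfl

theorem fits_const : (Expr.const a).Fits W s ↔ a ≤ W := Iff.rfl
theorem fits_reg : (Expr.reg x).Fits W s ↔ s.reg x ≤ W := Iff.rfl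
theorem fits_load : (Expr.load e).Fits W s ↔ e.Fits W s ∧ s.mem (e.eval s) ≤ W := Iff.rfl
theorem fits_add : (e + f).Fits W s ↔ e.Fits W s ∧ f.Fits W s ∧ e.eval s + f.eval s ≤ W :=
  Iff.rfl
theorem fits_mul : (e * f).Fits W s ↔ e.Fits W s ∧ f.Fits W s ∧ e.eval s * f.eval s ≤ W :=
  Iff.rfl
theorem fits_sub : (e - f).Fits W s ↔ e.Fits W s ∧ f.Fits W s :=
  ⟨fun h => ⟨h.1, h.2.1⟩, fun h => ⟨h.1, h.2, (Nat.sub_le _ _).trans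
    (match e, h.1 with
      | .const _, h => h
      | .reg _, h => h
      | .load _, h => h.2
      | .bin _ _ _, h => h.2.2)⟩⟩

theorem Expr.Fits.eval_le {W : ℕ} {s : State} {e : Expr} (h : e.Fits W s) : e.eval s ≤ W := by
  cases e with
  | const a => exact h
  | reg x => exact h
  | load e => exact h.2
  | bin o e f => exact h.2.2

theorem fits_div : (e / f).Fits W s ↔ e.Fits W s ∧ f.Fits W s :=
  ⟨fun h => ⟨h.1, h.2.1⟩, fun h => ⟨h.1, h.2, (Nat.div_le_self _ _).trans h.1.eval_le⟩⟩
theorem fits_mod : (e % f).Fits W s ↔ e.Fits W s ∧ f.Fits W s :=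
  ⟨fun h => ⟨h.1, h.2.1⟩, fun h => ⟨h.1, h.2, (Nat.mod_le _ _).trans h.1.eval_le⟩⟩
theorem fits_lt : (Expr.bin .lt e f).Fits W s ↔ e.Fits W s ∧ f.Fits W s ∧
    (if e.eval s < f.eval s then 1 else 0) ≤ W := Iff.rfl
theorem fits_eq : (Expr.bin .eq e f).Fits W s ↔ e.Fits W s ∧ f.Fits W s ∧
    (if e.eval s = f.eval s then 1 else 0) ≤ W := Iff.rfl

theorem cost_const : (Expr.const a).cost = 1 := rfl
theorem cost_reg : (Expr.reg a).cost = 1 := rfl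
theorem cost_load : (Expr.load e).cost = e.cost + 1 := rfl
theorem cost_add : (e + f).cost = e.cost + f.cost + 1 := rfl
theorem cost_sub : (e - f).cost = e.cost + f.cost + 1 := rfl
theorem cost_mul : (e * f).cost = e.cost + f.cost + 1 := rfl
theorem cost_div : (e / f).cost = e.cost + f.cost + 1 := rfl
theorem cost_mod : (e % f).cost = e.cost + f.cost + 1 := rfl
theorem cost_bin (o : BinOp) : (Expr.bin o e f).cost = e.cost + f.cost + 1 := rfl

theorem reg_setReg : (s.setReg x a).reg y = if y = x then a else s.reg y :=
  Function.update_apply _ _ _ _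
theorem mem_setReg : (s.setReg x a).mem = s.mem := rfl
theorem reg_setMem : (s.setMem p a).reg = s.reg := rfl
theorem mem_setMem : (s.setMem p a).mem y = if y = p then a else s.mem y :=
  Function.update_apply _ _ _ _

end Simp

attribute [simp] eval_const eval_reg eval_load eval_add eval_sub eval_mul eval_div eval_mod
  eval_lt eval_eq fits_const fits_reg fits_load fits_add fits_mul fits_sub fits_div fits_mod
  fits_lt fits_eq cost_const cost_reg cost_load cost_add cost_sub cost_mul cost_div cost_mod
  cost_bin reg_setReg mem_setReg reg_setMem mem_setMem

theorem ite_one_le {W : ℕ} (hW : 1 ≤ W) (p : Prop) [Decidable p] : (if p then 1 else 0) ≤ W := by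
  split_ifs
  · exact hW
  · exact Nat.zero_le _

/-- Started in `s`, the program `P` halts within `T` steps in a state satisfying `Q`, and no
number in the run exceeds `W`. -/
def Ends (W : ℕ) (P : Prog) (s : State) (T : ℕ) (Q : State → Prop) : Prop :=
  ∃ t s', Exec W P s t s' ∧ t ≤ T ∧ Q s'

namespace Ends

variable {W T T₁ T₂ x : ℕ} {P P' : Prog} {s : State} {Q Q' : State → Prop} {e f : Expr}

theorem mono (h : Ends W P s T₁ Q) (hT : T₁ ≤ T) : Ends W P s T Q := by
  obtain ⟨t, s', h, ht, hQ⟩ := h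
  exact ⟨t, s', h, ht.trans hT, hQ⟩

theorem imp (h : Ends W P s T Q) (hQ : ∀ s', Q s' → Q' s') : Ends W P s T Q' := by
  obtain ⟨t, s', h, ht, h'⟩ := h
  exact ⟨t, s', h, ht, hQ s' h'⟩

theorem skip (hQ : Q s) (hT : 1 ≤ T) : Ends W .skip s T Q := ⟨_, _, .skip s, hT, hQ⟩

theorem assign (he : e.Fits W s) (hT : e.cost + 1 ≤ T) (hQ : Q (s.setReg x (e.eval s))) :
    Ends W (.assign x e) s T Q := ⟨_, _, .assign s x e he, hT, hQ⟩

theorem store (he : e.Fits W s) (hf : f.Fits W s) (hT : e.cost + f.cost + 1 ≤ T)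
    (hQ : Q (s.setMem (e.eval s) (f.eval s))) : Ends W (.store e f) s T Q :=
  ⟨_, _, .store s e f he hf, hT, hQ⟩

theorem seq (h : Ends W P s T₁ Q) (hT : T₁ ≤ T) (h' : ∀ s', Q s' → Ends W P' s' (T - T₁) Q') :
    Ends W (.seq P P') s T Q' := by
  obtain ⟨t, s', h, ht, hQ⟩ := h
  obtain ⟨t', s'', h', ht', hQ'⟩ := h' s' hQ
  exact ⟨_, _, .seq h h', by omega, hQ'⟩

theorem assign_seq (he : e.Fits W s) (hT : e.cost + 1 ≤ T)
    (h : Ends W P (s.setReg x (e.eval s)) (T - (e.cost + 1)) Q) :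
    Ends W (.seq (.assign x e) P) s T Q :=
  seq (Q := fun s' => s' = s.setReg x (e.eval s)) (assign he le_rfl rfl) hT
    fun _ hs => hs ▸ h

theorem ite (he : e.Fits W s) (hT : e.cost + 1 ≤ T)
    (h1 : e.eval s ≠ 0 → Ends W P s (T - (e.cost + 1)) Q)
    (h2 : e.eval s = 0 → Ends W P' s (T - (e.cost + 1)) Q) : Ends W (.ite e P P') s T Q := by
  by_cases h : e.eval s = 0
  · obtain ⟨t, s', h', ht, hQ⟩ := h2 h
    exact ⟨_, _, .ite_false he h h', by omega, hQ⟩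
  · obtain ⟨t, s', h', ht, hQ⟩ := h1 h
    exact ⟨_, _, .ite_true he h h', by omega, hQ⟩

end Ends

/-- `for x = 0, …, b - 1 do P`, where `b` is the content of a register. -/
def forLoop (x b : ℕ) (P : Prog) : Prog :=
  .seq (.assign x (.const 0))
    (.loop (.bin .lt (.reg x) (.reg b)) (.seq P (.assign x (.reg x + .const 1))))

/-- The rule for counting loops: `Inv i` is the invariant after `i` rounds. -/
theorem Ends.forLoop {W x b N T : ℕ} {P : Prog} {s : State} (Inv : ℕ → State → Prop)
    (hW : 1 ≤ W) (hN : N ≤ W) (hb : ∀ i s, Inv i s → s.reg b = N) (h0 : Inv 0 (s.setReg x 0))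
    (hstep : ∀ i < N, ∀ s, Inv i s → s.reg x = i →
      Ends W P s T fun s' => s'.reg x = i ∧ Inv (i + 1) (s'.setReg x (i + 1))) :
    Ends W (forLoop x b P) s (N * (T + 8) + 6) (Inv N) := by
  have main : ∀ m i, i + m = N → ∀ s, Inv i s → s.reg x = i →
      Ends W (.loop (.bin .lt (.reg x) (.reg b)) (.seq P (.assign x (.reg x + .const 1)))) s
        (m * (T + 8) + 4) (Inv N) := by
    intro m
    induction m with
    | zero =>
      intro i hi s hI hx
      obtain rfl : i = N := by omega
      refine ⟨_, _, .loop_false ?_ ?_, ?_, hI⟩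
      · simp [hb _ _ hI, hx, hN]
      · simp [hb _ _ hI, hx]
      · simp
    | succ m ih =>
      intro i hi s hI hx
      obtain ⟨t, s', h, ht, hx', hI'⟩ := hstep i (by omega) s hI hx
      obtain ⟨t', s'', h', ht', hQ⟩ := ih (i + 1) (by omega) _ hI' (by simp)
      have ha : Exec W (.assign x (.reg x + .const 1)) s' 4 (s'.setReg x (i + 1)) := by
        have := Exec.assign (W := W) s' x (.reg x + .const 1) (by
          simp only [fits_add, fits_reg, fits_const, eval_reg, eval_const, hx']; omega)
        simpa [hx'] using this
      refine ⟨_, _, .loop_true ?_ ?_ (.seq h ha) h', ?_, hQ⟩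
      · have : i < N := by omega
        simp only [fits_lt, fits_reg, eval_reg, hb _ _ hI, hx, hN, true_and, this, if_true]
        omega
      · have : i < N := by omega
        simp [hb _ _ hI, hx, this]
      · simp only [cost_bin, cost_reg]
        have : (m + 1) * (T + 8) = m * (T + 8) + (T + 8) := by ring
        omega
  refine Ends.assign_seq (by simp) (by simp only [cost_const]; omega) ?_
  refine Ends.mono (main N 0 (by omega) _ (by simpa using h0) (by simp)) ?_
  simp only [cost_const]; omega

/-! ### Arithmetic of profiles -/

open MinConsistentSubset MinConsistentSubset.Profile

/-- The constants that the program keeps in its registers `0, …, 8`. -/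
structure Constants (n k : ℕ) (s : State) : Prop where
  r0 : s.reg 0 = n
  r1 : s.reg 1 = k
  r2 : s.reg 2 = 2 ^ k
  r3 : s.reg 3 = (n + 1) * 2 ^ k
  r4 : s.reg 4 = n + n * n
  r5 : s.reg 5 = n + n * n + n
  r6 : s.reg 6 = (n + 1) * 2 ^ k * ((n + 1) * 2 ^ k) * ((n + 1) * 2 ^ k)
  r7 : s.reg 7 = n * ((n + 1) * 2 ^ k) * ((n + 1) * 2 ^ k)
  r8 : s.reg 8 = n - 1

theorem Constants.congr {n k : ℕ} {s s' : State} (h : Constants n k s)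
    (hs : ∀ y < 9, s'.reg y = s.reg y) : Constants n k s' := by
  obtain ⟨h0, h1, h2, h3, h4, h5, h6, h7, h8⟩ := h
  constructor <;> rw [hs _ (by norm_num)] <;> assumption

/-- The word size suffices for all addresses of tables and for all loop counters. -/
structure Room (n k W : ℕ) : Prop where
  pos : 0 < n
  two : 2 ≤ W
  words : n + n * n + n + 2 * n * ((n + 1) * 2 ^ k) * ((n + 1) * 2 ^ k) * (n + 1) ≤ W
  cube : (n + 1) * 2 ^ k * ((n + 1) * 2 ^ k) * ((n + 1) * 2 ^ k) ≤ W

section Room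

variable {n k W : ℕ}

theorem Room.card_codes (h : Room n k W) : (n + 1) * 2 ^ k * 2 ≤ W := by
  have h1 := h.pos
  have h2 := h.words
  have h3 : 1 ≤ 2 ^ k := Nat.one_le_two_pow
  have h4 : 1 ≤ (n + 1) * 2 ^ k := Nat.mul_pos (by omega) h3
  calc (n + 1) * 2 ^ k * 2 = (2 * 1 * ((n + 1) * 2 ^ k)) * 1 * 1 := by ring
    _ ≤ (2 * n * ((n + 1) * 2 ^ k)) * ((n + 1) * 2 ^ k) * (n + 1) := by gcongr <;> omega
    _ ≤ W := by omega

theorem Room.two_pow (h : Room n k W) : 2 ^ k * 2 ≤ W := by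
  have := h.card_codes
  nlinarith [Nat.two_pow_pos k]

theorem Room.colours (h : Room n k W) : k ≤ W := by
  have := h.two_pow
  have := (Nat.lt_two_pow_self (n := k))
  omega

end Room

/-- `s'` differs from `s` at most in the register `d` and in the scratch registers from `30`
on. -/
def Keeps (d : ℕ) (s s' : State) : Prop :=
  (∀ y < 30, y ≠ d → s'.reg y = s.reg y) ∧ s'.mem = s.mem

/-- Register `d` receives `2 ^ m`, where `m` is the content of register `a`. -/
def powProg (a d : ℕ) : Prog :=
  .seq (.assign d (.const 1)) (forLoop 30 a (.assign d (.reg d * .const 2)))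

theorem ends_powProg {W a d m : ℕ} {s : State} (ha : a < 30) (hd : d < 30) (had : a ≠ d)
    (hm : s.reg a = m) (h2 : 2 ≤ W) (hW : 2 ^ m ≤ W) :
    Ends W (powProg a d) s (m * 12 + 8) fun s' => s'.reg d = 2 ^ m ∧ Keeps d s s' := by
  have hmW : m ≤ W := (Nat.lt_two_pow_self (n := m)).le.trans hW
  refine Ends.assign_seq (by simp; omega) (by simp) ?_
  refine Ends.mono (Ends.imp (Ends.forLoop (N := m) (T := 4)
    (fun i s' => s'.reg d = 2 ^ i ∧ Keeps d s s') (by omega) hmW ?_ ?_ ?_) ?_) ?_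
  · rintro i s' ⟨-, h, -⟩
    rw [h a ha had, hm]
  · refine ⟨?_, ?_, ?_⟩
    · have : d ≠ 30 := by omega
      simp [this]
    · intro y hy hyd
      have : y ≠ 30 := by omega
      simp [this, hyd]
    · simp
  · rintro i hi s' ⟨h1, h2', h3⟩ hx
    have hp : 2 ^ i * 2 ≤ W := by
      rw [← pow_succ]
      exact (Nat.pow_le_pow_right (by norm_num) hi).trans hW
    have hd30 : d ≠ 30 := by omega
    refine Ends.assign ?_ (by simp) ⟨?_, ?_, ?_, ?_⟩
    · simp only [fits_mul, fits_reg, fits_const, eval_reg, eval_const, h1]; omega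
    · simp [hd30.symm, hx]
    · simp [hd30, h1, pow_succ]
    · intro y hy hyd
      have : y ≠ 30 := by omega
      simp [this, hyd, h2' y hy hyd]
    · simpa using h3
  · rintro s' h; exact h
  · simp

/-- Register `d` receives the code of the shift of the profile coded by register `a`. -/
def shiftProg (a d : ℕ) : Prog :=
  .ite (.bin .lt (.reg a / .reg 2 + .const 1) (.reg 0))
    (.assign d (.reg a + .reg 2)) (.assign d (.reg 0 * .reg 2))

theorem code_shift (n k x : ℕ) : code k (shift n (ofCode k x)) =
    if x / 2 ^ k + 1 < n then x + 2 ^ k else n * 2 ^ k := by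
  unfold shift
  simp only [show (ofCode k x).1 = x / 2 ^ k from rfl]
  split_ifs
  · simp only [ofCode, code]
    rw [add_mul, one_mul, add_right_comm, mul_comm (x / 2 ^ k), Nat.div_add_mod]
  · simp [code, far]

theorem ends_shiftProg {n k W a d x : ℕ} {s : State} (hW : Room n k W) (hs : Constants n k s)
    (hx : s.reg a = x) (hxM : x < (n + 1) * 2 ^ k) :
    Ends W (shiftProg a d) s 20 fun s' =>
      s'.reg d = code k (shift n (ofCode k x)) ∧ Keeps d s s' := by
  have h1 := hW.card_codes
  have h2 := hW.two_pow
  have h0 := Nat.two_pow_pos k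
  have h4 : (n + 1) * 2 ^ k = n * 2 ^ k + 2 ^ k := by ring
  have h3 : n ≤ n * 2 ^ k := Nat.le_mul_of_pos_right n h0
  have h5 : x / 2 ^ k ≤ x := Nat.div_le_self _ _
  have h6 := hW.two
  rw [code_shift]
  refine Ends.ite ?_ (by simp) ?_ ?_
  · simp only [fits_lt, fits_add, fits_div, fits_reg, fits_const, eval_add, eval_div, eval_reg,
      eval_const, hx, hs.r0, hs.r2]
    have := ite_one_le (W := W) (by omega) (x / 2 ^ k + 1 < n)
    refine ⟨⟨⟨?_, ?_⟩, ?_, ?_⟩, ?_, this⟩ <;> omega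
  all_goals
    simp only [eval_lt, eval_add, eval_div, eval_reg, eval_const, hx, hs.r0, hs.r2]
    intro h
    refine Ends.assign ?_ (by simp) ⟨?_, ?_, ?_⟩
  · simp only [fits_add, fits_reg, eval_reg, hx, hs.r2]
    omega
  · have : x / 2 ^ k + 1 < n := by by_contra h'; simp [h'] at h
    simp [hx, hs.r2, this]
  · intro y _ hy; simp [hy]
  · simp
  · simp only [fits_mul, fits_reg, eval_reg, hs.r0, hs.r2]
    omega
  · have : ¬ x / 2 ^ k + 1 < n := by intro h'; simp [h'] at h
    simp [hs.r0, hs.r2, this]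
  · intro y _ hy; simp [hy]
  · simp

/-- Register `d` receives the code of the merge of the profiles coded by the registers `a` and
`b`. The bitwise disjunction of the colour masks is computed bit by bit. -/
def mergeProg (a b d : ℕ) : Prog :=
  .seq (.assign 31 (.reg a / .reg 2)) <|
  .seq (.assign 32 (.reg b / .reg 2)) <|
  .ite (.bin .lt (.reg 31) (.reg 32)) (.assign d (.reg a)) <|
  .ite (.bin .lt (.reg 32) (.reg 31)) (.assign d (.reg b)) <|
  .seq (.assign 33 (.const 0)) <|
  .seq (.assign 34 (.const 1)) <|
  .seq (forLoop 35 1 <|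
    .seq (.assign 33 (.reg 33 + .reg 34 * .bin .lt (.const 0)
      (.reg a / .reg 34 % .const 2 + .reg b / .reg 34 % .const 2)))
    (.assign 34 (.reg 34 * .const 2))) <|
  .assign d (.reg 31 * .reg 2 + .reg 33)

theorem code_merge (k x y : ℕ) : code k (merge (ofCode k x) (ofCode k y)) =
    if x / 2 ^ k < y / 2 ^ k then x
    else if y / 2 ^ k < x / 2 ^ k then y
    else x / 2 ^ k * 2 ^ k + (x ||| y) % 2 ^ k := by
  unfold merge
  simp only [show (ofCode k x).1 = x / 2 ^ k from rfl, show (ofCode k y).1 = y / 2 ^ k from rfl]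
  split_ifs
  · exact code_ofCode k x
  · exact code_ofCode k y
  · simp only [code, ofCode, Nat.or_mod_two_pow]

theorem or_mod_two_pow_succ (x y i : ℕ) : (x ||| y) % 2 ^ (i + 1) =
    (x ||| y) % 2 ^ i + 2 ^ i * if 0 < x / 2 ^ i % 2 + y / 2 ^ i % 2 then 1 else 0 := by
  rw [Nat.mod_pow_succ, ← Nat.toNat_testBit, Nat.testBit_or, Nat.testBit_eq_decide_div_mod_eq,
    Nat.testBit_eq_decide_div_mod_eq]
  congr 2
  rcases Nat.mod_two_eq_zero_or_one (x / 2 ^ i) with h | h <;>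
  rcases Nat.mod_two_eq_zero_or_one (y / 2 ^ i) with h' | h' <;> simp [h, h']

theorem ends_mergeProg {n k W a b d x y : ℕ} {s : State} (hW : Room n k W)
    (hs : Constants n k s) (ha : a < 30) (hb : b < 30) (hx : s.reg a = x)
    (hxM : x < (n + 1) * 2 ^ k) (hy : s.reg b = y) (hyM : y < (n + 1) * 2 ^ k) :
    Ends W (mergeProg a b d) s (k * 40 + 50) fun s' =>
      s'.reg d = code k (merge (ofCode k x) (ofCode k y)) ∧ Keeps d s s' := by
  have h1 := hW.card_codes
  have h2 := hW.two_pow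
  have h6 := hW.two
  have h5 : x / 2 ^ k ≤ x := Nat.div_le_self _ _
  have h5' : y / 2 ^ k ≤ y := Nat.div_le_self _ _
  have h7 : x / 2 ^ k * 2 ^ k ≤ x := Nat.div_mul_le_self _ _
  have hlt : ∀ y, y < 30 → y ≠ 31 ∧ y ≠ 32 ∧ y ≠ 33 ∧ y ≠ 34 ∧ y ≠ 35 := fun y hy => by omega
  rw [code_merge]
  refine Ends.assign_seq (by simp [hx, hs.r2]; omega) (by simp) ?_
  refine Ends.assign_seq (by simp [hlt b hb, hy, hs.r2]; omega) (by simp) ?_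
  simp only [eval_div, eval_reg, reg_setReg, hx, hs.r2, hy, hlt b hb, if_false, cost_div,
    cost_reg, Nat.reduceEqDiff]
  refine Ends.ite ?_ (by simp) ?_ ?_
  · simp only [fits_lt, fits_reg, eval_reg, reg_setReg, Nat.reduceEqDiff, if_true, if_false]
    exact ⟨by omega, by omega, ite_one_le (by omega) _⟩
  · intro h
    have h : x / 2 ^ k < y / 2 ^ k := by by_contra h'; simp [h'] at h
    refine Ends.assign (by simp [hlt a ha, hx]; omega) (by simp) ⟨?_, ?_, ?_⟩
    · simp [hlt a ha, hx, h]
    · intro z hz hzd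
      simp [hlt z hz, hzd]
    · simp
  intro h
  have h : ¬ x / 2 ^ k < y / 2 ^ k := by intro h'; simp [h'] at h
  refine Ends.ite ?_ (by simp) ?_ ?_
  · simp only [fits_lt, fits_reg, eval_reg, reg_setReg, Nat.reduceEqDiff, if_true, if_false]
    exact ⟨by omega, by omega, ite_one_le (by omega) _⟩
  · intro h'
    have h' : y / 2 ^ k < x / 2 ^ k := by by_contra h''; simp [h''] at h'
    refine Ends.assign (by simp [hlt b hb, hy]; omega) (by simp) ⟨?_, ?_, ?_⟩
    · simp [hlt b hb, hy, h, h']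
    · intro z hz hzd
      simp [hlt z hz, hzd]
    · simp
  intro h'
  have h' : ¬ y / 2 ^ k < x / 2 ^ k := by intro h''; simp [h''] at h'
  rw [if_neg h, if_neg h']
  refine Ends.assign_seq (by simp) (by simp) ?_
  refine Ends.assign_seq (by simp; omega) (by simp) ?_
  refine Ends.seq (Ends.forLoop (N := k) (T := 24)
    (fun i s' => s'.reg 31 = x / 2 ^ k ∧ s'.reg 33 = (x ||| y) % 2 ^ i ∧ s'.reg 34 = 2 ^ i ∧
      (∀ y < 30, s'.reg y = s.reg y) ∧ s'.mem = s.mem) (by omega) hW.colours ?_ ?_ ?_) ?_ ?_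
  · rintro i s' ⟨-, -, -, h, -⟩
    rw [h 1 (by norm_num), hs.r1]
  · refine ⟨by simp, by simp [Nat.mod_one], by simp, ?_, by simp⟩
    intro z hz
    simp [hlt z hz]
  · rintro i hi s' ⟨e1, e2, e3, e4, e5⟩ e6
    have hp : 2 ^ i * 2 ≤ 2 ^ k := by
      rw [← pow_succ]
      exact Nat.pow_le_pow_right (by norm_num) hi
    have hm : (x ||| y) % 2 ^ i < 2 ^ i := Nat.mod_lt _ (Nat.two_pow_pos i)
    have hm' : (x ||| y) % 2 ^ (i + 1) < 2 ^ (i + 1) := Nat.mod_lt _ (Nat.two_pow_pos _)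
    have m1 : x / 2 ^ i % 2 < 2 := Nat.mod_lt _ (by norm_num)
    have m2 : y / 2 ^ i % 2 < 2 := Nat.mod_lt _ (by norm_num)
    have l := ite_one_le (W := 1) le_rfl (0 < x / 2 ^ i % 2 + y / 2 ^ i % 2)
    have hmul := Nat.mul_le_mul_left (2 ^ i) l
    refine Ends.assign_seq ?_ (by simp) ?_
    · simp only [fits_add, fits_mul, fits_lt, fits_mod, fits_div, fits_reg, fits_const, eval_reg,
        eval_const, eval_add, eval_mul, eval_div, eval_mod, eval_lt, e2, e3, e4 a ha, e4 b hb, hx,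
        hy]
      refine ⟨?_, ⟨?_, ⟨?_, ⟨⟨⟨?_, ?_⟩, ?_⟩, ⟨⟨?_, ?_⟩, ?_⟩, ?_⟩, ?_⟩, ?_⟩, ?_⟩ <;> omega
    · refine Ends.assign ?_ (by simp) ⟨?_, ?_, ?_, ?_, ?_, ?_⟩
      · simp only [fits_mul, fits_reg, fits_const, eval_reg, eval_const, reg_setReg,
          Nat.reduceEqDiff, if_false, e3]
        omega
      · simp [e6]
      · simp [e1]
      · simp [e2, e3, e4 a ha, e4 b hb, hx, hy, or_mod_two_pow_succ]
      · simp [e3, pow_succ]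
      · intro z hz
        simp [hlt z hz, e4 z hz]
      · simp [e5]
  · simp; omega
  · rintro s' ⟨e1, e2, e3, e4, e5⟩
    have hm : (x ||| y) % 2 ^ k < 2 ^ k := Nat.mod_lt _ (Nat.two_pow_pos k)
    refine Ends.assign ?_ ?_ ⟨?_, ?_, ?_⟩
    · simp only [fits_mul, fits_add, fits_reg, eval_mul, eval_reg, e1, e2, e4 2 (by norm_num),
        hs.r2]
      refine ⟨⟨?_, ?_, ?_⟩, ?_, ?_⟩ <;> omega
    · simp; omega
    · simp [e1, e2, e4 2 (by norm_num), hs.r2]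
    · intro z hz hzd
      simp [hzd, e4 z hz]
    · simp [e5]

/-! ### Tables in memory -/

section Memory

variable {n k : ℕ}

/-- The cells from `a` on hold a table entry: cell `a` holds `0` for `none`, and for `some S` it
holds the cardinality of `S` plus one, followed by the `n` values of the indicator function of
`S`. -/
def HoldsEntry (s : State) (a : ℕ) : Option (Finset (Fin n)) → Prop
  | none => s.mem a = 0
  | some S => s.mem a = S.card + 1 ∧ ∀ u : Fin n, s.mem (a + 1 + u) = if u ∈ S then 1 else 0

/-- The address of the entry at position `j`. -/
def addr (n j : ℕ) : ℕ := n + n * n + n + j * (n + 1)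

/-- The memory holds the tables `D`. -/
def Holds (n k : ℕ) (s : State) (D : Tables n) : Prop :=
  ∀ j < 2 * n * ((n + 1) * 2 ^ k) * ((n + 1) * 2 ^ k), HoldsEntry s (addr n j) (D j)

theorem HoldsEntry.congr {s s' : State} {a : ℕ} {o : Option (Finset (Fin n))}
    (h : HoldsEntry s a o) (hs : ∀ p, a ≤ p → p ≤ a + n → s'.mem p = s.mem p) :
    HoldsEntry s' a o := by
  cases o with
  | none => exact (hs a le_rfl (by omega)).trans h
  | some S =>
    refine ⟨(hs a le_rfl (by omega)).trans h.1, fun u => ?_⟩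
    rw [hs _ (by omega) (by omega)]
    exact h.2 u

theorem HoldsEntry.eq_zero_iff {s : State} {a : ℕ} {o : Option (Finset (Fin n))}
    (h : HoldsEntry s a o) : s.mem a = 0 ↔ o = none := by
  cases o with
  | none => exact ⟨fun _ => rfl, fun _ => h⟩
  | some S => simp [h.1]

theorem HoldsEntry.mem_le {s : State} {a : ℕ} {o : Option (Finset (Fin n))}
    (h : HoldsEntry s a o) : s.mem a ≤ n + 1 := by
  cases o with
  | none => rw [show s.mem a = 0 from h]; omega
  | some S =>
    rw [h.1]
    have := S.card_le_univ
    simp only [Fintype.card_fin] at this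
    omega

theorem Holds.congr {s s' : State} {D : Tables n} (h : Holds n k s D)
    (hs : ∀ p, n + n * n + n ≤ p → s'.mem p = s.mem p) : Holds n k s' D :=
  fun j hj => (h j hj).congr fun p hp _ => hs p (by unfold addr at hp; omega)

theorem addr_add_lt {i j : ℕ} (h : i < j) : addr n i + n < addr n j := by
  unfold addr
  have : (i + 1) * (n + 1) ≤ j * (n + 1) := Nat.mul_le_mul_right _ h
  rw [add_mul] at this
  omega

theorem Holds.update {s s' : State} {D : Tables n} (h : Holds n k s D) {j : ℕ}
    {o : Option (Finset (Fin n))} (hj : HoldsEntry s' (addr n j) o)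
    (hs : ∀ p, p < addr n j ∨ addr n j + n < p → s'.mem p = s.mem p) :
    Holds n k s' (Function.update D j o) := by
  intro i hi
  rw [Function.update_apply]
  split_ifs with hij
  · rwa [hij]
  · refine (h i hi).congr fun p hp hp' => hs p ?_
    rcases Nat.lt_or_gt_of_ne hij with h | h
    · have := addr_add_lt (n := n) h; omega
    · have := addr_add_lt (n := n) h; omega

theorem Room.addr_add_le {W j : ℕ} (hW : Room n k W)
    (hj : j < 2 * n * ((n + 1) * 2 ^ k) * ((n + 1) * 2 ^ k)) : addr n j + n < W := by
  have h1 := addr_add_lt (n := n) hj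
  have h2 := hW.words
  unfold addr at h1 ⊢
  omega

end Memory

/-- The entry whose address is in register `a` is set to a set whose cardinality plus one is the
value of `e` and whose indicator function is `f`, a function of register `28`. -/
def writeProg (a : ℕ) (e f : Expr) : Prog :=
  .seq (.store (.reg a) e) (forLoop 28 0 (.store (.reg a + .const 1 + .reg 28) f))

theorem ends_writeProg {n k W a p : ℕ} {e f : Expr} {s : State} {S : Finset (Fin n)}
    (hW : Room n k W) (hs : Constants n k s) (ha : a < 28) (hp : s.reg a = p) (hpW : p + n < W)
    (he : e.Fits W s ∧ e.eval s = S.card + 1)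
    (hf : ∀ (s' : State) (u : Fin n), (∀ y < 28, s'.reg y = s.reg y) →
      (∀ q, q < p ∨ p + n < q → s'.mem q = s.mem q) → s'.reg 28 = u →
      f.Fits W s' ∧ f.eval s' = if u ∈ S then 1 else 0) :
    Ends W (writeProg a e f) s (n * (f.cost + 14) + e.cost + 8) fun s' =>
      (∀ y < 28, s'.reg y = s.reg y) ∧ (∀ q, q < p ∨ p + n < q → s'.mem q = s.mem q) ∧
      HoldsEntry s' p (some S) := by
  have h6 := hW.two
  refine Ends.seq (T₁ := e.cost + 2)
    (Q := fun s' => s'.reg = s.reg ∧ (∀ q, q < p ∨ p + n < q → s'.mem q = s.mem q) ∧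
      s'.mem p = S.card + 1) ?_ (by omega) ?_
  · refine Ends.store (by simp only [fits_reg, hp]; omega) he.1 (by simp; omega) ⟨?_, ?_, ?_⟩
    · simp
    · intro q hq
      have : q ≠ p := by omega
      simp [hp, this]
    · simp [hp, he.2]
  rintro s₁ ⟨hr, hm, hz⟩
  refine Ends.mono (Ends.imp (Ends.forLoop (N := n) (T := f.cost + 6)
    (fun i s' => (∀ y < 28, s'.reg y = s.reg y) ∧
      (∀ q, q < p ∨ p + n < q → s'.mem q = s.mem q) ∧ s'.mem p = S.card + 1 ∧
      ∀ u : Fin n, (u : ℕ) < i → s'.mem (p + 1 + u) = if u ∈ S then 1 else 0)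
    (by omega) (by omega) ?_ ?_ ?_) ?_) ?_
  · rintro i s' ⟨h, -⟩
    rw [h 0 (by norm_num), hs.r0]
  · refine ⟨?_, ?_, ?_, by simp⟩
    · intro y hy
      have : y ≠ 28 := by omega
      simp [this, hr]
    · simpa using hm
    · simpa using hz
  · rintro i hi s' ⟨h1, h2, h3, h4⟩ hx
    obtain ⟨hf1, hf2⟩ := hf s' ⟨i, hi⟩ h1 h2 hx
    refine Ends.store ?_ hf1 (by simp; omega) ⟨?_, ?_, ?_, ?_, ?_⟩
    · simp only [fits_add, fits_reg, fits_const, eval_add, eval_reg, eval_const, h1 a ha, hp, hx]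
      omega
    · simp [hx]
    · intro y hy
      have : y ≠ 28 := by omega
      simp [this, h1 y hy]
    · intro q hq
      have : q ≠ p + 1 + i := by omega
      simp [h1 a ha, hp, hx, this, h2 q hq]
    · have : p ≠ p + 1 + i := by omega
      simp [h1 a ha, hp, hx, this, h3]
    · intro u hu
      simp only [mem_setReg, mem_setMem, eval_add, eval_reg, eval_const, h1 a ha, hp, hx, hf2]
      rcases Nat.lt_succ_iff_lt_or_eq.mp hu with hu | hu
      · rw [if_neg (by omega), h4 u hu]
      · have : u = ⟨i, hi⟩ := Fin.ext hu
        subst this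
        simp
  · rintro s' ⟨h1, h2, h3, h4⟩
    exact ⟨h1, h2, h3, fun u => h4 u u.2⟩
  · have : f.cost + 6 + 8 = f.cost + 14 := by omega
    rw [this]; omega

/-- The address of entry `(σ, τ)` of table `i`, computed from expressions for `i`, `σ`, `τ`. -/
def addrExpr (i σ τ : Expr) : Expr :=
  .reg 5 + ((i * .reg 3 + σ) * .reg 3 + τ) * (.reg 0 + .const 1)

section Address

variable {n k W iv σv τv : ℕ} {i σ τ : Expr} {s : State}

theorem eval_addrExpr (hs : Constants n k s) (hi : i.eval s = iv) (hσ : σ.eval s = σv)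
    (hτ : τ.eval s = τv) :
    (addrExpr i σ τ).eval s = addr n (entry ((n + 1) * 2 ^ k) iv σv τv) := by
  simp only [addrExpr, eval_add, eval_mul, eval_reg, eval_const, hs.r0, hs.r3, hs.r5, hi, hσ, hτ,
    addr, entry]

theorem fits_addrExpr (hW : Room n k W) (hs : Constants n k s) (hi : i.Fits W s)
    (hσ : σ.Fits W s) (hτ : τ.Fits W s) (hi' : i.eval s < 2 * n)
    (hσ' : σ.eval s < (n + 1) * 2 ^ k) (hτ' : τ.eval s < (n + 1) * 2 ^ k) :
    (addrExpr i σ τ).Fits W s := by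
  have h1 := hW.addr_add_le (entry_lt hi' hσ' hτ')
  have h2 := hW.card_codes
  have h6 := hW.two
  simp only [addrExpr, fits_add, fits_mul, fits_reg, fits_const, eval_add, eval_mul, eval_reg,
    eval_const, hs.r0, hs.r3, hs.r5, hi, hσ, hτ, true_and]
  generalize (n + 1) * 2 ^ k = M at *
  unfold addr entry at h1
  have a1 : i.eval s * M + σ.eval s ≤ (i.eval s * M + σ.eval s) * M :=
    Nat.le_mul_of_pos_right _ (by omega)
  have a2 : (i.eval s * M + σ.eval s) * M + τ.eval s ≤
    ((i.eval s * M + σ.eval s) * M + τ.eval s) * (n + 1) :=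
    Nat.le_mul_of_pos_right _ (by omega)
  omega

end Address

/-! ### Combining two tables -/

/-- The addresses of the three entries that take part in the step of combining whose number is
in register `13`; the numbers of the three tables are in the registers `10`, `11` and `12`. -/
def locateProg : Prog :=
  .seq (.assign 14 (.reg 13 / .reg 3 / .reg 3)) <|
  .seq (.assign 15 (.reg 13 / .reg 3 % .reg 3)) <|
  .seq (.assign 16 (.reg 13 % .reg 3)) <|
  .seq (shiftProg 15 17) <|
  .seq (mergeProg 17 16 18) <|
  .seq (mergeProg 14 16 19) <|
  .seq (shiftProg 19 19) <|
  .seq (mergeProg 14 17 20) <|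
  .seq (.assign 21 (addrExpr (.reg 10) (.reg 14) (.reg 18))) <|
  .seq (.assign 22 (addrExpr (.reg 11) (.reg 15) (.reg 19))) <|
  .assign 23 (addrExpr (.reg 12) (.reg 20) (.reg 16))

section Step

variable {n k W : ℕ}

theorem Constants.keeps {d : ℕ} {s s' : State} (h : Constants n k s) (hd : 9 ≤ d)
    (hs : Keeps d s s') : Constants n k s' :=
  h.congr fun y hy => hs.1 y (by omega) (by omega)

/-- Position of the entry of the first cluster that is read in step `q`. -/
def pos₁ (n k i₁ q : ℕ) : ℕ :=
  let M := (n + 1) * 2 ^ k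
  entry M i₁ (q / M / M) (code k (merge (shift n (ofCode k (q / M % M))) (ofCode k (q % M))))

/-- Position of the entry of the second cluster that is read in step `q`. -/
def pos₂ (n k i₂ q : ℕ) : ℕ :=
  let M := (n + 1) * 2 ^ k
  entry M i₂ (q / M % M) (code k (shift n (merge (ofCode k (q / M / M)) (ofCode k (q % M)))))

/-- Position of the entry of the union that is improved in step `q`. -/
def pos₃ (n k i₃ q : ℕ) : ℕ :=
  let M := (n + 1) * 2 ^ k
  entry M i₃ (code k (merge (ofCode k (q / M / M)) (shift n (ofCode k (q / M % M))))) (q % M)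

theorem mergeStep_eq (i₁ i₂ i₃ : ℕ) (D : Tables n) (q : ℕ) :
    mergeStep k i₁ i₂ i₃ D q = Function.update D (pos₃ n k i₃ q)
      (combine (D (pos₁ n k i₁ q)) (D (pos₂ n k i₂ q)) (D (pos₃ n k i₃ q))) := by
  simp only [mergeStep, pos₁, pos₂, pos₃, code_ofCode]

theorem ends_locateProg {i₁ i₂ i₃ q : ℕ} {s : State} (hW : Room n k W) (hs : Constants n k s)
    (h10 : s.reg 10 = i₁) (h11 : s.reg 11 = i₂) (h12 : s.reg 12 = i₃) (h13 : s.reg 13 = q)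
    (hi₁ : i₁ < 2 * n) (hi₂ : i₂ < 2 * n) (hi₃ : i₃ < 2 * n)
    (hq : q < (n + 1) * 2 ^ k * ((n + 1) * 2 ^ k) * ((n + 1) * 2 ^ k)) :
    Ends W locateProg s (k * 120 + 300) fun s' =>
      (∀ y < 14, s'.reg y = s.reg y) ∧ s'.mem = s.mem ∧
      s'.reg 21 = addr n (pos₁ n k i₁ q) ∧ s'.reg 22 = addr n (pos₂ n k i₂ q) ∧
      s'.reg 23 = addr n (pos₃ n k i₃ q) := by
  obtain ⟨la, lb, lt⟩ := entry_decode_lt hq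
  have hc := hW.card_codes
  have hqW := hW.cube
  have va := valid_ofCode la
  have vb := valid_ofCode lb
  have vt := valid_ofCode lt
  have l18 := code_lt (vb.shift.merge vt)
  have l19' := code_lt (va.merge vt)
  have l19 := code_lt (va.merge vt).shift
  have l20 := code_lt (va.merge vb.shift)
  have l17 := code_lt vb.shift
  unfold pos₁ pos₂ pos₃
  simp only
  have hM := hs.r3
  generalize hMe : (n + 1) * 2 ^ k = M at *
  generalize ha : q / M / M = a at *
  generalize hb : q / M % M = b at *
  generalize ht : q % M = t at *
  refine Ends.assign_seq (by simp [h13, hM]; omega) (by simp) ?_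
  refine Ends.assign_seq (by simp [h13, hM]; omega) (by simp) ?_
  refine Ends.assign_seq (by simp [h13, hM]; omega) (by simp) ?_
  simp only [eval_div, eval_mod, eval_reg, reg_setReg, Nat.reduceEqDiff, if_false, h13,
    hM, ha, hb, ht, cost_div, cost_mod, cost_reg]
  set s₁ := ((s.setReg 14 a).setReg 15 b).setReg 16 t with hs₁
  have k1 : ∀ y < 14, s₁.reg y = s.reg y := by
    intro y hy
    have : y ≠ 14 ∧ y ≠ 15 ∧ y ≠ 16 := by omega
    simp [hs₁, this]
  have c1 : Constants n k s₁ := hs.congr fun y hy => k1 y (by omega)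
  have m1 : s₁.mem = s.mem := by simp [hs₁]
  have r14 : s₁.reg 14 = a := by simp [hs₁]
  have r15 : s₁.reg 15 = b := by simp [hs₁]
  have r16 : s₁.reg 16 = t := by simp [hs₁]
  refine Ends.seq (ends_shiftProg hW c1 r15 (by omega)) (by omega) ?_
  rintro s₂ ⟨r17, k2⟩
  have c2 := c1.keeps (by norm_num) k2
  refine Ends.seq (ends_mergeProg (a := 17) (b := 16) (d := 18) hW c2 (by norm_num)
    (by norm_num) r17 (by omega) ((k2.1 16 (by norm_num) (by norm_num)).trans r16) (by omega))
    (by omega) ?_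
  rintro s₃ ⟨r18, k3⟩
  have c3 := c2.keeps (by norm_num) k3
  have e14 : s₃.reg 14 = a := by
    rw [k3.1 14 (by norm_num) (by norm_num), k2.1 14 (by norm_num) (by norm_num), r14]
  have e16 : s₃.reg 16 = t := by
    rw [k3.1 16 (by norm_num) (by norm_num), k2.1 16 (by norm_num) (by norm_num), r16]
  refine Ends.seq (ends_mergeProg (a := 14) (b := 16) (d := 19) hW c3 (by norm_num)
    (by norm_num) e14 (by omega) e16 (by omega)) (by omega) ?_
  rintro s₄ ⟨r19, k4⟩
  have c4 := c3.keeps (by norm_num) k4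
  refine Ends.seq (ends_shiftProg (a := 19) (d := 19) hW c4 r19 (by omega)) (by omega) ?_
  rintro s₅ ⟨r19', k5⟩
  have c5 := c4.keeps (by norm_num) k5
  rw [ofCode_code (va.merge vt)] at r19'
  have e14' : s₅.reg 14 = a := by
    rw [k5.1 14 (by norm_num) (by norm_num), k4.1 14 (by norm_num) (by norm_num), e14]
  have e17 : s₅.reg 17 = code k (shift n (ofCode k b)) := by
    rw [k5.1 17 (by norm_num) (by norm_num), k4.1 17 (by norm_num) (by norm_num),
      k3.1 17 (by norm_num) (by norm_num), r17]
  refine Ends.seq (ends_mergeProg (a := 14) (b := 17) (d := 20) hW c5 (by norm_num)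
    (by norm_num) e14' (by omega) e17 (by omega)) (by omega) ?_
  rintro s₆ ⟨r20, k6⟩
  have c6 := c5.keeps (by norm_num) k6
  rw [ofCode_code vb.shift] at r20 r18
  have f19 : s₆.reg 19 = code k (shift n (merge (ofCode k a) (ofCode k t))) := by
    rw [k6.1 19 (by norm_num) (by norm_num), r19']
  have f18 : s₆.reg 18 = code k (merge (shift n (ofCode k b)) (ofCode k t)) := by
    rw [k6.1 18 (by norm_num) (by norm_num), k5.1 18 (by norm_num) (by norm_num),
      k4.1 18 (by norm_num) (by norm_num), r18]
  have f14 : s₆.reg 14 = a := by rw [k6.1 14 (by norm_num) (by norm_num), e14']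
  have f15 : s₆.reg 15 = b := by
    rw [k6.1 15 (by norm_num) (by norm_num), k5.1 15 (by norm_num) (by norm_num),
      k4.1 15 (by norm_num) (by norm_num), k3.1 15 (by norm_num) (by norm_num),
      k2.1 15 (by norm_num) (by norm_num), r15]
  have f16 : s₆.reg 16 = t := by
    rw [k6.1 16 (by norm_num) (by norm_num), k5.1 16 (by norm_num) (by norm_num),
      k4.1 16 (by norm_num) (by norm_num), e16]
  have k7 : ∀ y < 14, s₆.reg y = s.reg y := by
    intro y hy
    rw [k6.1 y (by omega) (by omega), k5.1 y (by omega) (by omega), k4.1 y (by omega) (by omega),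
      k3.1 y (by omega) (by omega), k2.1 y (by omega) (by omega), k1 y hy]
  have m7 : s₆.mem = s.mem := by rw [k6.2, k5.2, k4.2, k3.2, k2.2, m1]
  have f10 := (k7 10 (by norm_num)).trans h10
  have f11 := (k7 11 (by norm_num)).trans h11
  have f12 := (k7 12 (by norm_num)).trans h12
  clear k1 c1 m1 r14 r15 r16 k2 c2 r17 k3 c3 r18 e14 e16 k4 c4 r19 k5 c5 r19' e14' e17 k6
  subst hMe
  have cost : ∀ x y z, (addrExpr (.reg x) (.reg y) (.reg z)).cost = 15 := fun _ _ _ => rfl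
  have hnW : 2 * n ≤ (n + 1) * 2 ^ k * 2 := by nlinarith [Nat.one_le_two_pow (n := k)]
  refine Ends.assign_seq (fits_addrExpr hW c6 ?_ ?_ ?_ ?_ ?_ ?_) (by simp only [cost]; omega) ?_
  any_goals simp only [fits_reg, eval_reg, f10, f14, f18]; omega
  rw [eval_addrExpr (i := .reg 10) (σ := .reg 14) (τ := .reg 18) c6 f10 f14 f18]
  set s₇ := s₆.setReg 21 _ with hs₇
  have c7 : Constants n k s₇ := c6.congr fun y hy => by
    have : y ≠ 21 := by omega
    simp [hs₇, this]
  have g11 : s₇.reg 11 = i₂ := by simp [hs₇, f11]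
  have g15 : s₇.reg 15 = b := by simp [hs₇, f15]
  have g19 : s₇.reg 19 = _ := (show s₇.reg 19 = s₆.reg 19 by simp [hs₇]).trans f19
  refine Ends.assign_seq (fits_addrExpr hW c7 ?_ ?_ ?_ ?_ ?_ ?_) (by simp only [cost]; omega) ?_
  any_goals simp only [fits_reg, eval_reg, g11, g15, g19]; omega
  rw [eval_addrExpr (i := .reg 11) (σ := .reg 15) (τ := .reg 19) c7 g11 g15 g19]
  set s₈ := s₇.setReg 22 _ with hs₈
  have c8 : Constants n k s₈ := c7.congr fun y hy => by
    have : y ≠ 22 := by omega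
    simp [hs₈, this]
  have g12 : s₈.reg 12 = i₃ := by simp [hs₈, hs₇, f12]
  have g16 : s₈.reg 16 = t := by simp [hs₈, hs₇, f16]
  have g20 : s₈.reg 20 = _ := (show s₈.reg 20 = s₆.reg 20 by simp [hs₈, hs₇]).trans r20
  refine Ends.assign (fits_addrExpr hW c8 ?_ ?_ ?_ ?_ ?_ ?_) (by simp only [cost]; omega) ?_
  any_goals simp only [fits_reg, eval_reg, g12, g16, g20]; omega
  rw [eval_addrExpr (i := .reg 12) (σ := .reg 20) (τ := .reg 16) c8 g12 g20 g16]
  refine ⟨?_, ?_, ?_, ?_, ?_⟩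
  · intro y hy
    have : y ≠ 21 ∧ y ≠ 22 ∧ y ≠ 23 := by omega
    simp [hs₈, hs₇, this, k7 y hy]
  · simp [hs₈, hs₇, m7]
  · simp [hs₈, hs₇]
  · simp [hs₈]
  · simp

/-- One step of combining: if both entries hold a set and the union of the two sets improves the
third entry, then it is written there. -/
def stepProg : Prog :=
  .seq locateProg <|
  .ite (.load (.reg 21))
    (.ite (.load (.reg 22))
      (.seq (.assign 24 (.load (.reg 21) + .load (.reg 22) - .const 1)) <|
        .ite (.bin .lt (.reg 24) (.load (.reg 23)) + .bin .eq (.load (.reg 23)) (.const 0))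
          (writeProg 23 (.reg 24)
            (.load (.reg 21 + .const 1 + .reg 28) + .load (.reg 22 + .const 1 + .reg 28)))
          .skip)
      .skip)
    .skip

theorem ends_stepProg {i₁ i₂ i₃ q : ℕ} {s : State} {D : Tables n} (hW : Room n k W)
    (hs : Constants n k s) (hD : Holds n k s D)
    (h10 : s.reg 10 = i₁) (h11 : s.reg 11 = i₂) (h12 : s.reg 12 = i₃) (h13 : s.reg 13 = q)
    (hi₁ : i₁ < 2 * n) (hi₂ : i₂ < 2 * n) (hi₃ : i₃ < 2 * n) (h₁ : i₁ ≠ i₃) (h₂ : i₂ ≠ i₃)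
    (hq : q < (n + 1) * 2 ^ k * ((n + 1) * 2 ^ k) * ((n + 1) * 2 ^ k))
    (hdisj : ∀ S T, D (pos₁ n k i₁ q) = some S → D (pos₂ n k i₂ q) = some T → Disjoint S T) :
    Ends W stepProg s (k * 120 + n * 30 + 400) fun s' =>
      (∀ y < 14, s'.reg y = s.reg y) ∧ (∀ p < n + n * n + n, s'.mem p = s.mem p) ∧
      Holds n k s' (mergeStep k i₁ i₂ i₃ D q) := by
  have h6 := hW.two
  have hc := hW.card_codes
  have h3 : n + 1 ≤ (n + 1) * 2 ^ k := Nat.le_mul_of_pos_right _ (Nat.two_pow_pos k)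
  obtain ⟨la, lb, lt⟩ := entry_decode_lt hq
  have va := valid_ofCode la
  have vb := valid_ofCode lb
  have vt := valid_ofCode lt
  have p1 : pos₁ n k i₁ q < 2 * n * ((n + 1) * 2 ^ k) * ((n + 1) * 2 ^ k) :=
    entry_lt hi₁ la (code_lt (vb.shift.merge vt))
  have p2 : pos₂ n k i₂ q < 2 * n * ((n + 1) * 2 ^ k) * ((n + 1) * 2 ^ k) :=
    entry_lt hi₂ lb (code_lt (va.merge vt).shift)
  have p3 : pos₃ n k i₃ q < 2 * n * ((n + 1) * 2 ^ k) * ((n + 1) * 2 ^ k) :=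
    entry_lt hi₃ (code_lt (va.merge vb.shift)) lt
  have n13 : pos₁ n k i₁ q ≠ pos₃ n k i₃ q := by
    intro h
    have := congrArg (fun j => j / ((n + 1) * 2 ^ k) / ((n + 1) * 2 ^ k)) h
    simp only [pos₁, pos₃] at this
    rw [entry_div_div la (code_lt (vb.shift.merge vt)),
      entry_div_div (code_lt (va.merge vb.shift)) lt] at this
    exact h₁ this
  have n23 : pos₂ n k i₂ q ≠ pos₃ n k i₃ q := by
    intro h
    have := congrArg (fun j => j / ((n + 1) * 2 ^ k) / ((n + 1) * 2 ^ k)) h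
    simp only [pos₂, pos₃] at this
    rw [entry_div_div lb (code_lt (va.merge vt).shift),
      entry_div_div (code_lt (va.merge vb.shift)) lt] at this
    exact h₂ this
  have a1 := hW.addr_add_le p1
  have a2 := hW.addr_add_le p2
  have a3 := hW.addr_add_le p3
  refine Ends.seq (ends_locateProg hW hs h10 h11 h12 h13 hi₁ hi₂ hi₃ hq) (by omega) ?_
  rintro s₁ ⟨k1, m1, r21, r22, r23⟩
  have c1 : Constants n k s₁ := hs.congr fun y hy => k1 y (by omega)
  have D1 : Holds n k s₁ D := hD.congr fun p _ => by rw [m1]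
  rw [mergeStep_eq]
  have same : ∀ s₂ : State, s₂.mem = s.mem →
      combine (D (pos₁ n k i₁ q)) (D (pos₂ n k i₂ q)) (D (pos₃ n k i₃ q)) = D (pos₃ n k i₃ q) →
      (∀ p < n + n * n + n, s₂.mem p = s.mem p) ∧
      Holds n k s₂ (Function.update D (pos₃ n k i₃ q)
        (combine (D (pos₁ n k i₁ q)) (D (pos₂ n k i₂ q)) (D (pos₃ n k i₃ q)))) := by
    intro s₂ hm h
    rw [h, Function.update_eq_self]
    exact ⟨fun p _ => by rw [hm], hD.congr fun p _ => by rw [hm]⟩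
  have z1 := D1 _ p1
  have z2 := D1 _ p2
  have z3 := D1 _ p3
  have b1 := z1.mem_le
  have b2 := z2.mem_le
  have b3 := z3.mem_le
  refine Ends.ite ?_ (by simp; omega) ?_ ?_
  · simp only [fits_load, fits_reg, eval_reg, r21]; omega
  swap
  · intro h
    simp only [eval_load, eval_reg, r21] at h
    refine Ends.skip ⟨k1, same s₁ m1 ?_⟩ (by simp; omega)
    rw [z1.eq_zero_iff.mp h]; rfl
  intro h
  simp only [eval_load, eval_reg, r21] at h
  refine Ends.ite ?_ (by simp; omega) ?_ ?_
  · simp only [fits_load, fits_reg, eval_reg, r22]; omega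
  swap
  · intro h
    simp only [eval_load, eval_reg, r22] at h
    refine Ends.skip ⟨k1, same s₁ m1 ?_⟩ (by simp; omega)
    rw [z2.eq_zero_iff.mp h]
    cases D (pos₁ n k i₁ q) <;> rfl
  intro h'
  simp only [eval_load, eval_reg, r22] at h'
  obtain ⟨S, hS⟩ := Option.ne_none_iff_exists'.mp (fun h0 => h (z1.eq_zero_iff.mpr h0))
  obtain ⟨T, hT⟩ := Option.ne_none_iff_exists'.mp (fun h0 => h' (z2.eq_zero_iff.mpr h0))
  have hST := hdisj S T hS hT
  have hcard : (S ∪ T).card = S.card + T.card := Finset.card_union_of_disjoint hST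
  rw [hS] at z1
  rw [hT] at z2
  rw [hS, hT] at same ⊢
  refine Ends.assign_seq ?_ (by simp; omega) ?_
  · simp only [fits_sub, fits_add, fits_load, fits_reg, fits_const, eval_load, eval_reg, r21,
      r22]
    omega
  have e24 : (Expr.load (.reg 21) + .load (.reg 22) - .const 1).eval s₁ = (S ∪ T).card + 1 := by
    simp only [eval_sub, eval_add, eval_load, eval_reg, eval_const, r21, r22, z1.1, z2.1, hcard]
    omega
  rw [e24]
  set s₂ := s₁.setReg 24 ((S ∪ T).card + 1) with hs₂
  have m2 : s₂.mem = s₁.mem := by simp [hs₂]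
  have k2 : ∀ y < 24, s₂.reg y = s₁.reg y := fun y hy => by
    have : y ≠ 24 := by omega
    simp [hs₂, this]
  have q24 : s₂.reg 24 = (S ∪ T).card + 1 := by simp [hs₂]
  have q23 : s₂.reg 23 = _ := (k2 23 (by norm_num)).trans r23
  have c2 : Constants n k s₂ := c1.congr fun y hy => k2 y (by omega)
  have hle : (S ∪ T).card ≤ n := by simpa using (S ∪ T).card_le_univ
  refine Ends.ite ?_ (by simp; omega) ?_ ?_
  · simp only [fits_add, fits_lt, fits_eq, fits_reg, fits_load, fits_const, eval_reg, eval_load,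
      eval_const, eval_lt, eval_eq, q24, q23, m2]
    have l1 := ite_one_le (W := 1) le_rfl
      ((S ∪ T).card + 1 < s₁.mem (addr n (pos₃ n k i₃ q)))
    have l2 := ite_one_le (W := 1) le_rfl (s₁.mem (addr n (pos₃ n k i₃ q)) = 0)
    omega
  · intro hlt
    have himp : combine (some S) (some T) (D (pos₃ n k i₃ q)) = some (S ∪ T) := by
      cases hU : D (pos₃ n k i₃ q) with
      | none => rfl
      | some U =>
        rw [hU] at z3
        simp only [eval_add, eval_lt, eval_eq, eval_reg, eval_load, eval_const, q24, q23, m2,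
          z3.1] at hlt
        have : (S ∪ T).card < U.card := by
          by_contra h0
          apply hlt
          simp [h0]
        simp only [combine, improve, if_pos this]
    rw [himp]
    refine Ends.mono (Ends.imp (ends_writeProg (p := addr n (pos₃ n k i₃ q)) (S := S ∪ T) hW c2
      (by norm_num) q23 a3 ⟨?_, ?_⟩ ?_) ?_) ?_
    · simp only [fits_reg, q24]; omega
    · simp only [eval_reg, q24]
    · intro s' u hr hm hu
      have e21 : s'.reg 21 = addr n (pos₁ n k i₁ q) := by
        rw [hr 21 (by norm_num), k2 21 (by norm_num), r21]
      have e22 : s'.reg 22 = addr n (pos₂ n k i₂ q) := by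
        rw [hr 22 (by norm_num), k2 22 (by norm_num), r22]
      have x1 : s'.mem (addr n (pos₁ n k i₁ q) + 1 + u) = if u ∈ S then 1 else 0 := by
        rw [hm, m2, z1.2 u]
        rcases Nat.lt_or_gt_of_ne n13 with h0 | h0
        · have := addr_add_lt (n := n) h0; omega
        · have := addr_add_lt (n := n) h0; omega
      have x2 : s'.mem (addr n (pos₂ n k i₂ q) + 1 + u) = if u ∈ T then 1 else 0 := by
        rw [hm, m2, z2.2 u]
        rcases Nat.lt_or_gt_of_ne n23 with h0 | h0
        · have := addr_add_lt (n := n) h0; omega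
        · have := addr_add_lt (n := n) h0; omega
      have hxor : (if u ∈ S then 1 else 0) + (if u ∈ T then 1 else 0) =
          if u ∈ S ∪ T then 1 else 0 := by
        by_cases hu1 : u ∈ S
        · have := Finset.disjoint_left.mp hST hu1
          simp [hu1, this]
        · simp [hu1]
      have hu2 := u.2
      have hbnd := ite_one_le (W := 1) le_rfl (u ∈ S ∪ T)
      have hbS := ite_one_le (W := 1) le_rfl (u ∈ S)
      have hbT := ite_one_le (W := 1) le_rfl (u ∈ T)
      simp only [fits_add, fits_load, fits_reg, fits_const, eval_add, eval_load, eval_reg,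
        eval_const, e21, e22, hu, x1, x2, hxor, and_true]
      omega
    · rintro s' ⟨hr, hm, hz⟩
      refine ⟨fun y hy => ?_, fun p hp => ?_, ?_⟩
      · rw [hr y (by omega), k2 y (by omega), k1 y hy]
      · rw [hm p (by unfold addr; omega), m2, m1]
      · refine hD.update hz fun p hp => ?_
        rw [hm p hp, m2, m1]
    · simp; omega
  · intro hlt
    refine Ends.skip ⟨fun y hy => ?_, same s₂ (m2.trans m1) ?_⟩ (by simp; omega)
    · rw [k2 y (by omega), k1 y hy]
    · cases hU : D (pos₃ n k i₃ q) with
      | none =>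
        rw [hU] at z3
        simp [q23, m2, show s₁.mem (addr n (pos₃ n k i₃ q)) = 0 from z3] at hlt
      | some U =>
        rw [hU] at z3
        simp only [eval_add, eval_lt, eval_eq, eval_reg, eval_load, eval_const, q24, q23, m2,
          z3.1] at hlt
        have : ¬ (S ∪ T).card < U.card := by
          intro h0
          simp [h0] at hlt
        simp only [combine, improve, if_neg this]

/-- The program for combining two tables. -/
def combineProg : Prog := forLoop 13 6 stepProg

theorem ends_combineProg {i₁ i₂ i₃ : ℕ} {s : State} {D : Tables n} (hW : Room n k W)
    (hs : Constants n k s) (hD : Holds n k s D)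
    (h10 : s.reg 10 = i₁) (h11 : s.reg 11 = i₂) (h12 : s.reg 12 = i₃)
    (hi₁ : i₁ < 2 * n) (hi₂ : i₂ < 2 * n) (hi₃ : i₃ < 2 * n) (h₁ : i₁ ≠ i₃) (h₂ : i₂ ≠ i₃)
    (hdisj : ∀ σ < (n + 1) * 2 ^ k, ∀ τ < (n + 1) * 2 ^ k,
      ∀ σ' < (n + 1) * 2 ^ k, ∀ τ' < (n + 1) * 2 ^ k, ∀ S T,
      D (entry ((n + 1) * 2 ^ k) i₁ σ τ) = some S →
      D (entry ((n + 1) * 2 ^ k) i₂ σ' τ') = some T → Disjoint S T) :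
    Ends W combineProg s
      ((n + 1) * 2 ^ k * ((n + 1) * 2 ^ k) * ((n + 1) * 2 ^ k) * (k * 120 + n * 30 + 408) + 6)
      fun s' => (∀ y < 13, s'.reg y = s.reg y) ∧ (∀ p < n + n * n + n, s'.mem p = s.mem p) ∧
        Holds n k s' (mergeSteps k i₁ i₂ i₃ D
          ((n + 1) * 2 ^ k * ((n + 1) * 2 ^ k) * ((n + 1) * 2 ^ k))) := by
  have h6 := hW.two
  refine Ends.forLoop (T := k * 120 + n * 30 + 400) (fun q s' => (∀ y < 13, s'.reg y = s.reg y) ∧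
    (∀ p < n + n * n + n, s'.mem p = s.mem p) ∧ Holds n k s' (mergeSteps k i₁ i₂ i₃ D q))
    (by omega) hW.cube ?_ ?_ ?_
  · rintro q s' ⟨h, -⟩
    rw [h 6 (by norm_num), hs.r6]
  · refine ⟨fun y hy => ?_, fun p _ => by simp, hD.congr fun p _ => by simp⟩
    have : y ≠ 13 := by omega
    simp [this]
  · rintro q hq s' ⟨hk, hm, hD'⟩ h13
    obtain ⟨la, lb, lt⟩ := entry_decode_lt hq
    have va := valid_ofCode la
    have vb := valid_ofCode lb
    have vt := valid_ofCode lt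
    refine Ends.imp (ends_stepProg hW (hs.congr fun y hy => hk y (by omega)) hD'
      ((hk 10 (by norm_num)).trans h10) ((hk 11 (by norm_num)).trans h11)
      ((hk 12 (by norm_num)).trans h12) h13 hi₁ hi₂ hi₃ h₁ h₂ hq ?_) ?_
    · intro S T hS hT
      unfold pos₁ at hS
      unfold pos₂ at hT
      have l1 := code_lt (vb.shift.merge vt)
      have l2 := code_lt (va.merge vt).shift
      rw [mergeSteps_of_ne D h₁ hq.le la l1] at hS
      rw [mergeSteps_of_ne D h₂ hq.le lb l2] at hT
      exact hdisj _ la _ l1 _ lb _ l2 S T hS hT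
    · rintro s'' ⟨hk', hm', hD''⟩
      refine ⟨(hk' 13 (by norm_num)).trans h13, fun y hy => ?_, fun p hp => ?_, ?_⟩
      · have : y ≠ 13 := by omega
        simp [this, hk' y (by omega), hk y hy]
      · simp [hm' p hp, hm p hp]
      · exact hD''.congr fun p _ => by simp

end Step

/-! ### The tables of single vertices -/

section Init

variable {n k W : ℕ} {c : Fin n → Fin k}

/-- Writes the entry at the position held in register `13`: the singleton or the empty set, whose
cardinalities plus one are `2` and `1`. -/
def initStepProg : Prog :=
  .seq (.assign 14 (.reg 13 / .reg 3 / .reg 3)) <|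
  .seq (.assign 15 (.reg 13 / .reg 3 % .reg 3)) <|
  .seq (.assign 16 (.reg 13 % .reg 3)) <|
  .seq (.assign 17 (.load (.reg 14))) <|
  .seq (.assign 23 (.reg 5 + .reg 13 * (.reg 0 + .const 1))) <|
  .seq (powProg 17 18) <|
  .ite (.bin .eq (.reg 15) (.reg 18))
    (writeProg 23 (.const 2) (.bin .eq (.reg 28) (.reg 14))) <|
  .ite (.bin .eq (.reg 15) (.reg 0 * .reg 2))
    (.ite (.bin .eq (.reg 16 % .reg 2 / .reg 18 % .const 2) (.const 1))
      (writeProg 23 (.const 1) (.const 0)) .skip)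
    .skip

/-- The initial tables up to position `q`. -/
def initTables (k : ℕ) (c : Fin n → Fin k) (q : ℕ) : Tables n :=
  fun j => if j < q then initEntry k c j else none

theorem initTables_succ (q : ℕ) :
    initTables k c (q + 1) = Function.update (initTables k c q) q (initEntry k c q) := by
  funext j
  rw [Function.update_apply]
  unfold initTables
  split_ifs <;> first | omega | rfl | skip
  rename_i h
  rw [h]

theorem ends_initStepProg {q : ℕ} {s : State} (hW : Room n k W)
    (hs : Constants n k s) (hc : ∀ v : Fin n, s.mem v = c v)
    (hD : Holds n k s (initTables k c q)) (h13 : s.reg 13 = q)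
    (hq : q < n * ((n + 1) * 2 ^ k) * ((n + 1) * 2 ^ k)) :
    Ends W initStepProg s (k * 12 + n * 30 + 100) fun s' =>
      (∀ y < 14, s'.reg y = s.reg y) ∧ (∀ p < n + n * n + n, s'.mem p = s.mem p) ∧
      Holds n k s' (initTables k c (q + 1)) := by
  have h6 := hW.two
  have hcc := hW.card_codes
  have hpos := hW.pos
  have h3 : n + 1 ≤ (n + 1) * 2 ^ k := Nat.le_mul_of_pos_right _ (Nat.two_pow_pos k)
  have h4 : (n + 1) * 2 ^ k = n * 2 ^ k + 2 ^ k := by ring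
  have hq2 : q < 2 * n * ((n + 1) * 2 ^ k) * ((n + 1) * 2 ^ k) := by nlinarith
  have ha := hW.addr_add_le hq2
  have hqn : q ≤ q * (n + 1) := Nat.le_mul_of_pos_right _ (by omega)
  have hv : q / ((n + 1) * 2 ^ k) / ((n + 1) * 2 ^ k) < n := by
    refine Nat.div_lt_of_lt_mul (Nat.div_lt_of_lt_mul ?_)
    calc q < _ := hq
      _ = _ := by ring
  have hσ : q / ((n + 1) * 2 ^ k) % ((n + 1) * 2 ^ k) < (n + 1) * 2 ^ k :=
    Nat.mod_lt _ (by omega)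
  have hτ : q % ((n + 1) * 2 ^ k) < (n + 1) * 2 ^ k := Nat.mod_lt _ (by omega)
  have hE : initEntry k c q =
      if q / ((n + 1) * 2 ^ k) % ((n + 1) * 2 ^ k) = 2 ^ (c ⟨_, hv⟩ : ℕ) then some {⟨_, hv⟩}
      else if q / ((n + 1) * 2 ^ k) % ((n + 1) * 2 ^ k) = n * 2 ^ k ∧
        q % ((n + 1) * 2 ^ k) % 2 ^ k / 2 ^ (c ⟨_, hv⟩ : ℕ) % 2 = 1 then some ∅
      else none := by
    unfold initEntry
    simp only [hv, dif_pos]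
  have hcv := hc ⟨_, hv⟩
  simp only at hcv
  have hM := hs.r3
  rw [initTables_succ, hE]
  have haddr : addr n q = n + n * n + n + q * (n + 1) := rfl
  have hpow : 2 ^ (c ⟨_, hv⟩ : ℕ) ≤ 2 ^ k := Nat.pow_le_pow_right (by norm_num) (c _).2.le
  generalize hcol : (c ⟨_, hv⟩ : ℕ) = col at *
  have hcolW : col < 2 ^ col := Nat.lt_two_pow_self
  have hcolk : col ≤ k := by have := (c ⟨_, hv⟩).2; omega
  generalize hvv : (⟨_, hv⟩ : Fin n) = v at *
  have hvv' := congrArg Fin.val hvv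
  simp only at hvv'
  rw [hvv'] at hcv
  have hv2 := v.2
  generalize hMe : (n + 1) * 2 ^ k = M at *
  generalize hbe : q / M % M = b at *
  generalize hte : q % M = t at *
  refine Ends.assign_seq (by simp [h13, hM]; omega) (by simp) ?_
  refine Ends.assign_seq (by simp [h13, hM]; omega) (by simp) ?_
  refine Ends.assign_seq (by simp [h13, hM]; omega) (by simp) ?_
  refine Ends.assign_seq (by simp [h13, hM, hvv', hcv]; omega) (by simp) ?_
  refine Ends.assign_seq (by simp [h13, hs.r0, hs.r5]; omega) (by simp) ?_
  simp only [eval_div, eval_mod, eval_add, eval_mul, eval_load, eval_const, eval_reg, reg_setReg,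
    mem_setReg, Nat.reduceEqDiff, if_true, if_false, OfNat.zero_ne_ofNat, h13,
    hM, hvv', hbe, hte, hcv, hs.r0, hs.r5, cost_div, cost_mod, cost_reg, cost_load, cost_add,
    cost_mul, cost_const]
  set s₁ := ((((s.setReg 14 v).setReg 15 b).setReg 16 t).setReg 17 col).setReg 23
    (n + n * n + n + q * (n + 1)) with hs₁
  have k1 : ∀ y < 14, s₁.reg y = s.reg y := by
    intro y hy
    have : y ≠ 14 ∧ y ≠ 15 ∧ y ≠ 16 ∧ y ≠ 17 ∧ y ≠ 23 := by omega
    simp [hs₁, this]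
  have c1 : Constants n k s₁ := hs.congr fun y hy => k1 y (by omega)
  have m1 : s₁.mem = s.mem := by simp [hs₁]
  refine Ends.seq (ends_powProg (a := 17) (d := 18) (m := col) (by norm_num) (by norm_num)
    (by norm_num) (by simp [hs₁]) h6 (by omega)) (by omega) ?_
  rintro s₂ ⟨r18, k2, m2⟩
  have c2 : Constants n k s₂ := c1.congr fun y hy => k2 y (by omega) (by omega)
  have r14 : s₂.reg 14 = v := by rw [k2 14 (by norm_num) (by norm_num)]; simp [hs₁]
  have r15 : s₂.reg 15 = b := by rw [k2 15 (by norm_num) (by norm_num)]; simp [hs₁]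
  have r16 : s₂.reg 16 = t := by rw [k2 16 (by norm_num) (by norm_num)]; simp [hs₁]
  have r23 : s₂.reg 23 = addr n q := by
    rw [k2 23 (by norm_num) (by norm_num), haddr]; simp [hs₁]
  have k3 : ∀ y < 14, s₂.reg y = s.reg y := fun y hy => by
    rw [k2 y (by omega) (by omega), k1 y hy]
  have m3 : s₂.mem = s.mem := m2.trans m1
  have write : ∀ (S : Finset (Fin n)) (s' : State), (∀ y < 28, s'.reg y = s₂.reg y) →
      (∀ p, p < addr n q ∨ addr n q + n < p → s'.mem p = s₂.mem p) →
      HoldsEntry s' (addr n q) (some S) →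
      (∀ y < 14, s'.reg y = s.reg y) ∧ (∀ p < n + n * n + n, s'.mem p = s.mem p) ∧
      Holds n k s' (Function.update (initTables k c q) q (some S)) := by
    intro S s' h1 h2 h5
    refine ⟨fun y hy => (h1 y (by omega)).trans (k3 y hy), fun p hp => ?_, ?_⟩
    · rw [h2 p (by omega), m3]
    · exact hD.update h5 fun p hp => by rw [h2 p hp, m3]
  have skip : ∀ s' : State, s'.mem = s₂.mem → (∀ y < 14, s'.reg y = s₂.reg y) →
      (∀ y < 14, s'.reg y = s.reg y) ∧ (∀ p < n + n * n + n, s'.mem p = s.mem p) ∧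
      Holds n k s' (Function.update (initTables k c q) q none) := by
    intro s' h1 h2
    have : initTables k c q q = none := by simp [initTables]
    rw [← this, Function.update_eq_self]
    exact ⟨fun y hy => (h2 y hy).trans (k3 y hy), fun p _ => by rw [h1, m3],
      hD.congr fun p _ => by rw [h1, m3]⟩
  refine Ends.ite ?_ (by simp; omega) ?_ ?_
  · simp only [fits_eq, fits_reg, eval_reg, r15, r18]
    exact ⟨by omega, by omega, ite_one_le (by omega) _⟩
  · intro h
    have h : b = 2 ^ col := by by_contra h0; simp [r15, r18, h0] at h
    rw [if_pos h]
    refine Ends.mono (Ends.imp (ends_writeProg (p := addr n q) (S := {v}) hW c2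
      (by norm_num) r23 (by omega) ⟨by simpa using h6, by simp⟩ ?_) ?_) ?_
    · intro s' u hr hm hu
      have e14 := (hr 14 (by norm_num)).trans r14
      have := u.2
      simp only [fits_eq, fits_reg, eval_reg, eval_eq, e14, hu, Finset.mem_singleton, Fin.ext_iff,
        and_true]
      exact ⟨by omega, by omega, ite_one_le (by omega) _⟩
    · rintro s' ⟨x1, x2, x3⟩
      exact write _ s' x1 x2 x3
    · simp; omega
  intro h
  have h : ¬ b = 2 ^ col := by intro h0; simp [r15, r18, h0] at h
  rw [if_neg h]
  refine Ends.ite ?_ (by simp; omega) ?_ ?_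
  · simp only [fits_eq, fits_mul, fits_reg, eval_reg, eval_mul, r15, c2.r0, c2.r2]
    exact ⟨by omega, ⟨by omega, by omega, by omega⟩, ite_one_le (by omega) _⟩
  swap
  · intro h'
    have h' : ¬ b = n * 2 ^ k := by intro h0; simp [r15, c2.r0, c2.r2, h0] at h'
    rw [if_neg (by simp [h'])]
    exact Ends.skip (skip s₂ rfl fun _ _ => rfl) (by simp; omega)
  intro h'
  have h' : b = n * 2 ^ k := by by_contra h0; simp [r15, c2.r0, c2.r2, h0] at h'
  refine Ends.ite ?_ (by simp; omega) ?_ ?_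
  · simp only [fits_eq, fits_mod, fits_div, fits_const, fits_reg, r16, r18, c2.r2]
    exact ⟨⟨⟨⟨by omega, by omega⟩, by omega⟩, by omega⟩, by omega, ite_one_le (by omega) _⟩
  · intro hb
    have hb : t % 2 ^ k / 2 ^ col % 2 = 1 := by
      by_contra h0; simp [r16, r18, c2.r2, h0] at hb
    rw [if_pos ⟨h', hb⟩]
    refine Ends.mono (Ends.imp (ends_writeProg (p := addr n q) (S := ∅) hW c2
      (by norm_num) r23 (by omega) ⟨by simp; omega, by simp⟩ ?_) ?_) ?_
    · intro s' u hr hm hu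
      simp
    · rintro s' ⟨x1, x2, x3⟩
      exact write _ s' x1 x2 x3
    · simp; omega
  · intro hb
    have hb : ¬ t % 2 ^ k / 2 ^ col % 2 = 1 := by
      intro h0; simp [r16, r18, c2.r2, h0] at hb
    rw [if_neg (by simp [hb])]
    exact Ends.skip (skip s₂ rfl fun _ _ => rfl) (by simp; omega)

/-- Writes the tables of the single vertices and makes every vertex point to its own table. -/
def initProg : Prog :=
  .seq (forLoop 13 7 initStepProg) <|
  forLoop 13 0 (.store (.reg 4 + .reg 13) (.reg 13 + .const 1))

/-- The vertices in `R` are alive: the cell `v` of the pointer area holds one more than the number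
of the table of `v` if `v ∈ R`, and `0` otherwise. -/
def HoldsPointers (s : State) (R : Finset (Fin n)) (ptr : Fin n → ℕ) : Prop :=
  ∀ v : Fin n, s.mem (n + n * n + v) = if v ∈ R then ptr v + 1 else 0

theorem ends_initProg {s : State} (hW : Room n k W)
    (hs : Constants n k s) (hc : ∀ v : Fin n, s.mem v = c v)
    (h0 : ∀ p, n + n * n ≤ p → s.mem p = 0) :
    Ends W initProg s (n * ((n + 1) * 2 ^ k) * ((n + 1) * 2 ^ k) * (k * 12 + n * 30 + 108) +
        n * 16 + 12) fun s' =>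
      Constants n k s' ∧ (∀ p < n + n * n, s'.mem p = s.mem p) ∧
      HoldsPointers s' Finset.univ (fun v : Fin n => (v : ℕ)) ∧
      Holds n k s' (initEntry k c) := by
  have h6 := hW.two
  have hw := hW.words
  have hpos := hW.pos
  have hMM : n * ((n + 1) * 2 ^ k) * ((n + 1) * 2 ^ k) ≤
      2 * n * ((n + 1) * 2 ^ k) * ((n + 1) * 2 ^ k) * (n + 1) := by
    have : n * ((n + 1) * 2 ^ k) * ((n + 1) * 2 ^ k) * 1 ≤
      2 * n * ((n + 1) * 2 ^ k) * ((n + 1) * 2 ^ k) * (n + 1) := by gcongr <;> omega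
    omega
  refine Ends.seq (Ends.forLoop (N := n * ((n + 1) * 2 ^ k) * ((n + 1) * 2 ^ k))
    (T := k * 12 + n * 30 + 100) (fun q s' => (∀ y < 13, s'.reg y = s.reg y) ∧
    (∀ p < n + n * n + n, s'.mem p = s.mem p) ∧ Holds n k s' (initTables k c q))
    (by omega) (by omega) ?_ ?_ ?_)
    (by rw [show k * 12 + n * 30 + 108 = k * 12 + n * 30 + 100 + 8 from rfl]; omega) ?_
  · rintro q s' ⟨h, -⟩
    rw [h 7 (by norm_num), hs.r7]
  · refine ⟨fun y hy => ?_, fun p _ => by simp, fun j _ => ?_⟩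
    · have : y ≠ 13 := by omega
      simp [this]
    · simp only [initTables, Nat.not_lt_zero, if_false]
      exact h0 _ (by unfold addr; omega)
  · rintro q hq s' ⟨h1, h2, h3⟩ h13
    refine Ends.imp (ends_initStepProg (c := c) hW (hs.congr fun y hy => h1 y (by omega))
      (fun v => ?_) h3 h13 hq) ?_
    · have := v.2
      rw [h2 _ (by omega), hc]
    · rintro s'' ⟨e1, e2, e3⟩
      refine ⟨(e1 13 (by norm_num)).trans h13, fun y hy => ?_, fun p hp => ?_, ?_⟩
      · have : y ≠ 13 := by omega
        simp [this, e1 y (by omega), h1 y hy]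
      · simp [e2 p hp, h2 p hp]
      · exact e3.congr fun p _ => by simp
  rintro s₁ ⟨k1, m1, D1⟩
  have D1 : Holds n k s₁ (initEntry k c) := by
    intro j hj
    have := D1 j hj
    unfold initTables at this
    split_ifs at this with hlt
    · exact this
    · rw [initEntry_of_le (by omega)]
      exact this
  have c1 : Constants n k s₁ := hs.congr fun y hy => k1 y (by omega)
  refine Ends.mono (Ends.imp (Ends.forLoop (N := n) (T := 8)
    (fun i s' => (∀ y < 13, s'.reg y = s₁.reg y) ∧ (∀ p < n + n * n, s'.mem p = s.mem p) ∧
      (∀ v : Fin n, (v : ℕ) < i → s'.mem (n + n * n + v) = v + 1) ∧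
      Holds n k s' (initEntry k c)) (by omega) (by omega) ?_ ?_ ?_) ?_)
    (by rw [show k * 12 + n * 30 + 108 = k * 12 + n * 30 + 100 + 8 from rfl]; omega)
  · rintro q s' ⟨h, -⟩
    rw [h 0 (by norm_num), c1.r0]
  · refine ⟨fun y hy => ?_, fun p hp => ?_, by simp, D1.congr fun p _ => by simp⟩
    · have : y ≠ 13 := by omega
      simp [this]
    · simp [m1 p (by omega)]
  · rintro i hi s' ⟨e1, e2, e3, e4⟩ h13
    have r4 : s'.reg 4 = n + n * n := (e1 4 (by norm_num)).trans c1.r4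
    refine Ends.store ?_ ?_ (by simp) ⟨?_, ?_, ?_, ?_, ?_⟩
    · simp only [fits_add, fits_reg, eval_reg, r4, h13]; omega
    · simp only [fits_add, fits_reg, fits_const, eval_reg, eval_const, h13]; omega
    · simp [h13]
    · intro y hy
      have : y ≠ 13 := by omega
      simp [this, e1 y hy]
    · intro p hp
      have : p ≠ n + n * n + i := by omega
      simp [r4, h13, this, e2 p hp]
    · intro v hv
      by_cases hvi : (v : ℕ) = i
      · simp [r4, h13, hvi]
      · simp [r4, h13, hvi, e3 v (by omega)]
    · refine e4.congr fun p hp => ?_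
      have : p ≠ n + n * n + i := by omega
      simp [r4, h13, this]
  · rintro s' ⟨e1, e2, e3, e4⟩
    exact ⟨c1.congr fun y hy => e1 y (by omega), e2, fun v => by simp [e3 v v.2], e4⟩

end Init

/-! ### Finding a leaf -/

section Find

variable {n k W : ℕ} {G : SimpleGraph (Fin n)}

open Classical in
/-- The memory holds the adjacency matrix of `G`. -/
def HoldsGraph (s : State) (G : SimpleGraph (Fin n)) : Prop :=
  ∀ u v : Fin n, s.mem (n + n * u + v) = if G.Adj u v then 1 else 0

/-- Counts the living neighbours of the vertex in register `14`; the count goes to register `16`,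
and the last neighbour found to register `17`. -/
def countProg : Prog :=
  .seq (.assign 16 (.const 0)) <|
  forLoop 15 0 <|
    .ite (.load (.reg 0 + .reg 0 * .reg 14 + .reg 15))
      (.ite (.load (.reg 4 + .reg 15))
        (.seq (.assign 16 (.reg 16 + .const 1)) (.assign 17 (.reg 15)))
        .skip)
      .skip

open Classical in
theorem ends_countProg {s : State} {R : Finset (Fin n)} {ptr : Fin n → ℕ} {x : Fin n}
    (hW : Room n k W) (hs : Constants n k s) (hG : HoldsGraph s G) (hR : HoldsPointers s R ptr)
    (hptr : ∀ v ∈ R, ptr v < 2 * n) (h14 : s.reg 14 = x) :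
    Ends W countProg s (n * 30 + 8) fun s' =>
      (∀ y, y ≠ 15 → y ≠ 16 → y ≠ 17 → s'.reg y = s.reg y) ∧ s'.mem = s.mem ∧
      s'.reg 16 = (R.filter fun y => G.Adj x y).card ∧
      (s'.reg 16 ≠ 0 → ∃ y ∈ R, G.Adj x y ∧ s'.reg 17 = y) := by
  have h6 := hW.two
  have hw := hW.words
  have hpos := hW.pos
  have hcc := hW.card_codes
  have h3 : n + 1 ≤ (n + 1) * 2 ^ k := Nat.le_mul_of_pos_right _ (Nat.two_pow_pos k)
  have hx : n * x + n ≤ n * n := by nlinarith [x.2]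
  refine Ends.assign_seq (by simp) (by simp) ?_
  simp only [cost_const]
  refine Ends.mono (Ends.imp (Ends.forLoop (N := n) (T := 22)
    (fun i s' => (∀ y, y ≠ 15 → y ≠ 16 → y ≠ 17 → s'.reg y = s.reg y) ∧ s'.mem = s.mem ∧
      s'.reg 16 = (R.filter fun y => G.Adj x y ∧ (y : ℕ) < i).card ∧
      (s'.reg 16 ≠ 0 → ∃ y ∈ R, G.Adj x y ∧ s'.reg 17 = y)) (by omega) (by omega)
      ?_ ?_ ?_) ?_) (by omega)
  · rintro i s' ⟨h, -⟩
    rw [h 0 (by norm_num) (by norm_num) (by norm_num), hs.r0]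
  · refine ⟨fun y h1 h2 _ => ?_, by simp, by simp, by simp⟩
    simp [h1, h2]
  · rintro i hi s' ⟨e1, e2, e3, e4⟩ h15
    have r0 : s'.reg 0 = n := (e1 0 (by norm_num) (by norm_num) (by norm_num)).trans hs.r0
    have r4 : s'.reg 4 = n + n * n :=
      (e1 4 (by norm_num) (by norm_num) (by norm_num)).trans hs.r4
    have r14 : s'.reg 14 = x := (e1 14 (by norm_num) (by norm_num) (by norm_num)).trans h14
    have g1 : s'.mem (n + n * x + i) = if G.Adj x ⟨i, hi⟩ then 1 else 0 := by
      rw [e2]; exact hG x ⟨i, hi⟩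
    have g2 : s'.mem (n + n * n + i) = if ⟨i, hi⟩ ∈ R then ptr ⟨i, hi⟩ + 1 else 0 := by
      rw [e2]; exact hR ⟨i, hi⟩
    have skip : ¬ (G.Adj x ⟨i, hi⟩ ∧ (⟨i, hi⟩ : Fin n) ∈ R) → (s'.reg 15 = i ∧
        (∀ y, y ≠ 15 → y ≠ 16 → y ≠ 17 → (s'.setReg 15 (i + 1)).reg y = s.reg y) ∧
        (s'.setReg 15 (i + 1)).mem = s.mem ∧
        (s'.setReg 15 (i + 1)).reg 16 =
          (R.filter fun y => G.Adj x y ∧ (y : ℕ) < i + 1).card ∧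
        ((s'.setReg 15 (i + 1)).reg 16 ≠ 0 →
          ∃ y ∈ R, G.Adj x y ∧ (s'.setReg 15 (i + 1)).reg 17 = y)) := by
      intro hn
      refine ⟨h15, fun y h1 h2 h3 => by simp [h1, e1 y h1 h2 h3], by simp [e2], ?_,
        by simpa using e4⟩
      have : (R.filter fun y => G.Adj x y ∧ (y : ℕ) < i + 1) =
          R.filter fun y => G.Adj x y ∧ (y : ℕ) < i := by
        refine Finset.filter_congr fun y hy => and_congr_right fun hxy => ?_
        have : (y : ℕ) ≠ i := by
          rintro rfl
          exact hn ⟨hxy, hy⟩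
        omega
      rw [this, ← e3]
      simp
    refine Ends.ite ?_ (by simp) ?_ ?_
    · simp only [fits_load, fits_add, fits_mul, fits_reg, eval_add, eval_mul, eval_reg, r0, r14,
        h15, g1]
      have := ite_one_le (W := 1) le_rfl (G.Adj x ⟨i, hi⟩)
      omega
    swap
    · intro h
      refine Ends.skip (skip ?_) (by simp)
      simp only [eval_load, eval_add, eval_mul, eval_reg, r0, r14, h15, g1] at h
      rintro ⟨h', -⟩
      simp [h'] at h
    intro h
    have hadj : G.Adj x ⟨i, hi⟩ := by
      simp only [eval_load, eval_add, eval_mul, eval_reg, r0, r14, h15, g1] at h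
      by_contra h'
      simp [h'] at h
    refine Ends.ite ?_ (by simp) ?_ ?_
    · simp only [fits_load, fits_add, fits_reg, eval_add, eval_reg, r4, h15, g2]
      refine ⟨by omega, ?_⟩
      split_ifs with hiR
      · have := hptr _ hiR; omega
      · omega
    swap
    · intro h'
      refine Ends.skip (skip ?_) (by simp)
      simp only [eval_load, eval_add, eval_reg, r4, h15, g2] at h'
      rintro ⟨-, h''⟩
      simp [h''] at h'
    intro h'
    have hiR : (⟨i, hi⟩ : Fin n) ∈ R := by
      simp only [eval_load, eval_add, eval_reg, r4, h15, g2] at h'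
      by_contra h''
      simp [h''] at h'
    have hins : (R.filter fun y => G.Adj x y ∧ (y : ℕ) < i + 1) =
        insert ⟨i, hi⟩ (R.filter fun y => G.Adj x y ∧ (y : ℕ) < i) := by
      ext y
      simp only [Finset.mem_filter, Finset.mem_insert, Fin.ext_iff]
      constructor
      · rintro ⟨h1, h2, h3⟩
        by_cases hyi : (y : ℕ) = i
        · exact Or.inl hyi
        · exact Or.inr ⟨h1, h2, by omega⟩
      · rintro (hyi | ⟨h1, h2, h3⟩)
        · obtain rfl : y = ⟨i, hi⟩ := Fin.ext hyi
          exact ⟨hiR, hadj, by simp⟩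
        · exact ⟨h1, h2, by omega⟩
    have hcard : (R.filter fun y => G.Adj x y ∧ (y : ℕ) < i + 1).card = s'.reg 16 + 1 := by
      rw [hins, Finset.card_insert_of_notMem (by simp), e3]
    have hle : (R.filter fun y => G.Adj x y ∧ (y : ℕ) < i + 1).card ≤ n := by
      simpa using Finset.card_le_univ (R.filter fun y => G.Adj x y ∧ (y : ℕ) < i + 1)
    refine Ends.assign_seq ?_ (by simp) ?_
    · simp only [fits_add, fits_reg, fits_const, eval_reg, eval_const]; omega
    refine Ends.assign (by simp [h15]; omega) (by simp) ⟨by simp [h15], ?_, by simp [e2], ?_, ?_⟩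
    · intro y h1 h2 h3
      simp [h1, h2, h3, e1 y h1 h2 h3]
    · rw [hcard]; simp
    · intro _
      exact ⟨⟨i, hi⟩, hiR, hadj, by simp [h15]⟩
  · rintro s' ⟨e1, e2, e3, e4⟩
    refine ⟨e1, e2, ?_, e4⟩
    rw [e3]
    congr 1
    exact Finset.filter_congr fun y _ => by simp

/-- Finds a leaf among the living vertices; it goes to register `18`, and its living neighbour to
register `19`. -/
def findProg : Prog :=
  forLoop 14 0 <|
    .seq countProg <|
    .ite (.bin .eq (.reg 16) (.const 1))
      (.ite (.load (.reg 4 + .reg 14))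
        (.seq (.assign 18 (.reg 14)) (.assign 19 (.reg 17))) .skip)
      .skip

open Classical in
theorem IsLeaf.card_filter {R : Finset (Fin n)} {x p : Fin n} (h : IsLeaf G R x p) :
    (R.filter fun y => G.Adj x y).card = 1 := by
  rw [Finset.card_eq_one]
  refine ⟨p, ?_⟩
  ext y
  simp only [Finset.mem_filter, Finset.mem_singleton]
  exact ⟨fun hy => h.2.2.2 y hy.1 hy.2, by rintro rfl; exact ⟨h.2.1, h.2.2.1⟩⟩

theorem ends_findProg {s : State} {R : Finset (Fin n)} {ptr : Fin n → ℕ}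
    (hW : Room n k W) (hs : Constants n k s) (hG : HoldsGraph s G) (hR : HoldsPointers s R ptr)
    (hptr : ∀ v ∈ R, ptr v < 2 * n) (hleaf : ∃ x p, IsLeaf G R x p) :
    Ends W findProg s (n * (n * 30 + 40) + 6) fun s' =>
      (∀ y < 14, s'.reg y = s.reg y) ∧ s'.mem = s.mem ∧
      ∃ x p, IsLeaf G R x p ∧ s'.reg 18 = x ∧ s'.reg 19 = p := by
  classical
  have h6 := hW.two
  have hw := hW.words
  have hpos := hW.pos
  have hcc := hW.card_codes
  have h3 : n + 1 ≤ (n + 1) * 2 ^ k := Nat.le_mul_of_pos_right _ (Nat.two_pow_pos k)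
  refine Ends.imp (Ends.forLoop (N := n) (T := n * 30 + 32)
    (fun i s' => (∀ y < 14, s'.reg y = s.reg y) ∧ s'.mem = s.mem ∧
      ((∃ x p, IsLeaf G R x p ∧ s'.reg 18 = x ∧ s'.reg 19 = p) ∨
        ∀ x p : Fin n, (x : ℕ) < i → ¬ IsLeaf G R x p)) (by omega) (by omega) ?_ ?_ ?_) ?_
  · rintro i s' ⟨h, -⟩
    rw [h 0 (by norm_num), hs.r0]
  · refine ⟨fun y hy => ?_, by simp, Or.inr (by simp)⟩
    have : y ≠ 14 := by omega
    simp [this]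
  · rintro i hi s' ⟨e1, e2, e3⟩ h14
    have c' : Constants n k s' := hs.congr fun y hy => e1 y (by omega)
    refine Ends.seq (ends_countProg (x := ⟨i, hi⟩) (G := G) (R := R) (ptr := ptr) hW c'
      (by intro u v; rw [e2]; exact hG u v) (by intro v; rw [e2]; exact hR v) hptr h14)
      (by omega) ?_
    rintro s₁ ⟨k1, m1, r16, r17⟩
    have hle : (R.filter fun y => G.Adj ⟨i, hi⟩ y).card ≤ n := by
      simpa using Finset.card_le_univ (R.filter fun y => G.Adj ⟨i, hi⟩ y)
    have g14 : s₁.reg 14 = i := by rw [k1 14 (by norm_num) (by norm_num) (by norm_num), h14]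
    have g4 : s₁.reg 4 = n + n * n := by
      rw [k1 4 (by norm_num) (by norm_num) (by norm_num), c'.r4]
    have g18 : s₁.reg 18 = s'.reg 18 := k1 18 (by norm_num) (by norm_num) (by norm_num)
    have g19 : s₁.reg 19 = s'.reg 19 := k1 19 (by norm_num) (by norm_num) (by norm_num)
    have gm : s₁.mem (n + n * n + i) = if ⟨i, hi⟩ ∈ R then ptr ⟨i, hi⟩ + 1 else 0 := by
      rw [m1, e2]; exact hR ⟨i, hi⟩
    have keep : ∀ y < 14, s₁.reg y = s.reg y := fun y hy => by
      rw [k1 y (by omega) (by omega) (by omega), e1 y hy]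
    have skip : (∀ p, ¬ IsLeaf G R ⟨i, hi⟩ p) → (s₁.reg 14 = i ∧
        (∀ y < 14, (s₁.setReg 14 (i + 1)).reg y = s.reg y) ∧
        (s₁.setReg 14 (i + 1)).mem = s.mem ∧
        ((∃ x p, IsLeaf G R x p ∧ (s₁.setReg 14 (i + 1)).reg 18 = x ∧
          (s₁.setReg 14 (i + 1)).reg 19 = p) ∨
        ∀ x p : Fin n, (x : ℕ) < i + 1 → ¬ IsLeaf G R x p)) := by
      intro hn
      refine ⟨g14, fun y hy => ?_, by simp [m1, e2], ?_⟩
      · have : y ≠ 14 := by omega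
        simp [this, keep y hy]
      · rcases e3 with ⟨x, p, hl, hx, hp⟩ | e3
        · exact Or.inl ⟨x, p, hl, by simp [g18, hx], by simp [g19, hp]⟩
        · refine Or.inr fun x p hx hl => ?_
          rcases Nat.lt_succ_iff_lt_or_eq.mp hx with hx | hx
          · exact e3 x p hx hl
          · obtain rfl : x = ⟨i, hi⟩ := Fin.ext hx
            exact hn p hl
    refine Ends.ite ?_ (by simp) ?_ ?_
    · simp only [fits_eq, fits_reg, fits_const, eval_reg, eval_const, r16]
      exact ⟨by omega, by omega, ite_one_le (by omega) _⟩
    swap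
    · intro h
      refine Ends.skip (skip fun p hl => ?_) (by simp)
      simp [r16, IsLeaf.card_filter hl] at h
    intro h
    have h1 : (R.filter fun y => G.Adj ⟨i, hi⟩ y).card = 1 := by
      by_contra h'
      simp [r16, h'] at h
    refine Ends.ite ?_ (by simp) ?_ ?_
    · simp only [fits_load, fits_add, fits_reg, eval_add, eval_reg, g4, g14, gm]
      refine ⟨by omega, ?_⟩
      split_ifs with hiR
      · have := hptr _ hiR; omega
      · omega
    swap
    · intro h'
      refine Ends.skip (skip fun p hl => ?_) (by simp)
      simp only [eval_load, eval_add, eval_reg, g4, g14, gm] at h'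
      simp [hl.1] at h'
    intro h'
    have hiR : (⟨i, hi⟩ : Fin n) ∈ R := by
      simp only [eval_load, eval_add, eval_reg, g4, g14, gm] at h'
      by_contra h''
      simp [h''] at h'
    obtain ⟨p, hp, hadj, h17⟩ := r17 (by rw [r16, h1]; norm_num)
    have hl : IsLeaf G R ⟨i, hi⟩ p := by
      refine ⟨hiR, hp, hadj, fun y hy hxy => ?_⟩
      obtain ⟨z, hz⟩ := Finset.card_eq_one.mp h1
      have e1 : y ∈ ({z} : Finset (Fin n)) := hz ▸ Finset.mem_filter.mpr ⟨hy, hxy⟩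
      have e2 : p ∈ ({z} : Finset (Fin n)) := hz ▸ Finset.mem_filter.mpr ⟨hp, hadj⟩
      rw [Finset.mem_singleton.mp e1, Finset.mem_singleton.mp e2]
    have hpn := p.2
    refine Ends.assign_seq (by simp [g14]; omega) (by simp) ?_
    refine Ends.assign (by simp [h17]; omega) (by simp)
      ⟨by simp [g14], fun y hy => ?_, by simp [m1, e2], Or.inl ⟨⟨i, hi⟩, p, hl, ?_, ?_⟩⟩
    · have : y ≠ 14 ∧ y ≠ 18 ∧ y ≠ 19 := by omega
      simp [this, keep y hy]
    · simp [g14]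
    · simp [h17]
  · rintro s' ⟨e1, e2, e3 | e3⟩
    · exact ⟨e1, e2, e3⟩
    · obtain ⟨x, p, hl⟩ := hleaf
      exact absurd hl (e3 x p x.2)

end Find

end WordRAM

/-! ### Contracting the whole tree -/

namespace MinConsistentSubset

open Profile

section Progress

variable {n k : ℕ} {G : SimpleGraph (Fin n)} {c : Fin n → Fin k}

/-- The situation after `j` rounds: the tree is contracted onto `n - j` vertices `R`, the table of
the cluster of `v ∈ R` has the number `ptr v`, the table with the largest number in use belongs to
one of these vertices, and the tables with larger numbers are empty. -/
structure Progress (G : SimpleGraph (Fin n)) (c : Fin n → Fin k) (j : ℕ) (R : Finset (Fin n))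
    (root : Fin n → Fin n) (ptr : Fin n → ℕ) (D : Tables n) : Prop where
  contraction : Contraction G R root
  card : R.card + j = n
  ptr_lt : ∀ v ∈ R, ptr v < n + j
  isTable : ∀ v ∈ R, IsTable G c (cluster root v) v fun σ τ =>
    D (entry ((n + 1) * 2 ^ k) (ptr v) σ τ)
  last : ∃ v ∈ R, ptr v + 1 = n + j
  empty : ∀ i, n + j ≤ i → ∀ σ < (n + 1) * 2 ^ k, ∀ τ < (n + 1) * 2 ^ k,
    D (entry ((n + 1) * 2 ^ k) i σ τ) = none

theorem cluster_id (v : Fin n) : cluster id v = {v} := by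
  ext u
  simp [cluster]

theorem Progress.init (hG : G.Connected) (hn : 0 < n) :
    Progress G c 0 Finset.univ id (fun v => (v : ℕ)) (initEntry k c) where
  contraction := Contraction.refl hG
  card := by simp
  ptr_lt v _ := v.2
  isTable v _ := by
    rw [cluster_id]
    exact isTable_initEntry v
  -- before the first round, the last vertex owns the last table
  last := ⟨⟨n - 1, by omega⟩, Finset.mem_univ _, by simp only; omega⟩
  empty i hi σ _ τ _ := by
    refine initEntry_of_le ?_
    unfold entry
    have : n * ((n + 1) * 2 ^ k) ≤ i * ((n + 1) * 2 ^ k) + σ :=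
      (Nat.mul_le_mul_right _ hi).trans (Nat.le_add_right _ _)
    exact (Nat.mul_le_mul_right _ this).trans (Nat.le_add_right _ _)

variable {j : ℕ} {R : Finset (Fin n)} {root : Fin n → Fin n} {ptr : Fin n → ℕ} {D : Tables n}
  {x p : Fin n}

theorem Progress.disjoint (h : Progress G c j R root ptr D) (hl : IsLeaf G R x p) :
    ∀ σ < (n + 1) * 2 ^ k, ∀ τ < (n + 1) * 2 ^ k,
      ∀ σ' < (n + 1) * 2 ^ k, ∀ τ' < (n + 1) * 2 ^ k, ∀ S T,
      D (entry ((n + 1) * 2 ^ k) (ptr p) σ τ) = some S →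
      D (entry ((n + 1) * 2 ^ k) (ptr x) σ' τ') = some T → Disjoint S T := by
  intro σ hσ τ hτ σ' hσ' τ' hτ' S T hS hT
  exact (disjoint_cluster hl.2.2.1.ne').mono ((h.isTable p hl.2.1).subset hσ hτ hS)
    ((h.isTable x hl.1).subset hσ' hτ' hT)

/-- Merging a leaf into its neighbour. -/
theorem Progress.step (hG : G.Connected) (h : Progress G c j R root ptr D)
    (hl : IsLeaf G R x p) :
    Progress G c (j + 1) (R.erase x) (fun u => if root u = x then p else root u)
      (Function.update ptr p (n + j))
      (mergeSteps k (ptr p) (ptr x) (n + j) D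
        ((n + 1) * 2 ^ k * ((n + 1) * 2 ^ k) * ((n + 1) * 2 ^ k))) where
  contraction := h.contraction.contract hl
  card := by
    have h1 := h.card
    have h2 : 0 < R.card := Finset.card_pos.mpr ⟨x, hl.1⟩
    rw [Finset.card_erase_of_mem hl.1]
    omega
  ptr_lt v hv := by
    rw [Function.update_apply]
    split_ifs
    · omega
    · have := h.ptr_lt v (Finset.mem_of_mem_erase hv)
      omega
  isTable v hv := by
    have hp := h.ptr_lt p hl.2.1
    have hx := h.ptr_lt x hl.1
    have hpx := hl.2.2.1.ne'
    rw [Function.update_apply]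
    split_ifs with hvp
    · rw [hvp, cluster_contract_self]
      refine isTable_mergeSteps hG ?_ (disjoint_cluster hpx) (h.contraction.dist_cluster hl)
        (by omega) (by omega) D (h.isTable p hl.2.1) (h.isTable x hl.1) (h.empty _ le_rfl)
      simp [cluster, h.contraction.root_eq p hl.2.1]
    · rw [Finset.mem_erase] at hv
      have hv' := h.ptr_lt v hv.2
      rw [cluster_contract_of_ne hvp hv.1]
      intro σ τ hσ hτ
      simp only
      rw [mergeSteps_of_ne D (by omega) le_rfl (code_lt hσ) (code_lt hτ)]
      exact h.isTable v hv.2 σ τ hσ hτ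
  last := ⟨p, Finset.mem_erase.mpr ⟨hl.2.2.1.ne', hl.2.1⟩, by
    rw [Function.update_self]; omega⟩
  empty i hi σ hσ τ hτ := by
    rw [mergeSteps_of_ne D (by omega) le_rfl hσ hτ]
    exact h.empty i (by omega) σ hσ τ hτ

/-- When one vertex is left, the table with the largest number is that of the whole tree. -/
theorem Progress.isTable_univ (h : Progress G c (n - 1) R root ptr D) (hn : 0 < n) :
    ∃ r, IsTable G c Finset.univ r fun σ τ =>
      D (entry ((n + 1) * 2 ^ k) (2 * n - 2) σ τ) := by
  obtain ⟨r, hr, hp⟩ := h.last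
  have h1 := h.card
  obtain ⟨r', hR⟩ := Finset.card_eq_one.mp (show R.card = 1 by omega)
  have hcl : cluster root r = Finset.univ := by
    ext u
    have h2 := h.contraction.root_mem u
    rw [hR, Finset.mem_singleton] at h2 hr
    simp [cluster, h2, hr]
  have ht := h.isTable r hr
  rw [hcl, show ptr r = 2 * n - 2 by omega] at ht
  exact ⟨r, ht⟩

end Progress

end MinConsistentSubset

namespace WordRAM

open MinConsistentSubset MinConsistentSubset.Profile

section Main

variable {n k W : ℕ} {G : SimpleGraph (Fin n)} {c : Fin n → Fin k}

/-- Looks up the tables of the leaf in register `18` and of its neighbour in register `19`, removes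
the leaf, and makes the neighbour point to a fresh table. Pointers are stored plus one, so that
`0` can mark removed vertices. The number of the round is in register `9`. -/
def relinkProg : Prog :=
  .seq (.assign 10 (.load (.reg 4 + .reg 19) - .const 1)) <|
  .seq (.assign 11 (.load (.reg 4 + .reg 18) - .const 1)) <|
  .seq (.assign 12 (.reg 0 + .reg 9)) <|
  .seq (.store (.reg 4 + .reg 18) (.const 0))
  (.store (.reg 4 + .reg 19) (.reg 12 + .const 1))

theorem ends_relinkProg {j a b x p : ℕ} {s : State} (hW : Room n k W) (hs : Constants n k s)
    (h9 : s.reg 9 = j) (hj : j < n) (h18 : s.reg 18 = x) (h19 : s.reg 19 = p) (hx : x < n)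
    (hp : p < n) (ha : s.mem (n + n * n + p) = a + 1) (hb : s.mem (n + n * n + x) = b + 1)
    (han : a < 2 * n) (hbn : b < 2 * n) :
    Ends W relinkProg s 40 fun s' => (∀ y < 10, s'.reg y = s.reg y) ∧
      s'.reg 10 = a ∧ s'.reg 11 = b ∧ s'.reg 12 = n + j ∧
      ∀ q, s'.mem q = if q = n + n * n + p then n + j + 1
        else if q = n + n * n + x then 0 else s.mem q := by
  have h6 := hW.two
  have hw := hW.words
  have hcc := hW.card_codes
  have h3 : n + 1 ≤ (n + 1) * 2 ^ k := Nat.le_mul_of_pos_right _ (Nat.two_pow_pos k)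
  have g0 := hs.r0
  have g4 := hs.r4
  refine Ends.assign_seq (by simp [g4, h19, ha]; omega) (by simp) ?_
  refine Ends.assign_seq (by simp [g4, h18, hb]; omega) (by simp) ?_
  refine Ends.assign_seq (by simp [g0, h9]; omega) (by simp) ?_
  simp only [eval_sub, eval_add, eval_load, eval_reg, eval_const, reg_setReg, mem_setReg,
    Nat.reduceEqDiff, if_false, g4, h18, h19, ha, hb, g0, h9, OfNat.zero_ne_ofNat,
    Nat.add_sub_cancel, cost_sub, cost_add, cost_load, cost_reg, cost_const]
  refine Ends.seq (T₁ := 5) (Q := fun s' =>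
      s' = (((s.setReg 10 a).setReg 11 b).setReg 12 (n + j)).setMem (n + n * n + x) 0)
    (Ends.store ?_ (by simp) (by simp) ?_) (by simp) ?_
  · simp only [fits_add, fits_reg, eval_reg, reg_setReg, Nat.reduceEqDiff, if_false, g4, h18]
    omega
  · simp [g4, h18]
  rintro _ rfl
  refine Ends.store ?_ ?_ (by simp) ⟨fun y hy => ?_, ?_, ?_, ?_, fun q => ?_⟩
  · simp only [fits_add, fits_reg, eval_reg, reg_setReg, reg_setMem, Nat.reduceEqDiff, if_false,
      g4, h19]
    omega
  · simp only [fits_add, fits_reg, fits_const, eval_reg, eval_const, reg_setReg, reg_setMem,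
      if_true]
    omega
  · have : y ≠ 10 ∧ y ≠ 11 ∧ y ≠ 12 := by omega
    simp [this]
  · simp
  · simp
  · simp
  · simp [g4, h19]

/-- Merges a leaf into its neighbour; the number of the round is in register `9`. -/
def roundProg : Prog :=
  .seq findProg (.seq relinkProg combineProg)

/-- The memory describes the situation after `j` rounds. -/
def HoldsProgress (G : SimpleGraph (Fin n)) (c : Fin n → Fin k) (j : ℕ) (s : State) : Prop :=
  HoldsGraph s G ∧ ∃ R root ptr D, Progress G c j R root ptr D ∧ HoldsPointers s R ptr ∧
    Holds n k s D

theorem ends_roundProg {j : ℕ} {s : State} (hG : G.IsTree) (hW : Room n k W)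
    (hs : Constants n k s) (h9 : s.reg 9 = j) (hj : j < n - 1) (h : HoldsProgress G c j s) :
    Ends W roundProg s (n * (n * 30 + 40) +
      (n + 1) * 2 ^ k * ((n + 1) * 2 ^ k) * ((n + 1) * 2 ^ k) * (k * 120 + n * 30 + 408) + 60)
      fun s' => (∀ y < 10, s'.reg y = s.reg y) ∧ HoldsProgress G c (j + 1) s' := by
  obtain ⟨hg, R, root, ptr, D, hP, hR, hD⟩ := h
  have h6 := hW.two
  have hw := hW.words
  have hcc := hW.card_codes
  have h3 : n + 1 ≤ (n + 1) * 2 ^ k := Nat.le_mul_of_pos_right _ (Nat.two_pow_pos k)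
  have hcard := hP.card
  have hptr : ∀ v ∈ R, ptr v < 2 * n := fun v hv => by have := hP.ptr_lt v hv; omega
  have hleaf := hP.contraction.exists_isLeaf hG (by omega)
  refine Ends.seq (ends_findProg hW hs hg hR hptr hleaf) (by omega) ?_
  rintro s₁ ⟨k1, m1, x, p, hl, r18, r19⟩
  have g9 : s₁.reg 9 = j := (k1 9 (by norm_num)).trans h9
  have gx : s₁.mem (n + n * n + x) = ptr x + 1 := by rw [m1, hR x, if_pos hl.1]
  have gp : s₁.mem (n + n * n + p) = ptr p + 1 := by rw [m1, hR p, if_pos hl.2.1]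
  have hx := hP.ptr_lt x hl.1
  have hp := hP.ptr_lt p hl.2.1
  have hx2 := x.2
  have hp2 := p.2
  have hpx : (p : ℕ) ≠ x := fun h => hl.2.2.1.ne' (Fin.ext h)
  refine Ends.seq (ends_relinkProg hW (hs.congr fun y hy => k1 y (by omega)) g9 (by omega) r18
    r19 hx2 hp2 gp gx (by omega) (by omega)) (by omega) ?_
  rintro s₃ ⟨k2, f10, f11, f12, m3⟩
  rw [m1] at m3
  have c3 : Constants n k s₃ := hs.congr fun y hy => by rw [k2 y (by omega), k1 y (by omega)]
  have R3 : HoldsPointers s₃ (R.erase x) (Function.update ptr p (n + j)) := by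
    intro v
    rw [m3, Function.update_apply]
    by_cases hvp : v = p
    · rw [hvp, if_pos rfl, if_pos (Finset.mem_erase.mpr ⟨hl.2.2.1.ne', hl.2.1⟩), if_pos rfl]
    · have h1 : ¬ (n + n * n + (v : ℕ) = n + n * n + p) := fun h => hvp (Fin.ext (by omega))
      rw [if_neg h1, if_neg hvp]
      by_cases hvx : v = x
      · rw [hvx, if_pos rfl, if_neg (Finset.notMem_erase x R)]
      · have h2 : ¬ (n + n * n + (v : ℕ) = n + n * n + x) := fun h => hvx (Fin.ext (by omega))
        rw [if_neg h2, hR v]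
        simp only [Finset.mem_erase, hvx, ne_eq, not_false_eq_true, true_and]
  have D3 : Holds n k s₃ D := hD.congr fun a ha => by
    rw [m3, if_neg (by omega), if_neg (by omega)]
  have G3 : HoldsGraph s₃ G := fun u v => by
    have h1 : n * u + n ≤ n * n := by nlinarith [u.2]
    have h2 := v.2
    rw [m3, if_neg (by omega), if_neg (by omega)]
    exact hg u v
  refine Ends.mono (Ends.imp (ends_combineProg (i₁ := ptr p) (i₂ := ptr x) (i₃ := n + j) hW
    c3 D3 f10 f11 f12 (by omega) (by omega) (by omega) (by omega) (by omega) (hP.disjoint hl))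
    ?_) ?_
  · rintro s' ⟨e1, e2, e3⟩
    refine ⟨fun y hy => by rw [e1 y (by omega), k2 y hy, k1 y (by omega)], fun u v => ?_,
      _, _, _, _, hP.step hG.connected hl, fun v => ?_, e3⟩
    · have h1 : n * u + n ≤ n * n := by nlinarith [u.2]
      have h2 := v.2
      rw [e2 _ (by omega)]
      exact G3 u v
    · have := v.2
      rw [e2 _ (by omega)]
      exact R3 v
  · omega

/-- Selects a smallest set in the table of the whole tree, which has the number `2 * n - 2`, and
copies it to the output cells. Register `10` holds the address of the best entry so far; there `0`
stands for none, since it is not the address of an entry. -/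
def selectProg : Prog :=
  .seq (.assign 10 (.const 0)) <|
  .seq (forLoop 13 3 <|
    .seq (.assign 21 (addrExpr (.reg 0 + .reg 0 - .const 2) (.reg 13) (.reg 0 * .reg 2))) <|
    .ite (.load (.reg 21))
      (.ite (.reg 10)
        (.ite (.bin .lt (.load (.reg 21)) (.load (.reg 10))) (.assign 10 (.reg 21)) .skip)
        (.assign 10 (.reg 21)))
      .skip) <|
  forLoop 28 0 (.store (.reg 28) (.load (.reg 10 + .const 1 + .reg 28)))

theorem ends_selectProg {s : State} {D : Tables n} {r : Fin n} (hG : G.Connected)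
    (hW : Room n k W) (hs : Constants n k s) (hD : Holds n k s D)
    (hT : IsTable G c Finset.univ r fun σ τ => D (entry ((n + 1) * 2 ^ k) (2 * n - 2) σ τ)) :
    Ends W selectProg s ((n + 1) * 2 ^ k * 60 + n * 20 + 20) fun s' =>
      ∃ S : Finset (Fin n), IsOutput s' S ∧ IsMinConsistent G c S := by
  have h6 := hW.two
  have hw := hW.words
  have hpos := hW.pos
  have hcc := hW.card_codes
  have h3 : n + 1 ≤ (n + 1) * 2 ^ k := Nat.le_mul_of_pos_right _ (Nat.two_pow_pos k)
  have h4 : (n + 1) * 2 ^ k = n * 2 ^ k + 2 ^ k := by ring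
  have h5 := Nat.two_pow_pos k
  have hent : ∀ σ < (n + 1) * 2 ^ k, entry ((n + 1) * 2 ^ k) (2 * n - 2) σ (n * 2 ^ k) <
      2 * n * ((n + 1) * 2 ^ k) * ((n + 1) * 2 ^ k) := fun σ hσ =>
    entry_lt (by omega) hσ (by omega)
  refine Ends.assign_seq (by simp) (by simp) ?_
  simp only [cost_const, eval_const]
  refine Ends.seq (Ends.forLoop (N := (n + 1) * 2 ^ k) (T := 50)
    (fun i s' => (∀ y < 10, s'.reg y = s.reg y) ∧ s'.mem = s.mem ∧
      ((s'.reg 10 = 0 ∧ ∀ σ < i, D (entry ((n + 1) * 2 ^ k) (2 * n - 2) σ (n * 2 ^ k)) = none) ∨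
      ∃ σ < (n + 1) * 2 ^ k, ∃ S,
        D (entry ((n + 1) * 2 ^ k) (2 * n - 2) σ (n * 2 ^ k)) = some S ∧
        s'.reg 10 = addr n (entry ((n + 1) * 2 ^ k) (2 * n - 2) σ (n * 2 ^ k)) ∧
        ∀ σ' < i, ∀ S', D (entry ((n + 1) * 2 ^ k) (2 * n - 2) σ' (n * 2 ^ k)) = some S' →
          S.card ≤ S'.card)) (by omega) (by omega) ?_ ?_ ?_) (by omega) ?_
  · rintro i s' ⟨h, -⟩
    rw [h 3 (by norm_num), hs.r3]
  · refine ⟨fun y hy => ?_, by simp, Or.inl ⟨by simp, by simp⟩⟩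
    have : y ≠ 10 ∧ y ≠ 13 := by omega
    simp [this]
  · rintro i hi s' ⟨e1, e2, e3⟩ h13
    have c' : Constants n k s' := hs.congr fun y hy => e1 y (by omega)
    have hti : (Expr.reg 0 + .reg 0 - .const 2).eval s' = 2 * n - 2 := by
      simp only [eval_sub, eval_add, eval_reg, eval_const, c'.r0]; omega
    have htτ : (Expr.reg 0 * .reg 2).eval s' = n * 2 ^ k := by
      simp only [eval_mul, eval_reg, c'.r0, c'.r2]
    have hz : HoldsEntry s' _ _ := (hD.congr fun a _ => by rw [e2]) _ (hent i hi)
    have ha := hW.addr_add_le (hent i hi)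
    have hzle := hz.mem_le
    refine Ends.assign_seq (fits_addrExpr hW c' ?_ ?_ ?_ ?_ ?_ ?_) ?_ ?_
    · simp only [fits_sub, fits_add, fits_reg, fits_const, eval_reg, c'.r0]; omega
    · simp only [fits_reg, h13]; omega
    · simp only [fits_mul, fits_reg, eval_reg, c'.r0, c'.r2]; omega
    · rw [hti]; omega
    · simpa only [eval_reg, h13] using hi
    · rw [htτ]; omega
    · simp [addrExpr]
    rw [eval_addrExpr (σ := .reg 13) (σv := i) c' hti h13 htτ]
    set a := addr n (entry ((n + 1) * 2 ^ k) (2 * n - 2) i (n * 2 ^ k)) with hae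
    have hcost : (addrExpr (.reg 0 + .reg 0 - .const 2) (.reg 13) (.reg 0 * .reg 2)).cost = 21 :=
      rfl
    rw [hcost]
    have keep : ∀ y < 10, (s'.setReg 21 a).reg y = s.reg y := fun y hy => by
      have : y ≠ 21 := by omega
      simp [this, e1 y hy]
    have step : ∀ o, D (entry ((n + 1) * 2 ^ k) (2 * n - 2) i (n * 2 ^ k)) = o →
        ∀ S : Finset (Fin n), (∀ S', o = some S' → S.card ≤ S'.card) →
        (∀ σ' < i, ∀ S', D (entry ((n + 1) * 2 ^ k) (2 * n - 2) σ' (n * 2 ^ k)) = some S' →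
          S.card ≤ S'.card) →
        ∀ σ' < i + 1, ∀ S', D (entry ((n + 1) * 2 ^ k) (2 * n - 2) σ' (n * 2 ^ k)) = some S' →
          S.card ≤ S'.card := by
      rintro o rfl S h1 h2 σ' hσ' S' hS'
      rcases Nat.lt_succ_iff_lt_or_eq.mp hσ' with hlt | rfl
      · exact h2 σ' hlt S' hS'
      · exact h1 S' hS'
    refine Ends.ite ?_ (by simp) ?_ ?_
    · simp only [fits_load, fits_reg, eval_reg, reg_setReg, mem_setReg, if_true]; omega
    swap
    · intro h
      simp only [eval_load, eval_reg, reg_setReg, mem_setReg, if_true] at h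
      have hnone := hz.eq_zero_iff.mp h
      refine Ends.skip ⟨by simp [h13], fun y hy => ?_, by simp [e2], ?_⟩ (by simp)
      · have : y ≠ 13 := by omega
        rw [reg_setReg, if_neg this, keep y hy]
      · rcases e3 with ⟨h10, hno⟩ | ⟨σ, hσ, S, hS, h10, hmin⟩
        · refine Or.inl ⟨by simp [h10], fun σ hσ => ?_⟩
          rcases Nat.lt_succ_iff_lt_or_eq.mp hσ with hlt | rfl
          · exact hno σ hlt
          · exact hnone
        · exact Or.inr ⟨σ, hσ, S, hS, by simp [h10], step _ hnone S (by simp) hmin⟩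
    intro h
    simp only [eval_load, eval_reg, reg_setReg, mem_setReg, if_true] at h
    obtain ⟨T, hT⟩ := Option.ne_none_iff_exists'.mp (fun h0 => h (hz.eq_zero_iff.mpr h0))
    rw [hT] at hz
    have take : (∀ σ' < i, ∀ S',
          D (entry ((n + 1) * 2 ^ k) (2 * n - 2) σ' (n * 2 ^ k)) = some S' → T.card ≤ S'.card) →
        Ends W (.assign 10 (.reg 21)) (s'.setReg 21 a) 2 fun s' => s'.reg 13 = i ∧
          (∀ y < 10, (s'.setReg 13 (i + 1)).reg y = s.reg y) ∧
          (s'.setReg 13 (i + 1)).mem = s.mem ∧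
          (((s'.setReg 13 (i + 1)).reg 10 = 0 ∧ ∀ σ < i + 1,
            D (entry ((n + 1) * 2 ^ k) (2 * n - 2) σ (n * 2 ^ k)) = none) ∨
          ∃ σ < (n + 1) * 2 ^ k, ∃ S,
            D (entry ((n + 1) * 2 ^ k) (2 * n - 2) σ (n * 2 ^ k)) = some S ∧
            (s'.setReg 13 (i + 1)).reg 10 =
              addr n (entry ((n + 1) * 2 ^ k) (2 * n - 2) σ (n * 2 ^ k)) ∧
            ∀ σ' < i + 1, ∀ S',
              D (entry ((n + 1) * 2 ^ k) (2 * n - 2) σ' (n * 2 ^ k)) = some S' →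
              S.card ≤ S'.card) := by
      intro hle
      refine Ends.assign (by simp; omega) (by simp) ⟨by simp [h13], fun y hy => ?_, by simp [e2],
        Or.inr ⟨i, hi, T, hT, by simp [hae], step _ hT T (by simp) hle⟩⟩
      have : y ≠ 13 ∧ y ≠ 10 := by omega
      rw [reg_setReg, if_neg this.1, reg_setReg, if_neg this.2, keep y hy]
    rcases e3 with ⟨h10, hno⟩ | ⟨σ, hσ, S, hS, h10, hmin⟩
    · refine Ends.ite (by simp [h10]) (by simp) ?_ ?_
      · intro h'
        simp [h10] at h'
      · intro _
        refine Ends.mono (take fun σ' hσ' S' hS' => ?_) (by simp)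
        rw [hno σ' hσ'] at hS'
        cases hS'
    · have ha' := hW.addr_add_le (hent σ hσ)
      have hz' : HoldsEntry s' _ _ := (hD.congr fun a _ => by rw [e2]) _ (hent σ hσ)
      have hzle' := hz'.mem_le
      rw [hS] at hz'
      refine Ends.ite (by simp [h10]; omega) (by simp) ?_ ?_
      swap
      · intro h'
        simp only [eval_reg, reg_setReg, Nat.reduceEqDiff, if_false, h10] at h'
        unfold addr at h'
        omega
      intro _
      refine Ends.ite ?_ (by simp) ?_ ?_
      · simp only [fits_lt, fits_load, fits_reg, eval_load, eval_reg, reg_setReg, mem_setReg,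
          Nat.reduceEqDiff, if_true, if_false, h10]
        exact ⟨⟨by omega, by omega⟩, ⟨by omega, by omega⟩, ite_one_le (by omega) _⟩
      · intro hlt
        simp only [eval_lt, eval_load, eval_reg, reg_setReg, mem_setReg, Nat.reduceEqDiff,
          if_true, if_false, h10, hz'.1, hz.1] at hlt
        have hlt : T.card ≤ S.card := by
          by_contra h'
          apply hlt
          rw [if_neg (by omega)]
        exact Ends.mono (take fun σ' hσ' S' hS' => hlt.trans (hmin σ' hσ' S' hS')) (by simp)
      · intro hlt
        simp only [eval_lt, eval_load, eval_reg, reg_setReg, mem_setReg, Nat.reduceEqDiff,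
          if_true, if_false, h10, hz'.1, hz.1] at hlt
        have hlt : S.card ≤ T.card := by
          by_contra h'
          rw [if_pos (by omega)] at hlt
          exact one_ne_zero hlt
        refine Ends.skip ⟨by simp [h13], fun y hy => ?_, by simp [e2], Or.inr ⟨σ, hσ, S, hS,
          by simp [h10], step _ hT S (by simpa using hlt) hmin⟩⟩ (by simp)
        have : y ≠ 13 := by omega
        rw [reg_setReg, if_neg this, keep y hy]
  rintro s₁ ⟨k1, m1, h1⟩
  obtain ⟨σ₀, hσ₀, S₀, hS₀⟩ := hT.exists_some hG
  obtain ⟨σ, hσ, S, hS, h10, hmin⟩ : ∃ σ < (n + 1) * 2 ^ k, ∃ S,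
        D (entry ((n + 1) * 2 ^ k) (2 * n - 2) σ (n * 2 ^ k)) = some S ∧
        s₁.reg 10 = addr n (entry ((n + 1) * 2 ^ k) (2 * n - 2) σ (n * 2 ^ k)) ∧
        ∀ σ' < (n + 1) * 2 ^ k, ∀ S',
          D (entry ((n + 1) * 2 ^ k) (2 * n - 2) σ' (n * 2 ^ k)) = some S' →
          S.card ≤ S'.card := by
    rcases h1 with ⟨-, h1⟩ | h1
    · rw [h1 σ₀ hσ₀] at hS₀
      cases hS₀
    · exact h1
  have ha := hW.addr_add_le (hent σ hσ)
  have hz := hD _ (hent σ hσ)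
  rw [hS] at hz
  set a := addr n (entry ((n + 1) * 2 ^ k) (2 * n - 2) σ (n * 2 ^ k)) with hae
  have hna : n ≤ a := by rw [hae]; unfold addr; omega
  refine Ends.mono (Ends.imp (Ends.forLoop (N := n) (T := 12)
    (fun i s' => s'.reg 0 = n ∧ s'.reg 10 = a ∧ (∀ p, n ≤ p → s'.mem p = s.mem p) ∧
      ∀ v : Fin n, (v : ℕ) < i → s'.mem v = if v ∈ S then 1 else 0) (by omega) (by omega)
      ?_ ?_ ?_) ?_) (by omega)
  · rintro i s' ⟨h, -⟩
    exact h
  · refine ⟨?_, ?_, ?_, by simp⟩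
    · simp [k1 0 (by norm_num), hs.r0]
    · simp [h10]
    · simp [m1]
  · rintro i hi s' ⟨e0, e1, e2, e3⟩ h28
    have hv : s'.mem (a + 1 + i) = if (⟨i, hi⟩ : Fin n) ∈ S then 1 else 0 := by
      rw [e2 _ (by omega)]
      exact hz.2 ⟨i, hi⟩
    have hbnd := ite_one_le (W := 1) le_rfl ((⟨i, hi⟩ : Fin n) ∈ S)
    refine Ends.store ?_ ?_ (by simp) ⟨by simp [h28], by simp [e0], by simp [e1], ?_, ?_⟩
    · simp only [fits_reg, h28]; omega
    · simp only [fits_load, fits_add, fits_reg, fits_const, eval_add, eval_reg, eval_const, e1,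
        h28, hv]
      omega
    · intro p hp
      have : p ≠ i := by omega
      simp [h28, this, e2 p hp]
    · intro v hvi
      by_cases hv' : (v : ℕ) = i
      · obtain rfl : v = ⟨i, hi⟩ := Fin.ext hv'
        simp [h28, e1, hv]
      · simp [h28, hv', e3 v (by omega)]
  · rintro s' ⟨-, -, -, e3⟩
    exact ⟨S, fun v => e3 v v.2, hT.isMinConsistent hG hσ hS hmin⟩

/-- Computes the constants in the registers `2, …, 8`. -/
def constantsProg : Prog :=
  .seq (powProg 1 2) <|
  .seq (.assign 3 ((.reg 0 + .const 1) * .reg 2)) <|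
  .seq (.assign 4 (.reg 0 + .reg 0 * .reg 0)) <|
  .seq (.assign 5 (.reg 4 + .reg 0)) <|
  .seq (.assign 6 (.reg 3 * .reg 3 * .reg 3)) <|
  .seq (.assign 7 (.reg 0 * .reg 3 * .reg 3)) <|
  .assign 8 (.reg 0 - .const 1)

theorem ends_constantsProg {s : State} (hW : Room n k W) (h0 : s.reg 0 = n) (h1 : s.reg 1 = k) :
    Ends W constantsProg s (k * 12 + 60) fun s' => Constants n k s' ∧ s'.mem = s.mem := by
  have h6 := hW.two
  have hw := hW.words
  have hpos := hW.pos
  have hcc := hW.card_codes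
  have hcube := hW.cube
  have h2 := hW.two_pow
  have h3 : n + 1 ≤ (n + 1) * 2 ^ k := Nat.le_mul_of_pos_right _ (Nat.two_pow_pos k)
  refine Ends.seq (ends_powProg (by norm_num) (by norm_num) (by norm_num) h1 h6 (by omega))
    (by omega) ?_
  rintro s₁ ⟨r2, k1, m1⟩
  have r0 : s₁.reg 0 = n := (k1 0 (by norm_num) (by norm_num)).trans h0
  have r1 : s₁.reg 1 = k := (k1 1 (by norm_num) (by norm_num)).trans h1
  have hMM : (n + 1) * 2 ^ k * ((n + 1) * 2 ^ k) ≤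
      (n + 1) * 2 ^ k * ((n + 1) * 2 ^ k) * ((n + 1) * 2 ^ k) :=
    Nat.le_mul_of_pos_right _ (by omega)
  have hnM : n * ((n + 1) * 2 ^ k) ≤ (n + 1) * 2 ^ k * ((n + 1) * 2 ^ k) :=
    Nat.mul_le_mul_right _ (by omega)
  have hnMM : n * ((n + 1) * 2 ^ k) * ((n + 1) * 2 ^ k) ≤
      (n + 1) * 2 ^ k * ((n + 1) * 2 ^ k) * ((n + 1) * 2 ^ k) :=
    Nat.mul_le_mul_right _ hnM
  generalize hM : (n + 1) * 2 ^ k = M at *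
  refine Ends.assign_seq (by simp [r0, r2]; omega) (by simp) ?_
  refine Ends.assign_seq (by simp [r0]; omega) (by simp) ?_
  refine Ends.assign_seq (by simp [r0]; omega) (by simp) ?_
  refine Ends.assign_seq (by simp [r0, r2, hM]; omega) (by simp) ?_
  refine Ends.assign_seq (by simp [r0, r2, hM]; omega) (by simp) ?_
  refine Ends.assign (by simp [r0]; omega) (by simp) ⟨?_, by simp [m1]⟩
  constructor <;> simp [r0, r1, r2, hM]

/-- The dynamic programme for minimum consistent subsets of trees. -/
def mainProg : Prog :=
  .seq constantsProg <|
  .seq initProg <|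
  .seq (forLoop 9 8 roundProg)
  selectProg

/-- A bound for the running time of the program. -/
def runtime (n k : ℕ) : ℕ :=
  k * 12 + 60 +
  (n * ((n + 1) * 2 ^ k) * ((n + 1) * 2 ^ k) * (k * 12 + n * 30 + 108) + n * 16 + 12) +
  ((n - 1) * (n * (n * 30 + 40) + (n + 1) * 2 ^ k * ((n + 1) * 2 ^ k) * ((n + 1) * 2 ^ k) *
    (k * 120 + n * 30 + 408) + 60 + 8) + 6) +
  ((n + 1) * 2 ^ k * 60 + n * 20 + 20)

open Classical in
theorem mem_inputState_colour (v : Fin n) : (inputState G c).mem v = c v := by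
  simp [inputState]

open Classical in
theorem holdsGraph_inputState : HoldsGraph (inputState G c) G := by
  intro u v
  have hn : 0 < n := u.pos
  have h1 : ¬ n + n * (u : ℕ) + v < n := by omega
  simp only [inputState, h1, dif_neg, not_false_eq_true]
  refine if_congr ⟨?_, fun h => ⟨u, v, rfl, h⟩⟩ rfl rfl
  rintro ⟨u', v', h, hadj⟩
  have h2 : n * (u : ℕ) + v = n * u' + v' := by omega
  have hu : (u : ℕ) = u' := by
    have := congrArg (· / n) h2
    simpa [Nat.mul_add_div hn, Nat.div_eq_of_lt v.2, Nat.div_eq_of_lt v'.2] using this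
  have hv : (v : ℕ) = v' := by rw [hu] at h2; omega
  rwa [Fin.ext hu, Fin.ext hv]

theorem mem_inputState_of_le {p : ℕ} (hp : n + n * n ≤ p) : (inputState G c).mem p = 0 := by
  classical
  have h1 : ¬ p < n := by omega
  simp only [inputState, h1, dif_neg, not_false_eq_true]
  rw [if_neg]
  rintro ⟨u, v, rfl, -⟩
  have h2 : n * (u : ℕ) + n ≤ n * n := by nlinarith [u.2]
  have := v.2
  omega

theorem ends_mainProg (hG : G.IsTree) (hW : Room n k W) :
    Ends W mainProg (inputState G c) (runtime n k) fun s' =>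
      ∃ S : Finset (Fin n), IsOutput s' S ∧ IsMinConsistent G c S := by
  have hpos := hW.pos
  have h6 := hW.two
  have hcc := hW.card_codes
  have h3 : n + 1 ≤ (n + 1) * 2 ^ k := Nat.le_mul_of_pos_right _ (Nat.two_pow_pos k)
  unfold runtime
  refine Ends.seq (ends_constantsProg (n := n) (k := k) hW (by simp [inputState])
    (by simp [inputState])) (by omega) ?_
  rintro s₁ ⟨c1, m1⟩
  refine Ends.seq (ends_initProg (c := c) hW c1
    (fun v => by rw [m1]; exact mem_inputState_colour v)
    (fun p hp => by rw [m1]; exact mem_inputState_of_le hp)) (by omega) ?_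
  rintro s₂ ⟨c2, m2, P2, D2⟩
  refine Ends.seq (Ends.forLoop (N := n - 1) (T := n * (n * 30 + 40) +
      (n + 1) * 2 ^ k * ((n + 1) * 2 ^ k) * ((n + 1) * 2 ^ k) * (k * 120 + n * 30 + 408) + 60)
    (fun j s' => (∀ y < 9, s'.reg y = s₂.reg y) ∧
    HoldsProgress G c j s') (by omega) (by omega) ?_ ?_ ?_) ?_ ?_
  · rintro i s' ⟨h, -⟩
    rw [h 8 (by norm_num), c2.r8]
  · refine ⟨fun y hy => ?_, fun u v => ?_, Finset.univ, id, fun v => (v : ℕ), initEntry k c,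
      Progress.init hG.connected hpos, fun v => by simpa using P2 v, D2.congr fun _ _ => by simp⟩
    · have : y ≠ 9 := by omega
      simp [this]
    · have h1 : n * (u : ℕ) + n ≤ n * n := by nlinarith [u.2]
      have := v.2
      rw [mem_setReg, m2 _ (by omega), m1]
      exact holdsGraph_inputState u v
  · rintro j hj s' ⟨e1, e2⟩ h9
    refine Ends.imp (ends_roundProg hG hW (c2.congr e1) h9 hj e2) ?_
    rintro s'' ⟨k1, hP⟩
    refine ⟨(k1 9 (by norm_num)).trans h9, fun y hy => ?_, ?_⟩
    · have : y ≠ 9 := by omega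
      simp [this, k1 y (by omega), e1 y hy]
    · obtain ⟨hg, R, root, ptr, D, hP, hR, hD⟩ := hP
      exact ⟨fun u v => by simpa using hg u v, R, root, ptr, D, hP,
        fun v => by simpa using hR v, hD.congr fun _ _ => by simp⟩
  · omega
  · rintro s₃ ⟨e1, -, R, root, ptr, D, hP, -, hD⟩
    obtain ⟨r, hT⟩ := hP.isTable_univ hpos
    exact Ends.mono (ends_selectProg hG.connected hW (c2.congr e1) hD hT) (by omega)

end Main

/-! ### The bound -/

section Bound

variable {n k : ℕ}

theorem monomial_le (hn : 0 < n) {a b : ℕ} (ha : a ≤ 5) (hb : b ≤ 4) :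
    n ^ a * (2 ^ k) ^ b ≤ n ^ 5 * (2 ^ k) ^ 4 :=
  Nat.mul_le_mul (Nat.pow_le_pow_right hn ha) (Nat.pow_le_pow_right (Nat.two_pow_pos k) hb)

theorem card_codes_le (hn : 0 < n) : (n + 1) * 2 ^ k ≤ 2 * (n * 2 ^ k) := by
  have : n + 1 ≤ 2 * n := by omega
  calc (n + 1) * 2 ^ k ≤ 2 * n * 2 ^ k := Nat.mul_le_mul_right _ this
    _ = _ := by ring

theorem room_of_le {W : ℕ} (hn : 0 < n) (hW : 20 * (n ^ 5 * (2 ^ k) ^ 4) ≤ W) :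
    Room n k W where
  pos := hn
  two := by
    have := monomial_le (n := n) (k := k) (a := 0) (b := 0) hn (by norm_num) (by norm_num)
    simp only [pow_zero, mul_one] at this
    omega
  words := by
    refine le_trans ?_ hW
    have hM := card_codes_le (k := k) hn
    have h1 := monomial_le (n := n) (k := k) (a := 1) (b := 0) hn (by norm_num) (by norm_num)
    have h2 := monomial_le (n := n) (k := k) (a := 2) (b := 0) hn (by norm_num) (by norm_num)
    have h3 := monomial_le (n := n) (k := k) (a := 4) (b := 2) hn (by norm_num) (by norm_num)
    calc n + n * n + n + 2 * n * ((n + 1) * 2 ^ k) * ((n + 1) * 2 ^ k) * (n + 1)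
        ≤ n + n * n + n + 2 * n * (2 * (n * 2 ^ k)) * (2 * (n * 2 ^ k)) * (2 * n) := by
          gcongr; omega
      _ = 2 * (n ^ 1 * (2 ^ k) ^ 0) + n ^ 2 * (2 ^ k) ^ 0 + 16 * (n ^ 4 * (2 ^ k) ^ 2) := by ring
      _ ≤ _ := by omega
  cube := by
    refine le_trans ?_ hW
    have hM := card_codes_le (k := k) hn
    have h1 := monomial_le (n := n) (k := k) (a := 3) (b := 3) hn (by norm_num) (by norm_num)
    calc (n + 1) * 2 ^ k * ((n + 1) * 2 ^ k) * ((n + 1) * 2 ^ k)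
        ≤ (2 * (n * 2 ^ k)) * (2 * (n * 2 ^ k)) * (2 * (n * 2 ^ k)) := by gcongr
      _ = 8 * (n ^ 3 * (2 ^ k) ^ 3) := by ring
      _ ≤ _ := by omega

theorem runtime_le (hn : 0 < n) : runtime n k ≤ 10000 * (n ^ 5 * (2 ^ k) ^ 4) := by
  have hM := card_codes_le (k := k) hn
  have hk : k ≤ n * 2 ^ k :=
    (Nat.lt_two_pow_self (n := k)).le.trans (Nat.le_mul_of_pos_left _ hn)
  have hnK : n ≤ n * 2 ^ k := Nat.le_mul_of_pos_right _ (Nat.two_pow_pos k)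
  have b1 : k * 12 + n * 30 + 108 ≤ 150 * (n * 2 ^ k) := by omega
  have b2 : k * 120 + n * 30 + 408 ≤ 558 * (n * 2 ^ k) := by omega
  have b3 : n * 30 + 40 ≤ 70 * n := by omega
  have m := fun a b ha hb => monomial_le (n := n) (k := k) (a := a) (b := b) hn ha hb
  have m00 := m 0 0 (by norm_num) (by norm_num)
  have m10 := m 1 0 (by norm_num) (by norm_num)
  have m11 := m 1 1 (by norm_num) (by norm_num)
  have m30 := m 3 0 (by norm_num) (by norm_num)
  have m43 := m 4 3 (by norm_num) (by norm_num)
  unfold runtime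
  calc _ ≤ n * 2 ^ k * 12 + 60 +
      (n * (2 * (n * 2 ^ k)) * (2 * (n * 2 ^ k)) * (150 * (n * 2 ^ k)) + n * 16 + 12) +
      (n * (n * (70 * n) + 2 * (n * 2 ^ k) * (2 * (n * 2 ^ k)) * (2 * (n * 2 ^ k)) *
        (558 * (n * 2 ^ k)) + 60 + 8) + 6) +
      (2 * (n * 2 ^ k) * 60 + n * 20 + 20) := by
        gcongr
        exact Nat.sub_le n 1
    _ = 132 * (n ^ 1 * (2 ^ k) ^ 1) + 98 * (n ^ 0 * (2 ^ k) ^ 0) +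
        600 * (n ^ 4 * (2 ^ k) ^ 3) + 104 * (n ^ 1 * (2 ^ k) ^ 0) + 70 * (n ^ 3 * (2 ^ k) ^ 0) +
        4464 * (n ^ 5 * (2 ^ k) ^ 4) := by ring
    _ ≤ _ := by omega

end Bound

end WordRAM

theorem theorem1 :
    ∃ (P : WordRAM.Prog) (C : ℕ),
      ∀ (n k : ℕ) (G : SimpleGraph (Fin n)) (c : Fin n → Fin k), G.IsTree →
        ∃ (t : ℕ) (s : WordRAM.State) (S : Finset (Fin n)),
          WordRAM.Exec (C * (2 ^ (4 * k) * n ^ (2 * k + 3))) P (WordRAM.inputState G c) t s ∧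
          t ≤ C * (2 ^ (4 * k) * n ^ (2 * k + 3)) ∧
          WordRAM.IsOutput s S ∧
          MinConsistentSubset.IsMinConsistent G c S := by
  refine ⟨WordRAM.mainProg, 10000, fun n k G c hG => ?_⟩
  obtain ⟨v⟩ := hG.connected.nonempty
  have hn : 0 < n := v.pos
  -- the tree has a vertex and the vertex has a colour, so `5 ≤ 2 * k + 3`
  have hk : 0 < k := (c v).pos
  have hX : n ^ 5 * (2 ^ k) ^ 4 ≤ 2 ^ (4 * k) * n ^ (2 * k + 3) := by
    rw [← pow_mul, mul_comm k 4, mul_comm]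
    exact Nat.mul_le_mul_left _ (Nat.pow_le_pow_right hn (by omega))
  obtain ⟨t, s, h, ht, S, hS, hmin⟩ := WordRAM.ends_mainProg (c := c)
    (W := 10000 * (2 ^ (4 * k) * n ^ (2 * k + 3))) hG (WordRAM.room_of_le hn (by omega))
  exact ⟨t, s, S, h, (ht.trans (WordRAM.runtime_le hn)).trans (Nat.mul_le_mul_left _ hX), hS, hmin⟩
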